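/- **Lemma C.1.** Let $V:\mathbb R^2\to\mathbb R$ be a real-valued potential with $V\in L^q(\mathbb R^2)$ for some $q\in(1,\infty]$, and let $0<\alpha<\beta<1$. Let $H=-\Delta+V$ be the Schrödinger operator in the complex space $L^1(\mathbb R^2)$ with domain $\{u\in L^1:\Delta u\in L^1,\ Vu\in L^1\}$ ($\Delta$ in the sense of distributions), and let $\langle H\rangle^\alpha=(1+H^2)^{\alpha/2}$, where $\langle x\rangle=\sqrt{1+x^2}$. Here the fractional powers of a positive operator $A$ in a Banach space (i.e. $(-\infty,0]$ lies in the resolvent set and $\|(A+t)^{-1}\|\le M/(1+t)$ for all $t\ge 0$) are, for $0<p<1$, $A^{-p}=\frac{\sin \pi p}{\pi}\int_0^\infty t^{-p}(A+t)^{-1}\,dt$ and $A^p=(A^{-p})^{-1}$ with domain the range of $A^{-p}$. Let $(-\Delta+1)^{-\beta}$ be the Fourier multiplier with symbol $(1+|\xi|^2)^{-\beta}$. Then $1+H^2$ is a positive operator in $L^1(\mathbb R^2)$ and $(1+H^2)^{-\alpha/2}$ is injective, so that $\langle H\rangle^\alpha$ is well defined; and there is a constant $C$, depending on $V,\alpha,\beta$,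 such that for every $f\in L^1(\mathbb R^2)$ the function $(-\Delta+1)^{-\beta}f$ belongs to $L^1(\mathbb R^2)$ and to the domain of $\langle H\rangle^\alpha$, and $$\|\langle H\rangle^\alpha(-\Delta+1)^{-\beta}f\|_{L^1}\le C\,\|f\|_{L^1}.$$ -/

import Mathlib

open MeasureTheory Set
open scoped ENNReal SchwartzMap Laplacian

noncomputable section

namespace SchrodingerL1

/-! ### Unbounded operators on a complex Banach space and their fractional powers -/

section Abstract

variable {X : Type*} [NormedAddCommGroup X] [NormedSpace ℂ X]

/-- The graph of the square of an operator `A`: the pairs `(u, A (A u))`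
with `u ∈ D(A)` and `A u ∈ D(A)`. -/
def sqGraph (A : X →ₗ.[ℂ] X) : Submodule ℂ (X × X) where
  carrier := {p | ∃ v, (p.1, v) ∈ A.graph ∧ (v, p.2) ∈ A.graph}
  zero_mem' := ⟨0, A.graph.zero_mem, A.graph.zero_mem⟩
  add_mem' := by
    rintro p p' ⟨v, h₁, h₂⟩ ⟨v', h₁', h₂'⟩
    exact ⟨v + v', A.graph.add_mem h₁ h₁', A.graph.add_mem h₂ h₂'⟩
  smul_mem' := by
    rintro c p ⟨v, h₁, h₂⟩
    exact ⟨c • v, A.graph.smul_mem c h₁, A.graph.smul_mem c h₂⟩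

/-- The square `A²` on its natural domain. -/
def sq (A : X →ₗ.[ℂ] X) : X →ₗ.[ℂ] X := (sqGraph A).toLinearPMap

theorem mem_sq_graph (A : X →ₗ.[ℂ] X) (u w : X) :
    (u, w) ∈ (sq A).graph ↔ ∃ v, (u, v) ∈ A.graph ∧ (v, w) ∈ A.graph := by
  rw [sq, Submodule.toLinearPMap_graph_eq]
  · rfl
  · rintro ⟨x, y⟩ ⟨v, h₁, h₂⟩ hx
    have hv : v = 0 := A.graph_fst_eq_zero_snd h₁ hx
    exact A.graph_fst_eq_zero_snd h₂ hv

/-- The operator `c + A` (that is, `u ↦ c u + A u`) with domain `D(A)`. -/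
def shift (c : ℂ) (A : X →ₗ.[ℂ] X) : X →ₗ.[ℂ] X :=
  (c • (LinearMap.id : X →ₗ[ℂ] X)) +ᵥ A

/-- `R` is the bounded, everywhere defined inverse of the operator `A`:
`R x = u` exactly when `u ∈ D(A)` and `A u = x`. -/
def IsBoundedInverse (A : X →ₗ.[ℂ] X) (R : X →L[ℂ] X) : Prop :=
  ∀ u x, (u, x) ∈ A.graph ↔ R x = u

open Classical in
/-- The bounded inverse `A⁻¹` (with value `0` if there is none). -/
def boundedInverse (A : X →ₗ.[ℂ] X) : X →L[ℂ] X :=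
  if h : ∃ R, IsBoundedInverse A R then h.choose else 0

/-- `A` is a positive operator in the Banach space `X`: the half-line `(-∞, 0]` lies in the
resolvent set of `A`, and `‖(A + t)⁻¹‖ ≤ M / (1 + t)` for all `t ≥ 0`. -/
def IsPositiveOperator (A : X →ₗ.[ℂ] X) : Prop :=
  ∃ M : ℝ, ∀ t : ℝ, 0 ≤ t →
    ∃ R : X →L[ℂ] X, IsBoundedInverse (shift (t : ℂ) A) R ∧ ‖R‖ ≤ M / (1 + t)

/-- The negative fractional power of a positive operator, for `0 < p < 1`:
`A ^ (-p) = (sin (π p) / π) ∫₀^∞ t ^ (-p) (A + t)⁻¹ dt`. -/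
def negPow (A : X →ₗ.[ℂ] X) (p : ℝ) : X →L[ℂ] X :=
  ((Real.sin (Real.pi * p) / Real.pi : ℝ) : ℂ) •
    ∫ t in Ioi (0 : ℝ), ((t ^ (-p) : ℝ) : ℂ) • boundedInverse (shift (t : ℂ) A)

/-- The fractional power `A ^ p` of a positive operator, for `0 < p < 1`: the inverse of the
injective bounded operator `A ^ (-p)`, whose domain is the range of `A ^ (-p)`. -/
def fracPow (A : X →ₗ.[ℂ] X) (p : ℝ) : X →ₗ.[ℂ] X :=
  ((negPow A p : X →ₗ[ℂ] X).toPMap ⊤).inverse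

end Abstract

/-! ### The Schrödinger operator in `L¹(ℝ²)` -/

/-- The plane `ℝ²` with its Euclidean norm. -/
abbrev Plane : Type := EuclideanSpace ℝ (Fin 2)

/-- The space `L¹(ℝ²)` of complex-valued functions. -/
abbrev L1 : Type := Lp ℂ 1 (volume : Measure Plane)

/-- The graph of the Laplacian in `L¹`: the pairs `(u, w)` of `L¹` functions with `Δ u = w`
in the sense of (tempered) distributions. -/
def laplacianGraph : Submodule ℂ (L1 × L1) where
  carrier := {p | Δ (Lp.toTemperedDistributionCLM ℂ volume 1 p.1) =
    Lp.toTemperedDistributionCLM ℂ volume 1 p.2}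
  zero_mem' := by
    simp only [mem_ofPred_eq, Prod.fst_zero, Prod.snd_zero, map_zero]
    rw [← TemperedDistribution.laplacianCLM_apply, map_zero]
  add_mem' := by
    rintro p p' h h'
    simp only [mem_ofPred_eq, Prod.fst_add, Prod.snd_add, map_add,
      ← TemperedDistribution.laplacianCLM_apply] at h h' ⊢
    rw [h, h']
  smul_mem' := by
    rintro c p h
    simp only [mem_ofPred_eq, Prod.smul_fst, Prod.smul_snd, map_smul,
      ← TemperedDistribution.laplacianCLM_apply] at h ⊢
    rw [h]

/-- The Laplacian in `L¹`, with domain `{u ∈ L¹ : Δ u ∈ L¹}`. -/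
def laplacianL1 : L1 →ₗ.[ℂ] L1 := laplacianGraph.toLinearPMap

theorem mem_laplacianL1_graph (u w : L1) :
    (u, w) ∈ laplacianL1.graph ↔
      Δ (Lp.toTemperedDistributionCLM ℂ volume 1 u) =
        Lp.toTemperedDistributionCLM ℂ volume 1 w := by
  rw [laplacianL1, Submodule.toLinearPMap_graph_eq]
  · rfl
  · rintro ⟨x, y⟩ h hx
    obtain rfl : x = 0 := hx
    change Δ (Lp.toTemperedDistributionCLM ℂ volume 1 (0 : L1)) =
      Lp.toTemperedDistributionCLM ℂ volume 1 y at h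
    rw [map_zero, ← TemperedDistribution.laplacianCLM_apply, map_zero] at h
    have hk := Lp.ker_toTemperedDistributionCLM_eq_bot (F := ℂ) (E := Plane)
      (μ := volume) (p := 1)
    rw [LinearMap.ker_eq_bot'] at hk
    exact hk y h.symm

/-- The graph of multiplication by `V` in `L¹`. -/
def mulGraph (V : Plane → ℝ) : Submodule ℂ (L1 × L1) where
  carrier := {p | ⇑p.2 =ᵐ[volume] fun x => (V x : ℂ) * p.1 x}
  zero_mem' := by
    change ⇑(0 : L1) =ᵐ[volume] fun x => (V x : ℂ) * (0 : L1) x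
    filter_upwards with x
    simp
  add_mem' := by
    rintro p p' h h'
    change ⇑(p.2 + p'.2) =ᵐ[volume] fun x => (V x : ℂ) * (p.1 + p'.1) x
    filter_upwards [h, h', Lp.coeFn_add p.1 p'.1, Lp.coeFn_add p.2 p'.2] with x h₁ h₂ h₃ h₄
    rw [h₃, h₄, Pi.add_apply, Pi.add_apply, h₁, h₂, mul_add]
  smul_mem' := by
    rintro c p h
    change ⇑(c • p.2) =ᵐ[volume] fun x => (V x : ℂ) * (c • p.1) x
    filter_upwards [h, Lp.coeFn_smul c p.1, Lp.coeFn_smul c p.2] with x h₁ h₂ h₃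
    simp only [h₁, h₂, h₃, Pi.smul_apply, smul_eq_mul]
    ring

/-- Multiplication by `V` in `L¹`, with domain `{u ∈ L¹ : V u ∈ L¹}`. -/
def mulL1 (V : Plane → ℝ) : L1 →ₗ.[ℂ] L1 := (mulGraph V).toLinearPMap

theorem mem_mulL1_graph (V : Plane → ℝ) (u w : L1) :
    (u, w) ∈ (mulL1 V).graph ↔ ⇑w =ᵐ[volume] fun x => (V x : ℂ) * u x := by
  rw [mulL1, Submodule.toLinearPMap_graph_eq]
  · rfl
  · rintro ⟨x, y⟩ h hx
    obtain rfl : x = 0 := hx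
    change ⇑y =ᵐ[volume] fun z => (V z : ℂ) * (0 : L1) z at h
    refine (Lp.eq_zero_iff_ae_eq_zero).2 ?_
    filter_upwards [h] with z h₁
    simp [h₁]

/-- The Schrödinger operator `H = -Δ + V` in `L¹(ℝ²)`,
with domain `{u ∈ L¹ : Δ u ∈ L¹ and V u ∈ L¹}`. -/
def schrodinger (V : Plane → ℝ) : L1 →ₗ.[ℂ] L1 := -laplacianL1 + mulL1 V

/-- The operator `1 + H²`. -/
def oneAddSq (V : Plane → ℝ) : L1 →ₗ.[ℂ] L1 := shift 1 (sq (schrodinger V))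

/-- The operator `⟨H⟩ ^ α = (1 + H²) ^ (α / 2)`, where `⟨x⟩ = √(1 + x²)`. -/
def japanesePow (V : Plane → ℝ) (α : ℝ) : L1 →ₗ.[ℂ] L1 := fracPow (oneAddSq V) (α / 2)

/-- The symbol of `(-Δ + 1) ^ (-β)`; since the Fourier transform is normalized with the kernel
`e ^ (-2 π i x ξ)`, this is `(1 + |2 π ξ|²) ^ (-β)`. -/
def besselSymbol (β : ℝ) (ξ : Plane) : ℂ := (((1 + ‖(2 * Real.pi) • ξ‖ ^ 2) ^ (-β) : ℝ) : ℂ)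

theorem besselSymbol_hasTemperateGrowth (β : ℝ) :
    (besselSymbol β).HasTemperateGrowth := by
  have h := (Function.hasTemperateGrowth_one_add_norm_sq_rpow Plane (-β)).comp
    ((2 * Real.pi) • ContinuousLinearMap.id ℝ Plane).hasTemperateGrowth
  exact Complex.ofRealCLM.hasTemperateGrowth.comp h

/-- `u = (-Δ + 1) ^ (-β) f` for `u, f ∈ L¹`, in the sense of Fourier multipliers. -/
def IsBesselPotential (β : ℝ) (f u : L1) : Prop :=
  Lp.toTemperedDistributionCLM ℂ volume 1 u =
    TemperedDistribution.fourierMultiplierCLM ℂ (besselSymbol β)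
      (Lp.toTemperedDistributionCLM ℂ volume 1 f)

end SchrodingerL1

end

/-
Since `t + 1 + H² = (H + i s) (H - i s)` with `s = √(1 + t)`, positivity of `1 + H²` amounts to
`‖(H ± i s)⁻¹‖ = O(1 / s)` in `L¹` for `s ≥ 1`. For large `s` this is perturbation theory: the
kernel of `(-Δ + z)⁻¹` is a Laplace transform of the heat kernel, and `V ∈ L^q` with `q > 1` makes
`V (-Δ + z)⁻¹` small in `L¹`. Bounded `s` is reached by continuation in `s`, for which an a priori
bound is needed. If `(H - z) u = f`, then `(H + l)⁻¹ u` is better behaved: in place of `u` it solves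
`u = (-Δ + l)⁻¹ (g + v)` with `v = (z + l - V) u` and some `g ∈ L¹ ∩ L²`. Pair this with `v` in `L²`
with an exponential weight, as in the Combes–Thomas method. As `V` is real, the imaginary part
controls the weighted `L²` norm of `u`, and averaging over the centre of the weight gives a bound
in `L¹`.

With `A = 1 + H²`, Balakrishnan's integral shows that `v` is in the domain of `A ^ p` once
`‖A (A + t)⁻¹ v‖` decays faster than `t ^ (-p)`. For `v = (1 - Δ + τ)⁻¹ f` this quantity is
`O((1 + τ)⁻¹)` and, since `H v` is bounded by `f`, also `O((1 + t) ^ (-1 / 2))`. Interpolating and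
integrating against `τ ^ (-β)`, which turns `v` into `(1 - Δ) ^ (-β) f`, gives the decay for every
`p < β / 2`.
-/

noncomputable section

namespace SchrodingerL1

/-! ### Resolvents -/

section Resolvent

variable {X : Type*} [NormedAddCommGroup X] [NormedSpace ℂ X]

theorem mem_shift_graph {c : ℂ} {A : X →ₗ.[ℂ] X} {u x : X} :
    (u, x) ∈ (shift c A).graph ↔ ∃ y, (u, y) ∈ A.graph ∧ c • u + y = x := by
  simp only [LinearPMap.mem_graph_iff]
  constructor
  · rintro ⟨v, rfl, rfl⟩
    exact ⟨A v, ⟨v, rfl, rfl⟩, rfl⟩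
  · rintro ⟨_, ⟨v, rfl, rfl⟩, rfl⟩
    exact ⟨v, rfl, rfl⟩

theorem mem_add_graph {A B : X →ₗ.[ℂ] X} {u x : X} :
    (u, x) ∈ (A + B).graph ↔ ∃ y z, (u, y) ∈ A.graph ∧ (u, z) ∈ B.graph ∧ y + z = x := by
  simp only [LinearPMap.mem_graph_iff]
  constructor
  · rintro ⟨v, rfl, rfl⟩
    exact ⟨A ⟨v, v.2.1⟩, B ⟨v, v.2.2⟩, ⟨_, rfl, rfl⟩, ⟨_, rfl, rfl⟩, rfl⟩
  · rintro ⟨_, _, ⟨⟨v, hvA⟩, rfl, rfl⟩, ⟨⟨_, hvB⟩, rfl, rfl⟩, rfl⟩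
    exact ⟨⟨_, hvA, hvB⟩, rfl, rfl⟩

theorem mem_neg_graph {A : X →ₗ.[ℂ] X} {u x : X} : (u, x) ∈ (-A).graph ↔ (u, -x) ∈ A.graph := by
  simp only [LinearPMap.mem_graph_iff, LinearPMap.neg_apply, neg_eq_iff_eq_neg]
  rfl

theorem shift_add (c : ℂ) (A B : X →ₗ.[ℂ] X) : shift c (A + B) = shift c A + B :=
  LinearPMap.ext rfl fun _ _ _ => (add_assoc _ _ _).symm

theorem shift_shift (c d : ℂ) (A : X →ₗ.[ℂ] X) : shift c (shift d A) = shift (c + d) A := by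
  simp only [shift, vadd_vadd, ← add_smul]

namespace IsBoundedInverse

variable {A B : X →ₗ.[ℂ] X} {R S K : X →L[ℂ] X} {c d t : ℂ}

theorem mem_graph (hR : IsBoundedInverse A R) (x : X) : (R x, x) ∈ A.graph :=
  (hR _ x).2 rfl

theorem apply_eq (hR : IsBoundedInverse A R) {u x : X} (h : (u, x) ∈ A.graph) : R x = u :=
  (hR u x).1 h

theorem unique (hR : IsBoundedInverse A R) (hS : IsBoundedInverse A S) : R = S :=
  ContinuousLinearMap.ext fun x => hR.apply_eq (hS.mem_graph x)

theorem boundedInverse_eq (hR : IsBoundedInverse A R) : boundedInverse A = R := by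
  have h : ∃ R, IsBoundedInverse A R := ⟨R, hR⟩
  rw [boundedInverse, dif_pos h]
  exact h.choose_spec.unique hR

theorem injective (hR : IsBoundedInverse A R) : Function.Injective R :=
  (injective_iff_map_eq_zero R).2 fun x hx => A.graph_fst_eq_zero_snd ((hR 0 x).2 hx) rfl

theorem resolvent_identity (hR : IsBoundedInverse (shift c A) R)
    (hS : IsBoundedInverse (shift d A) S) : R - S = (d - c) • (R * S) := by
  ext x
  obtain ⟨y, hy, hx⟩ := mem_shift_graph.1 (hS.mem_graph x)
  have hRS : R (c • S x + y) = S x := hR.apply_eq (mem_shift_graph.2 ⟨y, hy, rfl⟩)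
  have hx' : x = (c • S x + y) + (d - c) • S x := by
    nth_rewrite 1 [← hx]
    module
  calc R x - S x = R ((c • S x + y) + (d - c) • S x) - S x := by rw [← hx']
    _ = (d - c) • R (S x) := by rw [map_add, hRS, map_smul, add_sub_cancel_left]

theorem add (hR : IsBoundedInverse A R) (hK : ∀ x, (R x, K x) ∈ B.graph)
    {U : X ≃L[ℂ] X} (hU : ∀ x, U x = x + K x) :
    IsBoundedInverse (A + B) (R ∘L U.symm) := by
  intro u x
  rw [mem_add_graph, ContinuousLinearMap.comp_apply, ContinuousLinearEquiv.coe_coe]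
  constructor
  · rintro ⟨y, z, hy, hz, rfl⟩
    have hRy : R y = u := hR.apply_eq hy
    have hKy : K y = z := B.mem_graph_snd_inj (hK y) hz hRy
    rwa [← hKy, ← hU, U.symm_apply_apply]
  · rintro rfl
    exact ⟨U.symm x, K (U.symm x), hR.mem_graph _, hK _, by rw [← hU, U.apply_symm_apply]⟩

end IsBoundedInverse

theorem exists_equiv_add_apply [CompleteSpace X] {K : X →L[ℂ] X} (hK : ‖K‖ ≤ 1 / 2) :
    ∃ U : X ≃L[ℂ] X, (∀ x, U x = x + K x) ∧ ‖(U.symm : X →L[ℂ] X)‖ ≤ 2 := by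
  have hK' : ‖-K‖ < 1 := by rw [norm_neg]; linarith
  refine ⟨ContinuousLinearEquiv.unitsEquiv ℂ X (Units.oneSub (-K) hK'), fun x => by simp, ?_⟩
  calc ‖∑' n : ℕ, (-K) ^ n‖ ≤ ‖(1 : X →L[ℂ] X)‖ - 1 + (1 - ‖-K‖)⁻¹ :=
        tsum_geometric_le_of_norm_lt_one _ hK'
    _ ≤ 1 - 1 + (1 - 1 / 2)⁻¹ := by
        rw [norm_neg]
        gcongr
        exact ContinuousLinearMap.norm_id_le
    _ = 2 := by norm_num

namespace IsBoundedInverse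

variable {A B : X →ₗ.[ℂ] X} {R S K : X →L[ℂ] X} {c d t : ℂ}

theorem exists_add [CompleteSpace X] (hR : IsBoundedInverse A R)
    (hK : ∀ x, (R x, K x) ∈ B.graph) (hK2 : ‖K‖ ≤ 1 / 2) :
    ∃ S, IsBoundedInverse (A + B) S ∧ ‖S‖ ≤ 2 * ‖R‖ := by
  obtain ⟨U, hU, hU2⟩ := exists_equiv_add_apply hK2
  refine ⟨_, hR.add hK hU, (ContinuousLinearMap.opNorm_comp_le _ _).trans ?_⟩
  rw [mul_comm]
  gcongr

theorem exists_shift_of_norm_le [CompleteSpace X] (hR : IsBoundedInverse (shift c A) R)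
    (h : ‖d - c‖ * ‖R‖ ≤ 1 / 2) : ∃ S, IsBoundedInverse (shift d A) S := by
  let B : X →ₗ.[ℂ] X := ((d - c) • (LinearMap.id : X →ₗ[ℂ] X)).toPMap ⊤
  have hB : shift c A + B = shift d A := by
    refine LinearPMap.ext (inf_top_eq _) fun u hu hu' => ?_
    change c • u + A ⟨u, hu'⟩ + (d - c) • u = d • u + A ⟨u, hu'⟩
    module
  obtain ⟨S, hS, -⟩ := hR.exists_add (B := B) (K := (d - c) • R)
    (fun x => LinearPMap.mem_graph B ⟨R x, trivial⟩) (by rwa [norm_smul])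
  exact ⟨S, hB ▸ hS⟩

/-- Rests on the factorization `t + 1 + A² = (A + c) (A - c)`. -/
theorem shift_one_add_sq (hR : IsBoundedInverse (shift c A) R)
    (hS : IsBoundedInverse (shift (-c) A) S) (hc : t + 1 = -(c * c)) :
    IsBoundedInverse (shift t (shift 1 (sq A))) (S * R) := by
  have hmem (u x : X) : (u, x) ∈ (shift t (shift 1 (sq A))).graph ↔
      ∃ v, (u, v) ∈ (shift (-c) A).graph ∧ (v, x) ∈ (shift c A).graph := by
    simp only [shift_shift, hc, mem_shift_graph, mem_sq_graph]
    constructor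
    · rintro ⟨w, ⟨v, hv, hw⟩, rfl⟩
      exact ⟨-c • u + v, ⟨v, hv, rfl⟩, -c • v + w,
        A.graph.add_mem (A.graph.smul_mem (-c) hv) hw, by module⟩
    · rintro ⟨_, ⟨v, hv, rfl⟩, y, hy, rfl⟩
      refine ⟨y + c • v, ⟨v, hv, ?_⟩, by module⟩
      have h := A.graph.add_mem hy (A.graph.smul_mem c hv)
      rwa [Prod.smul_mk, Prod.mk_add_mk, neg_smul, neg_add_eq_sub, sub_add_cancel] at h
  intro u x
  rw [hmem]
  constructor
  · rintro ⟨v, hu, hv⟩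
    change S (R x) = u
    rw [hR.apply_eq hv, hS.apply_eq hu]
  · rintro rfl
    exact ⟨R x, hS.mem_graph _, hR.mem_graph _⟩

end IsBoundedInverse

end Resolvent

/-! ### Fractional powers -/

section FractionalPowers

open Filter Topology

theorem integrableOn_Ioi_rpow_mul_one_add_rpow {a b : ℝ} (ha : -1 < a) (hab : a + b < -1) :
    IntegrableOn (fun t : ℝ => t ^ a * (1 + t) ^ b) (Ioi 0) := by
  have hb : b ≤ 0 := by linarith
  have hmeas (s : Set ℝ) : AEStronglyMeasurable (fun t : ℝ => t ^ a * (1 + t) ^ b)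
      (volume.restrict s) := Measurable.aestronglyMeasurable (by fun_prop)
  rw [← Ioc_union_Ioi_eq_Ioi zero_le_one]
  refine IntegrableOn.union ?_ ?_
  · refine Integrable.mono' (intervalIntegral.intervalIntegrable_rpow' (b := 1) ha).1 (hmeas _) ?_
    filter_upwards [ae_restrict_mem measurableSet_Ioc] with t ht
    have ht0 : 0 < t := ht.1
    rw [Real.norm_of_nonneg (by positivity)]
    exact mul_le_of_le_one_right (by positivity)
      (Real.rpow_le_one_of_one_le_of_nonpos (by linarith) hb)
  · refine Integrable.mono' (integrableOn_Ioi_rpow_of_lt hab zero_lt_one) (hmeas _) ?_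
    filter_upwards [ae_restrict_mem measurableSet_Ioi] with t ht
    have ht0 : 0 < t := zero_lt_one.trans ht
    rw [Real.norm_of_nonneg (by positivity), Real.rpow_add ht0]
    exact mul_le_mul_of_nonneg_left (Real.rpow_le_rpow_of_nonpos ht0 (by linarith) hb)
      (by positivity)

variable {X : Type*} [NormedAddCommGroup X]

theorem integrableOn_Ioi_comp_mul_left {g : ℝ → X} (hg : IntegrableOn g (Ioi 0))
    {s : ℝ} (hs : 0 < s) : IntegrableOn (fun r => g (s * r)) (Ioi 0) :=
  (integrableOn_Ioi_comp_mul_left_iff g 0 hs).2 (by rwa [mul_zero])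

variable [NormedSpace ℂ X]

section MultiplicativeConvolution

variable {T : ℝ → X →L[ℂ] X} {g : ℝ → X}

theorem integrable_prod_smul_apply_comp_mul (hT : ContinuousOn T (Ioi 0))
    (hT_int : IntegrableOn T (Ioi 0)) (hg : ContinuousOn g (Ioi 0))
    (hg_int : IntegrableOn g (Ioi 0)) :
    Integrable (fun z : ℝ × ℝ => z.1 • T z.1 (g (z.1 * z.2)))
      ((volume.restrict (Ioi 0)).prod (volume.restrict (Ioi 0))) := by
  have hmeas : AEStronglyMeasurable (fun z : ℝ × ℝ => z.1 • T z.1 (g (z.1 * z.2)))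
      ((volume.restrict (Ioi 0)).prod (volume.restrict (Ioi 0))) := by
    rw [Measure.prod_restrict]
    refine ContinuousOn.aestronglyMeasurable ?_ (measurableSet_Ioi.prod measurableSet_Ioi)
    exact continuousOn_fst.smul ((hT.comp continuousOn_fst fun z hz => hz.1).clm_apply
      (hg.comp (continuousOn_fst.mul continuousOn_snd)
        fun z hz => mem_Ioi.2 (mul_pos (mem_Ioi.1 hz.1) (mem_Ioi.1 hz.2))))
  refine (integrable_prod_iff hmeas).2 ⟨?_, ?_⟩
  · filter_upwards [ae_restrict_mem measurableSet_Ioi] with s hs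
    exact ((T s).integrable_comp (integrableOn_Ioi_comp_mul_left hg_int hs)).smul s
  · set I := ∫ t in Ioi (0 : ℝ), ‖g t‖
    refine (hT_int.norm.mul_const I).mono' hmeas.norm.integral_prod_right' ?_
    filter_upwards [ae_restrict_mem measurableSet_Ioi] with s (hs : 0 < s)
    rw [Real.norm_of_nonneg (integral_nonneg fun _ => norm_nonneg _)]
    calc ∫ r in Ioi (0 : ℝ), ‖s • T s (g (s * r))‖
        ≤ ∫ r in Ioi (0 : ℝ), s * ‖T s‖ * ‖g (s * r)‖ := by
          refine integral_mono_of_nonneg (Eventually.of_forall fun _ => norm_nonneg _)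
            ((integrableOn_Ioi_comp_mul_left hg_int hs).norm.const_mul _)
            (Eventually.of_forall fun r => ?_)
          simp only [norm_smul, Real.norm_of_nonneg hs.le, mul_assoc]
          gcongr
          exact (T s).le_opNorm _
      _ = s * ‖T s‖ * (s⁻¹ * I) := by
          rw [integral_const_mul, integral_comp_mul_left_Ioi (fun t => ‖g t‖) 0 hs, mul_zero,
            smul_eq_mul]
      _ = ‖T s‖ * I := by field_simp

theorem integral_apply_integral_comp_mul [CompleteSpace X] (hT : ContinuousOn T (Ioi 0))
    (hT_int : IntegrableOn T (Ioi 0)) (hg : ContinuousOn g (Ioi 0))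
    (hg_int : IntegrableOn g (Ioi 0)) :
    (∫ s in Ioi (0 : ℝ), T s) (∫ t in Ioi (0 : ℝ), g t) =
      ∫ r in Ioi (0 : ℝ), ∫ s in Ioi (0 : ℝ), s • T s (g (s * r)) := by
  rw [ContinuousLinearMap.integral_apply hT_int, ← integral_integral_swap
    (integrable_prod_smul_apply_comp_mul hT hT_int hg hg_int)]
  refine setIntegral_congr_fun measurableSet_Ioi fun s (hs : 0 < s) => ?_
  rw [integral_smul, ContinuousLinearMap.integral_comp_comm _
    (integrableOn_Ioi_comp_mul_left hg_int hs), integral_comp_mul_left_Ioi g 0 hs, mul_zero,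
    (T s).map_smul_of_tower, smul_inv_smul₀ hs.ne']

end MultiplicativeConvolution

/-- A family of bounded operators behaving like `t ↦ (A + t)⁻¹` for a positive operator `A`. The
generator `A` is not mentioned, so that the integral calculus below only involves bounded
operators. -/
structure IsResolventFamily (R : ℝ → X →L[ℂ] X) (M : ℝ) : Prop where
  sub_eq : ∀ s t, 0 ≤ s → 0 ≤ t → R s - R t = (t - s) • (R s * R t)
  norm_le : ∀ t, 0 ≤ t → ‖R t‖ ≤ M / (1 + t)

/-- The vector `A (A + t)⁻¹ v`, where `R t = (A + t)⁻¹`. -/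
def defect (R : ℝ → X →L[ℂ] X) (v : X) (t : ℝ) : X := v - t • R t v

/-- The integral `∫₀^∞ t ^ (-p) R t dt`, which is a multiple of `A ^ (-p)` if
`R t = (A + t)⁻¹`. -/
def resolventIntegral (R : ℝ → X →L[ℂ] X) (p : ℝ) : X →L[ℂ] X :=
  ∫ t in Ioi (0 : ℝ), t ^ (-p) • R t

/-- The constant `(π / sin (π p)) ^ 2` of the inversion formula for fractional powers, in the form
of the integral that Frullani's theorem produces. -/
def inversionConst (p : ℝ) : ℝ := ∫ r in Ioi (0 : ℝ), r ^ (p - 1) * (Real.log r / (r - 1))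

namespace IsResolventFamily

variable {R : ℝ → X →L[ℂ] X} {M p s t : ℝ} {v : X}

theorem nonneg (hR : IsResolventFamily R M) : 0 ≤ M := by
  simpa using (norm_nonneg _).trans (hR.norm_le 0 le_rfl)

theorem norm_le_const (hR : IsResolventFamily R M) (ht : 0 ≤ t) : ‖R t‖ ≤ M :=
  (hR.norm_le t ht).trans (div_le_self hR.nonneg (by linarith))

theorem sub_apply (hR : IsResolventFamily R M) (hs : 0 ≤ s) (ht : 0 ≤ t) (u : X) :
    R s u - R t u = (t - s) • R s (R t u) :=
  congrArg (fun T : X →L[ℂ] X => T u) (hR.sub_eq s t hs ht)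

theorem apply_comm (hR : IsResolventFamily R M) (hs : 0 ≤ s) (ht : 0 ≤ t) (u : X) :
    R s (R t u) = R t (R s u) := by
  rcases eq_or_ne s t with rfl | hst
  · rfl
  refine smul_right_injective X (sub_ne_zero.2 hst.symm) ?_
  change (t - s) • R s (R t u) = (t - s) • R t (R s u)
  rw [← hR.sub_apply hs ht, ← neg_sub s t, neg_smul, ← hR.sub_apply ht hs, neg_sub]

theorem continuousOn (hR : IsResolventFamily R M) : ContinuousOn R (Ioi 0) := by
  have hlip : LipschitzOnWith (M * M).toNNReal R (Ioi 0) := by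
    refine LipschitzOnWith.of_dist_le_mul fun s (hs : 0 < s) t (ht : 0 < t) => ?_
    rw [dist_eq_norm, hR.sub_eq s t hs.le ht.le, norm_smul, dist_comm, Real.dist_eq,
      Real.coe_toNNReal _ (mul_nonneg hR.nonneg hR.nonneg), mul_comm, Real.norm_eq_abs]
    gcongr
    exact norm_mul_le_of_le (hR.norm_le_const hs.le) (hR.norm_le_const ht.le)
  exact hlip.continuousOn

theorem continuousOn_rpow_smul (hR : IsResolventFamily R M) (a : ℝ) :
    ContinuousOn (fun t : ℝ => t ^ a • R t) (Ioi 0) :=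
  (continuousOn_id.rpow_const fun _ ht => Or.inl (ne_of_gt ht)).smul hR.continuousOn

theorem continuousOn_rpow_smul_defect (hR : IsResolventFamily R M) (a : ℝ) (v : X) :
    ContinuousOn (fun t : ℝ => t ^ a • defect R v t) (Ioi 0) :=
  (continuousOn_id.rpow_const fun _ ht => Or.inl (ne_of_gt ht)).smul
    (continuousOn_const.sub (continuousOn_id.smul (hR.continuousOn.clm_apply continuousOn_const)))

theorem integrableOn_rpow_smul (hR : IsResolventFamily R M) (hp : 0 < p) (hp1 : p < 1) :
    IntegrableOn (fun t : ℝ => t ^ (-p) • R t) (Ioi 0) := by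
  refine ((integrableOn_Ioi_rpow_mul_one_add_rpow (a := -p) (b := -1) (by linarith)
    (by linarith)).const_mul M).mono'
    ((hR.continuousOn_rpow_smul _).aestronglyMeasurable measurableSet_Ioi) ?_
  filter_upwards [ae_restrict_mem measurableSet_Ioi] with t (ht : 0 < t)
  calc ‖t ^ (-p) • R t‖ = t ^ (-p) * ‖R t‖ := by
        rw [norm_smul, Real.norm_of_nonneg (by positivity)]
    _ ≤ t ^ (-p) * (M / (1 + t)) := by gcongr; exact hR.norm_le t ht.le
    _ = M * (t ^ (-p) * (1 + t) ^ (-1 : ℝ)) := by rw [Real.rpow_neg_one]; ring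

theorem norm_rpow_smul_defect_le {δ C : ℝ} (ht : 0 < t)
    (hv : ‖defect R v t‖ ≤ C * (1 + t) ^ (-(p + δ))) :
    ‖t ^ (p - 1) • defect R v t‖ ≤ C * (t ^ (p - 1) * (1 + t) ^ (-(p + δ))) := by
  rw [norm_smul, Real.norm_of_nonneg (by positivity), mul_left_comm]
  gcongr

theorem integrableOn_rpow_smul_defect (hR : IsResolventFamily R M) {δ C : ℝ} (hp : 0 < p)
    (hδ : 0 < δ) (hv : ∀ t, 0 < t → ‖defect R v t‖ ≤ C * (1 + t) ^ (-(p + δ))) :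
    IntegrableOn (fun t : ℝ => t ^ (p - 1) • defect R v t) (Ioi 0) := by
  refine ((integrableOn_Ioi_rpow_mul_one_add_rpow (a := p - 1) (b := -(p + δ)) (by linarith)
    (by linarith)).const_mul C).mono'
    ((hR.continuousOn_rpow_smul_defect _ v).aestronglyMeasurable measurableSet_Ioi) ?_
  filter_upwards [ae_restrict_mem measurableSet_Ioi] with t ht
    using norm_rpow_smul_defect_le ht (hv t ht)

theorem apply_defect (hR : IsResolventFamily R M) (v : X) (hs : 0 ≤ s) (ht : 0 ≤ t)
    (hst : t ≠ s) : R s (defect R v t) = (t - s)⁻¹ • (t • R t v - s • R s v) := by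
  rw [eq_inv_smul_iff₀ (sub_ne_zero.2 hst), defect, map_sub, (R s).map_smul_of_tower, smul_sub,
    smul_comm, ← hR.sub_apply hs ht]
  module

theorem tendsto_smul_apply_nhdsGT_zero (hR : IsResolventFamily R M) (v : X) :
    Tendsto (fun t => t • R t v) (𝓝[>] 0) (𝓝 0) := by
  refine squeeze_zero_norm' (a := fun t : ℝ => t * (M * ‖v‖)) ?_ ?_
  · filter_upwards [self_mem_nhdsWithin] with t (ht : 0 < t)
    rw [norm_smul, Real.norm_of_nonneg ht.le]
    gcongr
    exact (R t).le_of_opNorm_le (hR.norm_le_const ht.le) v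
  · have hlim : Tendsto (fun t : ℝ => t * (M * ‖v‖)) (𝓝 0) (𝓝 (0 * (M * ‖v‖))) :=
      tendsto_id.mul_const _
    rw [zero_mul] at hlim
    exact hlim.mono_left nhdsWithin_le_nhds

theorem integral_apply_defect_comp_mul [CompleteSpace X] (hR : IsResolventFamily R M)
    (hv : Tendsto (defect R v) atTop (𝓝 0)) {r : ℝ} (hr : 0 < r) (hr1 : r ≠ 1)
    (h_int : IntegrableOn (fun s => R s (defect R v (s * r))) (Ioi 0)) :
    ∫ s in Ioi (0 : ℝ), R s (defect R v (s * r)) = (Real.log r / (r - 1)) • v := by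
  set φ : ℝ → X := fun t => t • R t v
  have hφ : LocallyIntegrableOn φ (Ioi 0) :=
    (continuousOn_id.smul (hR.continuousOn.clm_apply continuousOn_const)).locallyIntegrableOn
      measurableSet_Ioi
  have hφ_top : Tendsto φ atTop (𝓝 v) := by
    simpa only [defect, sub_sub_cancel, sub_zero] using hv.const_sub v
  have heq : ∀ s ∈ Ioi (0 : ℝ), R s (defect R v (s * r)) =
      (r - 1)⁻¹ • (s⁻¹ • (φ (r * s) - φ (1 * s))) := by
    intro s (hs : 0 < s)
    rw [hR.apply_defect v hs.le (by positivity) (fun h => hr1 (by simpa [hs.ne'] using h)),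
      smul_smul, one_mul, mul_comm s r, ← mul_inv]
    congr 2
    ring
  have h_int' : IntegrableOn (fun s => s⁻¹ • (φ (r * s) - φ (1 * s))) (Ioi 0) :=
    IntegrableOn.congr_fun ((h_int.congr_fun heq measurableSet_Ioi).smul (r - 1))
      (fun _ _ => smul_inv_smul₀ (sub_ne_zero.2 hr1) _) measurableSet_Ioi
  rw [setIntegral_congr_fun measurableSet_Ioi heq, integral_smul, Frullani.integral_Ioi_eq hφ hr
    one_pos (hR.tendsto_smul_apply_nhdsGT_zero v) hφ_top h_int', smul_smul, zero_sub, smul_neg,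
    ← neg_smul, one_div, Real.log_inv, mul_neg, neg_neg, div_eq_inv_mul]

theorem smul_rpow_smul_apply_rpow_smul {r : ℝ} (hs : 0 < s) (hr : 0 < r) :
    s • (s ^ (-p) • R s) ((s * r) ^ (p - 1) • defect R v (s * r)) =
      r ^ (p - 1) • R s (defect R v (s * r)) := by
  have hsp : s * s ^ (-p) * s ^ (p - 1) = 1 := by
    nth_rewrite 1 [← Real.rpow_one s]
    rw [← Real.rpow_add hs, ← Real.rpow_add hs, ← Real.rpow_zero s]
    ring_nf
  change s • s ^ (-p) • R s ((s * r) ^ (p - 1) • defect R v (s * r)) = _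
  rw [(R s).map_smul_of_tower, smul_smul, smul_smul, Real.mul_rpow hs.le hr.le, ← mul_assoc, hsp,
    one_mul]

theorem integral_smul_rpow_smul_apply_ae [CompleteSpace X] (hR : IsResolventFamily R M)
    (hp : 0 < p) (hp1 : p < 1) (hv : Tendsto (defect R v) atTop (𝓝 0))
    (hv_int : IntegrableOn (fun t : ℝ => t ^ (p - 1) • defect R v t) (Ioi 0)) :
    ∀ᵐ r ∂(volume.restrict (Ioi (0 : ℝ))), ∫ s in Ioi (0 : ℝ),
        s • (s ^ (-p) • R s) ((s * r) ^ (p - 1) • defect R v (s * r)) =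
      (r ^ (p - 1) * (Real.log r / (r - 1))) • v := by
  have hprod := integrable_prod_smul_apply_comp_mul (hR.continuousOn_rpow_smul (-p))
    (hR.integrableOn_rpow_smul hp hp1) (hR.continuousOn_rpow_smul_defect (p - 1) v) hv_int
  filter_upwards [ae_restrict_mem measurableSet_Ioi,
    ae_restrict_of_ae (Measure.ae_ne volume (1 : ℝ)), hprod.prod_left_ae] with r (hr : 0 < r) hr1 hi
  have hi' : IntegrableOn (fun s => r ^ (p - 1) • R s (defect R v (s * r))) (Ioi 0) :=
    IntegrableOn.congr_fun hi (fun s hs => smul_rpow_smul_apply_rpow_smul hs hr) measurableSet_Ioi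
  have h_int : IntegrableOn (fun s => R s (defect R v (s * r))) (Ioi 0) := by
    refine IntegrableOn.congr_fun (hi'.smul (r ^ (p - 1))⁻¹) (fun s _ => ?_) measurableSet_Ioi
    exact inv_smul_smul₀ (Real.rpow_pos_of_pos hr _).ne' _
  rw [setIntegral_congr_fun measurableSet_Ioi
    fun s hs => smul_rpow_smul_apply_rpow_smul hs hr, integral_smul,
    hR.integral_apply_defect_comp_mul hv hr hr1 h_int, smul_smul]

theorem resolventIntegral_apply_integral [CompleteSpace X] (hR : IsResolventFamily R M)
    (hp : 0 < p) (hp1 : p < 1) (hv : Tendsto (defect R v) atTop (𝓝 0))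
    (hv_int : IntegrableOn (fun t : ℝ => t ^ (p - 1) • defect R v t) (Ioi 0)) :
    resolventIntegral R p (∫ t in Ioi (0 : ℝ), t ^ (p - 1) • defect R v t) =
      inversionConst p • v := by
  rw [resolventIntegral, integral_apply_integral_comp_mul (hR.continuousOn_rpow_smul (-p))
    (hR.integrableOn_rpow_smul hp hp1) (hR.continuousOn_rpow_smul_defect (p - 1) v) hv_int,
    integral_congr_ae (hR.integral_smul_rpow_smul_apply_ae hp hp1 hv hv_int),
    integral_smul_const, inversionConst]

theorem defect_apply_zero (hR : IsResolventFamily R M) (ht : 0 ≤ t) (u : X) :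
    defect R (R 0 u) t = R t u := by
  have h := hR.sub_apply ht le_rfl u
  rw [zero_sub, neg_smul] at h
  rw [defect, sub_eq_iff_eq_add, ← sub_eq_iff_eq_add', ← neg_sub, h, neg_neg]

theorem tendsto_defect {η C : ℝ} (hη : 0 < η)
    (hv : ∀ t, 0 < t → ‖defect R v t‖ ≤ C * (1 + t) ^ (-η)) :
    Tendsto (defect R v) atTop (𝓝 0) := by
  have hlim : Tendsto (fun t : ℝ => C * (1 + t) ^ (-η)) atTop (𝓝 (C * 0)) :=
    ((tendsto_rpow_neg_atTop hη).comp (tendsto_atTop_add_const_left _ 1 tendsto_id)).const_mul C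
  rw [mul_zero] at hlim
  refine squeeze_zero_norm' ?_ hlim
  filter_upwards [eventually_gt_atTop 0] with t ht using hv t ht

end IsResolventFamily

/-- The resolvent family of `A = 1` on `ℂ`. Since the Frullani integral of `v = 1` is a multiple of
`v`, Fubini's theorem shows that the weight in `inversionConst` is integrable. -/
theorem isResolventFamily_inv_one_add :
    IsResolventFamily (fun t : ℝ => (1 + t)⁻¹ • (1 : ℂ →L[ℂ] ℂ)) 1 where
  sub_eq s t hs ht := by
    rw [← sub_smul, smul_mul_smul_comm, one_mul, smul_smul]
    congr 1
    field_simp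
    ring
  norm_le t ht := by
    rw [norm_smul, norm_one, mul_one, Real.norm_of_nonneg (by positivity), one_div]

theorem integrableOn_rpow_mul_log_div_sub_one {p : ℝ} (hp : 0 < p) (hp1 : p < 1) :
    IntegrableOn (fun r : ℝ => r ^ (p - 1) * (Real.log r / (r - 1))) (Ioi 0) := by
  have hR := isResolventFamily_inv_one_add
  have hv : ∀ t : ℝ, 0 < t →
      ‖defect (fun t : ℝ => (1 + t)⁻¹ • (1 : ℂ →L[ℂ] ℂ)) 1 t‖ ≤ 1 * (1 + t) ^ (-(p + (1 - p))) := by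
    intro t ht
    have h : defect (fun t : ℝ => (1 + t)⁻¹ • (1 : ℂ →L[ℂ] ℂ)) 1 t = ((1 + t)⁻¹ : ℝ) := by
      have : (1 + t : ℂ) ≠ 0 := by exact_mod_cast (by positivity : (1 + t : ℝ) ≠ 0)
      simp only [defect, smul_apply, one_apply_eq_self, Complex.real_smul,
        Complex.ofReal_inv, Complex.ofReal_add, Complex.ofReal_one]
      field_simp
      ring
    rw [h, Complex.norm_of_nonneg (by positivity), add_sub_cancel, Real.rpow_neg_one, one_mul]
  have hv_int := hR.integrableOn_rpow_smul_defect hp (sub_pos.2 hp1) hv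
  have hprod := integrable_prod_smul_apply_comp_mul (hR.continuousOn_rpow_smul (-p))
    (hR.integrableOn_rpow_smul hp hp1) (hR.continuousOn_rpow_smul_defect (p - 1) 1) hv_int
  exact (integrable_smul_const (one_ne_zero (α := ℂ))).1 <| hprod.integral_prod_right.congr <|
    hR.integral_smul_rpow_smul_apply_ae hp hp1
      (IsResolventFamily.tendsto_defect (by linarith) hv) hv_int

theorem log_div_sub_one_pos {r : ℝ} (hr : 0 < r) (hr1 : r ≠ 1) : 0 < Real.log r / (r - 1) := by
  rcases lt_or_gt_of_ne hr1 with h | h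
  · exact div_pos_of_neg_of_neg (Real.log_neg hr h) (by linarith)
  · exact div_pos (Real.log_pos h) (by linarith)

theorem inversionConst_pos {p : ℝ} (hp : 0 < p) (hp1 : p < 1) : 0 < inversionConst p := by
  have hpos {r : ℝ} (hr : 0 < r) (hr1 : r ≠ 1) : 0 < r ^ (p - 1) * (Real.log r / (r - 1)) :=
    mul_pos (Real.rpow_pos_of_pos hr _) (log_div_sub_one_pos hr hr1)
  rw [inversionConst, setIntegral_pos_iff_support_of_nonneg_ae _
    (integrableOn_rpow_mul_log_div_sub_one hp hp1)]
  · refine lt_of_lt_of_le ?_ (measure_mono (s := Ioi (1 : ℝ)) fun r hr => ?_)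
    · simp
    · have hr0 : (0 : ℝ) < r := zero_lt_one.trans hr
      exact ⟨(hpos hr0 (ne_of_gt hr)).ne', hr0⟩
  · filter_upwards [ae_restrict_mem measurableSet_Ioi,
      ae_restrict_of_ae (Measure.ae_ne volume (1 : ℝ))] with r hr hr1 using (hpos hr hr1).le

namespace IsResolventFamily

variable [CompleteSpace X] {R : ℝ → X →L[ℂ] X} {M p : ℝ}

theorem resolventIntegral_apply_comm (hR : IsResolventFamily R M) (hp : 0 < p) (hp1 : p < 1)
    {t : ℝ} (ht : 0 ≤ t) (u : X) :
    resolventIntegral R p (R t u) = R t (resolventIntegral R p u) := by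
  have h_int := hR.integrableOn_rpow_smul hp hp1
  have h_apply (w : X) : resolventIntegral R p w = ∫ s in Ioi (0 : ℝ), (s ^ (-p) • R s) w :=
    ContinuousLinearMap.integral_apply h_int w
  have hu_int : IntegrableOn (fun s : ℝ => (s ^ (-p) • R s) u) (Ioi 0) :=
    (ContinuousLinearMap.apply ℂ X u).integrable_comp h_int
  rw [h_apply, h_apply, ← (R t).integral_comp_comm hu_int]
  refine setIntegral_congr_fun measurableSet_Ioi fun s (hs : 0 < s) => ?_
  change s ^ (-p) • R s (R t u) = R t (s ^ (-p) • R s u)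
  rw [(R t).map_smul_of_tower, hR.apply_comm hs.le ht]

theorem resolventIntegral_injective (hR : IsResolventFamily R M) (hR0 : Function.Injective (R 0))
    (hp : 0 < p) (hp1 : p < 1) : Function.Injective (resolventIntegral R p) := by
  refine (injective_iff_map_eq_zero _).2 fun u hu => hR0 ?_
  have hbound : ∀ t, 0 < t →
      ‖defect R (R 0 u) t‖ ≤ (M * ‖u‖) * (1 + t) ^ (-(p + (1 - p))) := by
    intro t ht
    rw [hR.defect_apply_zero ht.le, add_sub_cancel, Real.rpow_neg_one, mul_right_comm,
      ← div_eq_mul_inv]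
    exact (R t).le_of_opNorm_le (hR.norm_le t ht.le) u
  have hv_int := hR.integrableOn_rpow_smul_defect hp (sub_pos.2 hp1) hbound
  have hzero :
      resolventIntegral R p (∫ t in Ioi (0 : ℝ), t ^ (p - 1) • defect R (R 0 u) t) = 0 := by
    rw [← ContinuousLinearMap.integral_comp_comm _ hv_int]
    refine setIntegral_eq_zero_of_forall_eq_zero fun t (ht : 0 < t) => ?_
    rw [hR.defect_apply_zero ht.le, ContinuousLinearMap.map_smul_of_tower,
      hR.resolventIntegral_apply_comm hp hp1 ht.le, hu, map_zero, smul_zero]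
  rw [hR.resolventIntegral_apply_integral hp hp1 (tendsto_defect (by linarith) hbound) hv_int]
    at hzero
  rw [map_zero]
  exact (smul_eq_zero.1 hzero).resolve_left (inversionConst_pos hp hp1).ne'

theorem exists_resolventIntegral_apply_eq (hR : IsResolventFamily R M) {δ : ℝ} (hp : 0 < p)
    (hp1 : p < 1) (hδ : 0 < δ) : ∃ L : ℝ, ∀ (C : ℝ) (v : X),
      (∀ t : ℝ, 0 < t → ‖defect R v t‖ ≤ C * (1 + t) ^ (-(p + δ))) →
      ∃ g, resolventIntegral R p g = v ∧ ‖g‖ ≤ L * C := by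
  have hc := inversionConst_pos hp hp1
  set I := ∫ t in Ioi (0 : ℝ), t ^ (p - 1) * (1 + t) ^ (-(p + δ))
  refine ⟨(inversionConst p)⁻¹ * I, fun C v hv =>
    ⟨(inversionConst p)⁻¹ • ∫ t in Ioi (0 : ℝ), t ^ (p - 1) • defect R v t, ?_, ?_⟩⟩
  · rw [ContinuousLinearMap.map_smul_of_tower, hR.resolventIntegral_apply_integral hp hp1
      (tendsto_defect (by linarith) hv) (hR.integrableOn_rpow_smul_defect hp hδ hv),
      inv_smul_smul₀ hc.ne']
  · rw [norm_smul, Real.norm_of_nonneg (by positivity), mul_assoc]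
    gcongr
    calc ‖∫ t in Ioi (0 : ℝ), t ^ (p - 1) • defect R v t‖
        ≤ ∫ t in Ioi (0 : ℝ), C * (t ^ (p - 1) * (1 + t) ^ (-(p + δ))) := by
          refine norm_integral_le_of_norm_le ((integrableOn_Ioi_rpow_mul_one_add_rpow
            (by linarith) (by linarith)).const_mul C) ?_
          filter_upwards [ae_restrict_mem measurableSet_Ioi] with t ht
            using norm_rpow_smul_defect_le ht (hv t ht)
      _ = I * C := by rw [integral_const_mul, mul_comm]

end IsResolventFamily

theorem negPow_eq_smul_resolventIntegral (A : X →ₗ.[ℂ] X) (p : ℝ) :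
    negPow A p = (Real.sin (Real.pi * p) / Real.pi) •
      resolventIntegral (fun t : ℝ => boundedInverse (shift (t : ℂ) A)) p := by
  simp only [negPow, resolventIntegral, Complex.coe_smul]

theorem sin_pi_mul_div_pi_pos {p : ℝ} (hp : 0 < p) (hp1 : p < 1) :
    0 < Real.sin (Real.pi * p) / Real.pi :=
  div_pos (Real.sin_pos_of_pos_of_lt_pi (by positivity)
    (mul_lt_of_lt_one_right Real.pi_pos hp1)) Real.pi_pos

namespace IsPositiveOperator

variable {A : X →ₗ.[ℂ] X} {p : ℝ}

theorem isBoundedInverse (hA : IsPositiveOperator A) {t : ℝ} (ht : 0 ≤ t) :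
    IsBoundedInverse (shift (t : ℂ) A) (boundedInverse (shift (t : ℂ) A)) := by
  obtain ⟨M, hM⟩ := hA
  obtain ⟨R, hR, -⟩ := hM t ht
  rwa [hR.boundedInverse_eq]

theorem exists_isResolventFamily (hA : IsPositiveOperator A) :
    ∃ M, IsResolventFamily (fun t : ℝ => boundedInverse (shift (t : ℂ) A)) M := by
  obtain ⟨M, hM⟩ := id hA
  refine ⟨M, fun s t hs ht => ?_, fun t ht => ?_⟩
  · rw [(hA.isBoundedInverse hs).resolvent_identity (hA.isBoundedInverse ht),
      ← Complex.ofReal_sub, Complex.coe_smul]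
  · obtain ⟨R, hR, hR'⟩ := hM t ht
    rwa [hR.boundedInverse_eq]

variable [CompleteSpace X]

theorem negPow_injective (hA : IsPositiveOperator A) (hp : 0 < p) (hp1 : p < 1) :
    Function.Injective (negPow A p) := by
  obtain ⟨M, hR⟩ := hA.exists_isResolventFamily
  have hinj := hR.resolventIntegral_injective (hA.isBoundedInverse le_rfl).injective hp hp1
  intro u v huv
  rw [negPow_eq_smul_resolventIntegral] at huv
  exact hinj (smul_right_injective X (sin_pi_mul_div_pi_pos hp hp1).ne' huv)

theorem mem_fracPow_graph (hA : IsPositiveOperator A) (hp : 0 < p) (hp1 : p < 1) (g : X) :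
    (negPow A p g, g) ∈ (fracPow A p).graph := by
  have hker : LinearMap.ker ((negPow A p : X →ₗ[ℂ] X).toPMap ⊤).toFun = ⊥ :=
    LinearMap.ker_eq_bot.2 fun _ _ hxy => Subtype.ext (hA.negPow_injective hp hp1 hxy)
  exact LinearPMap.mem_inverse_graph hker ⟨g, trivial⟩

/-- The decay condition reads `‖A (A + t)⁻¹ v‖ = O(t ^ (-(p + δ)))`. -/
theorem exists_fracPow_eq (hA : IsPositiveOperator A) {δ : ℝ} (hp : 0 < p) (hp1 : p < 1)
    (hδ : 0 < δ) : ∃ L : ℝ, ∀ (C : ℝ) (v : X),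
      (∀ t : ℝ, 0 < t → ‖v - t • boundedInverse (shift (t : ℂ) A) v‖ ≤ C * (1 + t) ^ (-(p + δ))) →
      ∃ u : (fracPow A p).domain, (u : X) = v ∧ ‖fracPow A p u‖ ≤ L * C := by
  obtain ⟨M, hR⟩ := hA.exists_isResolventFamily
  obtain ⟨L, hL⟩ := hR.exists_resolventIntegral_apply_eq hp hp1 hδ
  have hσ := sin_pi_mul_div_pi_pos hp hp1
  set σ := Real.sin (Real.pi * p) / Real.pi
  refine ⟨σ⁻¹ * L, fun C v hv => ?_⟩
  obtain ⟨g, hg, hgC⟩ := hL C v hv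
  have hgv : negPow A p (σ⁻¹ • g) = v := by
    rw [ContinuousLinearMap.map_smul_of_tower, negPow_eq_smul_resolventIntegral,
      smul_apply, hg, inv_smul_smul₀ hσ.ne']
  obtain ⟨u, hu, hug⟩ := (LinearPMap.mem_graph_iff _).1
    (hgv ▸ hA.mem_fracPow_graph hp hp1 (σ⁻¹ • g))
  refine ⟨u, hu, ?_⟩
  rw [hug, norm_smul, Real.norm_of_nonneg (by positivity), mul_assoc]
  gcongr

end IsPositiveOperator

end FractionalPowers

/-! ### The Fourier transform on `L¹` -/

section Fourier

open FourierTransform Filter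

variable {E : Type*} [NormedAddCommGroup E] [InnerProductSpace ℝ E] [FiniteDimensional ℝ E]
  [MeasurableSpace E] [BorelSpace E]

/-- The value at `ξ` of the Fourier transform of an integrable function. -/
def fourierAt (ξ : E) : (E →₁[volume] ℂ) →L[ℂ] ℂ :=
  (BoundedContinuousFunction.evalCLM ℂ ξ).comp (Real.Lp.fourierTransformCLM E ℂ)

theorem fourierAt_apply (ξ : E) (u : E →₁[volume] ℂ) : fourierAt ξ u = 𝓕 (u : E → ℂ) ξ := rfl

theorem fourierAt_toLp (ξ : E) {f : E → ℂ} (hf : MemLp f 1) : fourierAt ξ hf.toLp = 𝓕 f ξ :=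
  Real.fourier_congr_ae hf.coeFn_toLp ξ

theorem continuous_fourierAt (u : E →₁[volume] ℂ) : Continuous fun ξ => fourierAt ξ u :=
  (Real.Lp.fourierTransformCLM E ℂ u).continuous

theorem toTemperedDistributionCLM_fourier (u : E →₁[volume] ℂ) (ψ : 𝓢(E, ℂ)) :
    Lp.toTemperedDistributionCLM ℂ volume 1 u (𝓕 ψ) = ∫ ξ, ψ ξ • fourierAt ξ u := by
  have h := VectorFourier.integral_fourierIntegral_smul_eq_flip (L := innerₗ E)
    Real.continuous_fourierChar continuous_inner (ψ.integrable (μ := volume))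
    (L1.integrable_coeFn u)
  rw [Lp.toTemperedDistributionCLM_apply, Lp.toTemperedDistribution_apply]
  simpa using! h

theorem fourierMultiplierCLM_toTemperedDistributionCLM_fourier {g : E → ℂ}
    (hg : g.HasTemperateGrowth) (u : E →₁[volume] ℂ) (ψ : 𝓢(E, ℂ)) :
    TemperedDistribution.fourierMultiplierCLM ℂ g
      (Lp.toTemperedDistributionCLM ℂ volume 1 u) (𝓕 ψ) = ∫ ξ, ψ ξ • (g ξ * fourierAt ξ u) := by
  rw [TemperedDistribution.fourierMultiplierCLM_apply_apply, fourierInv_fourier_eq,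
    toTemperedDistributionCLM_fourier]
  refine integral_congr_ae (Eventually.of_forall fun ξ => ?_)
  simp only [SchwartzMap.smulLeftCLM_apply_apply hg, smul_eq_mul]
  ring

theorem eq_of_integral_schwartz_smul_eq {f g : E → ℂ} (hf : Continuous f) (hg : Continuous g)
    (h : ∀ ψ : 𝓢(E, ℂ), ∫ ξ, ψ ξ • f ξ = ∫ ξ, ψ ξ • g ξ) : f = g := by
  refine (Continuous.ae_eq_iff_eq volume hf hg).1 (ae_eq_of_integral_contDiff_smul_eq
    hf.locallyIntegrable hg.locallyIntegrable fun φ hφ hφs => ?_)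
  have hφs' : HasCompactSupport (Complex.ofRealCLM ∘ φ) := hφs.comp_left rfl
  simpa using h (hφs'.toSchwartzMap (Complex.ofRealCLM.contDiff.comp hφ))

theorem toTemperedDistributionCLM_eq_fourierMultiplierCLM_iff {g : E → ℂ}
    (hg : g.HasTemperateGrowth) (u w : E →₁[volume] ℂ) :
    Lp.toTemperedDistributionCLM ℂ volume 1 w =
      TemperedDistribution.fourierMultiplierCLM ℂ g (Lp.toTemperedDistributionCLM ℂ volume 1 u) ↔
    ∀ ξ, fourierAt ξ w = g ξ * fourierAt ξ u := by
  constructor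
  · intro h
    refine congrFun (eq_of_integral_schwartz_smul_eq (continuous_fourierAt w)
      (hg.1.continuous.mul (continuous_fourierAt u)) fun ψ => ?_)
    rw [← toTemperedDistributionCLM_fourier, h,
      fourierMultiplierCLM_toTemperedDistributionCLM_fourier hg]
  · intro h
    ext φ
    obtain ⟨ψ, rfl⟩ : ∃ ψ : 𝓢(E, ℂ), 𝓕 ψ = φ := ⟨𝓕⁻ φ, fourier_fourierInv_eq φ⟩
    rw [toTemperedDistributionCLM_fourier,
      fourierMultiplierCLM_toTemperedDistributionCLM_fourier hg]
    simp only [h]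

theorem fourierAt_injective {u w : E →₁[volume] ℂ} (h : ∀ ξ, fourierAt ξ u = fourierAt ξ w) :
    u = w := by
  have h1 := (toTemperedDistributionCLM_eq_fourierMultiplierCLM_iff
    (Function.HasTemperateGrowth.const (1 : ℂ)) w u).2 fun ξ => by rw [h, one_mul]
  rw [TemperedDistribution.fourierMultiplierCLM_const, one_smul] at h1
  exact LinearMap.ker_eq_bot.1
    (Lp.ker_toTemperedDistributionCLM_eq_bot (F := ℂ) (μ := volume) (p := 1)) h1

/-- The symbol `|2 π ξ|²` of `-Δ`; the Fourier transform has the kernel `e ^ (-2 π i x ξ)`. -/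
def laplaceSymbol (ξ : E) : ℝ := (2 * Real.pi) ^ 2 * ‖ξ‖ ^ 2

omit [InnerProductSpace ℝ E] [FiniteDimensional ℝ E] [MeasurableSpace E] [BorelSpace E] in
theorem laplaceSymbol_nonneg (ξ : E) : 0 ≤ laplaceSymbol ξ := by
  unfold laplaceSymbol
  positivity

theorem laplacian_toTemperedDistributionCLM_eq_iff (u w : E →₁[volume] ℂ) :
    Δ (Lp.toTemperedDistributionCLM ℂ volume 1 u) = Lp.toTemperedDistributionCLM ℂ volume 1 w ↔
      ∀ ξ, fourierAt ξ w = -laplaceSymbol ξ * fourierAt ξ u := by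
  have hg : (fun x : E => ((‖x‖ ^ 2 : ℝ) : ℂ)).HasTemperateGrowth := by fun_prop
  have hcg : ((-(2 * Real.pi) ^ 2 : ℂ) •
      fun x : E => ((‖x‖ ^ 2 : ℝ) : ℂ)).HasTemperateGrowth :=
    (Function.HasTemperateGrowth.const (-(2 * Real.pi) ^ 2 : ℂ)).mul hg
  have hΔ : Δ (Lp.toTemperedDistributionCLM ℂ volume 1 u) =
      TemperedDistribution.fourierMultiplierCLM ℂ ((-(2 * Real.pi) ^ 2 : ℂ) •
        fun x : E => ((‖x‖ ^ 2 : ℝ) : ℂ)) (Lp.toTemperedDistributionCLM ℂ volume 1 u) := by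
    rw [TemperedDistribution.laplacian_eq_fourierMultiplierCLM,
      TemperedDistribution.fourierMultiplierCLM_smul hg, ← Complex.coe_smul]
    push_cast
    rfl
  rw [hΔ, eq_comm, toTemperedDistributionCLM_eq_fourierMultiplierCLM_iff hcg]
  refine forall_congr' fun ξ => ?_
  simp [laplaceSymbol, mul_assoc]

theorem mem_laplacianL1_graph_iff_fourierAt (u w : L1) :
    (u, w) ∈ laplacianL1.graph ↔ ∀ ξ, fourierAt ξ w = -laplaceSymbol ξ * fourierAt ξ u := by
  rw [mem_laplacianL1_graph, laplacian_toTemperedDistributionCLM_eq_iff]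

theorem isBesselPotential_iff_fourierAt (β : ℝ) (f u : L1) :
    IsBesselPotential β f u ↔
      ∀ ξ, fourierAt ξ u = (((1 + laplaceSymbol ξ) ^ (-β) : ℝ) : ℂ) * fourierAt ξ f := by
  have hsymbol (ξ : Plane) : besselSymbol β ξ = (((1 + laplaceSymbol ξ) ^ (-β) : ℝ) : ℂ) := by
    rw [besselSymbol, laplaceSymbol, norm_smul, Real.norm_of_nonneg (by positivity), mul_pow]
  rw [IsBesselPotential,
    toTemperedDistributionCLM_eq_fourierMultiplierCLM_iff (besselSymbol_hasTemperateGrowth β)]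
  simp only [hsymbol]

theorem isBoundedInverse_shift_neg_laplacianL1 {z : ℂ} {G : L1 →L[ℂ] L1}
    (hz : ∀ ξ : Plane, z + laplaceSymbol ξ ≠ 0)
    (hG : ∀ f ξ, fourierAt ξ (G f) = (z + laplaceSymbol ξ)⁻¹ * fourierAt ξ f) :
    IsBoundedInverse (shift z (-laplacianL1)) G := by
  intro u x
  have hgraph : (u, x) ∈ (shift z (-laplacianL1)).graph ↔
      ∀ ξ, fourierAt ξ x = (z + laplaceSymbol ξ) * fourierAt ξ u := by
    simp only [mem_shift_graph, mem_neg_graph, mem_laplacianL1_graph_iff_fourierAt, map_neg]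
    constructor
    · rintro ⟨y, hy, rfl⟩ ξ
      rw [map_add, map_smul, smul_eq_mul, ← neg_neg (fourierAt ξ y), hy ξ]
      ring
    · refine fun h => ⟨x - z • u, fun ξ => ?_, by abel⟩
      rw [map_sub, map_smul, h, smul_eq_mul]
      ring
  rw [hgraph]
  constructor
  · intro h
    refine fourierAt_injective fun ξ => ?_
    rw [hG, h, inv_mul_cancel_left₀ (hz ξ)]
  · rintro rfl ξ
    rw [hG, mul_inv_cancel_left₀ (hz ξ)]

end Fourier

/-! ### Convolution and multiplication operators on `L¹` -/

section Convolution

open FourierTransform Filter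
open scoped Convolution

theorem enorm_L1_eq {α : Type*} [MeasurableSpace α] {μ : Measure α} (f : α →₁[μ] ℂ) :
    ‖f‖ₑ = ∫⁻ x, ‖f x‖ₑ ∂μ := by
  rw [Lp.enorm_def, eLpNorm_one_eq_lintegral_enorm]

theorem enorm_complex_ofReal (x : ℝ) : ‖(x : ℂ)‖ₑ = ‖x‖ₑ := by
  rw [← ofReal_norm, Complex.norm_real, ofReal_norm]

theorem norm_le_mul_norm_of_enorm_le {X Y : Type*} [SeminormedAddCommGroup X]
    [SeminormedAddCommGroup Y] {C : ℝ} (hC : 0 ≤ C) {f : X} {g : Y}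
    (h : ‖f‖ₑ ≤ ENNReal.ofReal C * ‖g‖ₑ) : ‖f‖ ≤ C * ‖g‖ := by
  rw [← ofReal_norm, ← ofReal_norm, ← ENNReal.ofReal_mul hC] at h
  exact (ENNReal.ofReal_le_ofReal_iff (by positivity)).1 h

section AddGroup

variable {G : Type*} [AddGroup G] [MeasurableSpace G] [MeasurableAdd₂ G] [MeasurableNeg G]
  {μ : Measure G} [SFinite μ]

theorem lintegral_mul_lintegral_sub_le {W k F : G → ℝ≥0∞} (hW : Measurable W)
    (hk : Measurable k) (hF : Measurable F) {c : ℝ≥0∞} (h : ∀ y, ∫⁻ x, W x * k (x - y) ∂μ ≤ c) :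
    ∫⁻ x, W x * ∫⁻ y, k (x - y) * F y ∂μ ∂μ ≤ c * ∫⁻ y, F y ∂μ := by
  calc ∫⁻ x, W x * ∫⁻ y, k (x - y) * F y ∂μ ∂μ
      = ∫⁻ x, ∫⁻ y, W x * (k (x - y) * F y) ∂μ ∂μ := by
        refine lintegral_congr fun x => ?_
        rw [lintegral_const_mul _ (by fun_prop)]
    _ = ∫⁻ y, ∫⁻ x, W x * (k (x - y) * F y) ∂μ ∂μ := by
        refine lintegral_lintegral_swap (Measurable.aemeasurable ?_)
        simp only [Function.uncurry_def]
        fun_prop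
    _ = ∫⁻ y, (∫⁻ x, W x * k (x - y) ∂μ) * F y ∂μ := by
        refine lintegral_congr fun y => ?_
        rw [← lintegral_mul_const _ (by fun_prop)]
        exact lintegral_congr fun x => by ring
    _ ≤ ∫⁻ y, c * F y ∂μ := by gcongr with y; exact h y
    _ = c * ∫⁻ y, F y ∂μ := lintegral_const_mul _ hF

omit [MeasurableAdd₂ G] [MeasurableNeg G] [SFinite μ] in
theorem enorm_convolution_le (f k : G → ℂ) (x : G) :
    ‖(f ⋆[ContinuousLinearMap.mul ℂ ℂ, μ] k) x‖ₑ ≤ ∫⁻ y, ‖k (x - y)‖ₑ * ‖f y‖ₑ ∂μ := by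
  refine (enorm_integral_le_lintegral_enorm _).trans_eq (lintegral_congr fun y => ?_)
  rw [ContinuousLinearMap.mul_apply', enorm_mul, mul_comm]

theorem lintegral_enorm_convolution_le [μ.IsAddRightInvariant] {f k : G → ℂ} (hf : Measurable f)
    (hk : Measurable k) :
    ∫⁻ x, ‖(f ⋆[ContinuousLinearMap.mul ℂ ℂ, μ] k) x‖ₑ ∂μ ≤
      (∫⁻ x, ‖k x‖ₑ ∂μ) * ∫⁻ y, ‖f y‖ₑ ∂μ := by
  have h := lintegral_mul_lintegral_sub_le (μ := μ) (W := fun _ => 1) (c := ∫⁻ x, ‖k x‖ₑ ∂μ)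
    measurable_const hk.enorm hf.enorm
    (fun y => by simp [lintegral_sub_right_eq_self (fun x => ‖k x‖ₑ) y])
  simp only [one_mul] at h
  exact (lintegral_mono (enorm_convolution_le f k)).trans h

end AddGroup

section Operator

variable {E : Type*} [NormedAddCommGroup E] [InnerProductSpace ℝ E] [FiniteDimensional ℝ E]
  [MeasurableSpace E] [BorelSpace E]

theorem memLp_convolution {k : E → ℂ} (hk : Integrable k) (f : E →₁[volume] ℂ) :
    MemLp (f ⋆[ContinuousLinearMap.mul ℂ ℂ] k) 1 :=
  memLp_one_iff_integrable.2 ((L1.integrable_coeFn f).integrable_convolution _ hk)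

theorem fourierAt_toLp_convolution {k : E → ℂ} (hk : Integrable k) (f : E →₁[volume] ℂ) (ξ : E) :
    fourierAt ξ (memLp_convolution hk f).toLp = 𝓕 k ξ * fourierAt ξ f := by
  rw [fourierAt_toLp, Real.fourier_mul_convolution_eq (L1.integrable_coeFn f) hk, mul_comm,
    fourierAt_apply]

/-- Convolution with an integrable kernel as a bounded operator on `L¹`; additivity is read off the
Fourier transform. -/
def convL1 (k : E → ℂ) (hk : Integrable k) (hkm : Measurable k) :
    (E →₁[volume] ℂ) →L[ℂ] E →₁[volume] ℂ :=
  LinearMap.mkContinuous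
    { toFun := fun f => (memLp_convolution hk f).toLp
      map_add' := fun f g => fourierAt_injective fun ξ => by
        rw [map_add, fourierAt_toLp_convolution hk, fourierAt_toLp_convolution hk,
          fourierAt_toLp_convolution hk, map_add, mul_add]
      map_smul' := fun c f => fourierAt_injective fun ξ => by
        rw [map_smul, fourierAt_toLp_convolution hk, fourierAt_toLp_convolution hk, map_smul,
          smul_eq_mul, smul_eq_mul, RingHom.id_apply, mul_left_comm] }
    (∫⁻ x, ‖k x‖ₑ).toReal fun f => by
      refine norm_le_mul_norm_of_enorm_le ENNReal.toReal_nonneg ?_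
      rw [ENNReal.ofReal_toReal hk.2.ne, enorm_L1_eq, enorm_L1_eq]
      refine le_trans (lintegral_congr_ae ?_).le
        (lintegral_enorm_convolution_le (Lp.stronglyMeasurable f).measurable hkm)
      exact (memLp_convolution hk f).coeFn_toLp.fun_comp enorm

variable {k : E → ℂ} (hk : Integrable k) (hkm : Measurable k)

theorem convL1_ae (f : E →₁[volume] ℂ) : ∀ᵐ x, convL1 k hk hkm f x = ∫ y, k (x - y) * f y := by
  filter_upwards [(memLp_convolution hk f).coeFn_toLp] with x hx
  refine hx.trans ?_
  rw [convolution_mul]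
  exact integral_congr_ae (Eventually.of_forall fun y => mul_comm _ _)

theorem enorm_convL1_ae_le (f : E →₁[volume] ℂ) :
    ∀ᵐ x, ‖convL1 k hk hkm f x‖ₑ ≤ ∫⁻ y, ‖k (x - y)‖ₑ * ‖f y‖ₑ := by
  filter_upwards [(memLp_convolution hk f).coeFn_toLp] with x hx
  exact (congrArg enorm hx).le.trans (enorm_convolution_le f k x)

theorem fourierAt_convL1 (f : E →₁[volume] ℂ) (ξ : E) :
    fourierAt ξ (convL1 k hk hkm f) = 𝓕 k ξ * fourierAt ξ f :=
  fourierAt_toLp_convolution hk f ξ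

theorem norm_convL1_le {C : ℝ} (hC : 0 ≤ C) (h : ∫⁻ x, ‖k x‖ₑ ≤ ENNReal.ofReal C) :
    ‖convL1 k hk hkm‖ ≤ C :=
  (LinearMap.mkContinuous_norm_le _ ENNReal.toReal_nonneg _).trans
    (ENNReal.toReal_le_of_le_ofReal hC h)

theorem lintegral_mul_enorm_convL1_le {W : E → ℝ≥0∞} (hW : Measurable W) {κ : ℝ≥0∞}
    (h : ∀ y, ∫⁻ x, W x * ‖k (x - y)‖ₑ ≤ κ) (f : E →₁[volume] ℂ) :
    ∫⁻ x, W x * ‖convL1 k hk hkm f x‖ₑ ≤ κ * ‖f‖ₑ := by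
  rw [enorm_L1_eq]
  refine le_trans (lintegral_mono_ae ?_) (lintegral_mul_lintegral_sub_le hW hkm.enorm
    (Lp.stronglyMeasurable f).measurable.enorm h)
  filter_upwards [enorm_convL1_ae_le hk hkm f] with x hx
  gcongr

end Operator

theorem exists_mul_comp {V : Plane → ℝ} (hV : Measurable V) (T : L1 →L[ℂ] L1) {κ : ℝ} (hκ : 0 ≤ κ)
    (hT : ∀ f : L1, ∫⁻ x, ‖V x‖ₑ * ‖T f x‖ₑ ≤ ENNReal.ofReal κ * ‖f‖ₑ) :
    ∃ K : L1 →L[ℂ] L1, (∀ f, (T f, K f) ∈ (mulL1 V).graph) ∧ ‖K‖ ≤ κ := by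
  have henorm (f : L1) (x : Plane) : ‖(V x : ℂ) * T f x‖ₑ = ‖V x‖ₑ * ‖T f x‖ₑ := by
    rw [enorm_mul, enorm_complex_ofReal]
  have hmem (f : L1) : MemLp (fun x => (V x : ℂ) * T f x) 1 := by
    refine ⟨((Complex.measurable_ofReal.comp hV).mul
      (Lp.stronglyMeasurable (T f)).measurable).aestronglyMeasurable, ?_⟩
    rw [eLpNorm_one_eq_lintegral_enorm, lintegral_congr (henorm f)]
    exact (hT f).trans_lt (ENNReal.mul_lt_top ENNReal.ofReal_lt_top (enorm_lt_top (x := f)))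
  have hgraph (f : L1) : (T f, (hmem f).toLp) ∈ (mulL1 V).graph :=
    (mem_mulL1_graph _ _ _).2 (hmem f).coeFn_toLp
  let L : L1 →ₗ[ℂ] L1 :=
    { toFun := fun f => (hmem f).toLp
      map_add' := fun f g => (mulL1 V).mem_graph_snd_inj (hgraph (f + g))
        ((mulL1 V).graph.add_mem (hgraph f) (hgraph g)) (map_add T f g)
      map_smul' := fun c f => (mulL1 V).mem_graph_snd_inj (hgraph (c • f))
        ((mulL1 V).graph.smul_mem c (hgraph f)) (map_smul T c f) }
  refine ⟨L.mkContinuous κ fun f => norm_le_mul_norm_of_enorm_le hκ (le_trans (le_of_eq ?_) (hT f)),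
    hgraph, LinearMap.mkContinuous_norm_le _ hκ _⟩
  rw [enorm_L1_eq, ← lintegral_congr (henorm f)]
  exact lintegral_congr_ae ((hmem f).coeFn_toLp.fun_comp enorm)

end Convolution

/-! ### Mixtures of Gaussians -/

section GaussianMixture

open Filter

theorem rpow_half_sq (a : ℝ≥0∞) : (a ^ (1 / 2 : ℝ)) ^ 2 = a := by
  rw [← ENNReal.rpow_two, ← ENNReal.rpow_mul]
  norm_num

theorem sq_lintegral_mul_le {α : Type*} [MeasurableSpace α] {μ : Measure α} {f g : α → ℝ≥0∞}
    (hf : AEMeasurable f μ) (hg : AEMeasurable g μ) :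
    (∫⁻ x, f x * g x ∂μ) ^ 2 ≤ (∫⁻ x, f x ^ 2 ∂μ) * ∫⁻ x, g x ^ 2 ∂μ := by
  have h := ENNReal.lintegral_mul_le_Lp_mul_Lq μ Real.HolderConjugate.two_two hf hg
  simp only [Pi.mul_apply, ENNReal.rpow_two] at h
  calc (∫⁻ x, f x * g x ∂μ) ^ 2
      ≤ ((∫⁻ x, f x ^ 2 ∂μ) ^ (1 / 2 : ℝ) * (∫⁻ x, g x ^ 2 ∂μ) ^ (1 / 2 : ℝ)) ^ 2 := by gcongr
    _ = _ := by rw [mul_pow, rpow_half_sq, rpow_half_sq]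

theorem lintegral_gaussian {b : ℝ} (hb : 0 < b) :
    ∫⁻ x : Plane, ENNReal.ofReal (Real.exp (-b * ‖x‖ ^ 2)) = ENNReal.ofReal (Real.pi / b) := by
  have h : ∫ v : Plane, Real.exp (-b * ‖v‖ ^ 2) = Real.pi / b := by
    rw [GaussianFourier.integral_rexp_neg_mul_sq_norm hb]
    simp
  have h_int : Integrable fun v : Plane => Real.exp (-b * ‖v‖ ^ 2) :=
    not_imp_comm.1 integral_undef (h.trans_ne (by positivity))
  rw [← h, ofReal_integral_eq_lintegral_ofReal h_int
    (Eventually.of_forall fun _ => (Real.exp_pos _).le)]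

theorem eLpNorm_gaussian {r : ℝ≥0∞} (hr0 : r ≠ 0) (hr : r ≠ ∞) {b : ℝ} (hb : 0 < b) (y : Plane) :
    eLpNorm (fun x : Plane => Real.exp (-b * ‖x - y‖ ^ 2)) r volume =
      ENNReal.ofReal ((Real.pi / (r.toReal * b)) ^ (1 / r.toReal)) := by
  have hr' : 0 < r.toReal := ENNReal.toReal_pos hr0 hr
  have hpow (x : Plane) : ‖Real.exp (-b * ‖x - y‖ ^ 2)‖ₑ ^ r.toReal =
      ENNReal.ofReal (Real.exp (-(r.toReal * b) * ‖x - y‖ ^ 2)) := by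
    rw [Real.enorm_of_nonneg (Real.exp_pos _).le, ENNReal.ofReal_rpow_of_pos (Real.exp_pos _),
      ← Real.exp_mul]
    congr 2
    ring
  rw [eLpNorm_eq_lintegral_rpow_enorm_toReal hr0 hr, lintegral_congr hpow,
    lintegral_sub_right_eq_self
      (fun x : Plane => ENNReal.ofReal (Real.exp (-(r.toReal * b) * ‖x‖ ^ 2))) y,
    lintegral_gaussian (by positivity), ENNReal.ofReal_rpow_of_pos (by positivity)]

theorem lintegral_mul_gaussian_le {q r : ℝ≥0∞} [ENNReal.HolderConjugate q r] (hr0 : r ≠ 0)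
    (hr : r ≠ ∞) {V : Plane → ℝ} (hV : AEStronglyMeasurable V) {b : ℝ} (hb : 0 < b) (y : Plane) :
    ∫⁻ x, ‖V x‖ₑ * ENNReal.ofReal (Real.exp (-b * ‖x - y‖ ^ 2)) ≤
      eLpNorm V q volume * ENNReal.ofReal ((Real.pi / (r.toReal * b)) ^ (1 / r.toReal)) := by
  have hg : AEStronglyMeasurable (fun x : Plane => Real.exp (-b * ‖x - y‖ ^ 2)) volume :=
    Measurable.aestronglyMeasurable (by fun_prop)
  have h := eLpNorm_smul_le_mul_eLpNorm (p := q) (q := r) (r := 1) hg hV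
  rw [eLpNorm_one_eq_lintegral_enorm, eLpNorm_gaussian hr0 hr hb] at h
  refine le_trans (lintegral_congr fun x => ?_).le h
  rw [Pi.smul_apply', smul_eq_mul, enorm_mul, Real.enorm_of_nonneg (Real.exp_pos _).le]

theorem lintegral_Ioi_exp_neg_mul_mul_rpow {μ a : ℝ} (hμ : 0 < μ) (ha : 0 < a) :
    ∫⁻ t in Ioi (0 : ℝ), ENNReal.ofReal (Real.exp (-μ * t) * t ^ (a - 1)) =
      ENNReal.ofReal ((1 / μ) ^ a * Real.Gamma a) := by
  have h := Real.integral_rpow_mul_exp_neg_mul_Ioi ha hμ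
  have hpos : 0 < (1 / μ) ^ a * Real.Gamma a :=
    mul_pos (by positivity) (Real.Gamma_pos_of_pos ha)
  have h_int : IntegrableOn (fun t : ℝ => t ^ (a - 1) * Real.exp (-(μ * t))) (Ioi 0) :=
    not_imp_comm.1 integral_undef (h.trans_ne hpos.ne')
  rw [← h, ofReal_integral_eq_lintegral_ofReal h_int]
  · refine lintegral_congr fun t => ?_
    rw [mul_comm, neg_mul]
  · filter_upwards [ae_restrict_mem measurableSet_Ioi] with t ht
    exact mul_nonneg (Real.rpow_nonneg (le_of_lt ht) _) (Real.exp_pos _).le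

/-- The superposition `∫₀^∞ w t e ^ (-|x|² / (c t)) dt` of heat kernels. -/
def gaussianMixture (w : ℝ → ℝ) (c : ℝ) (x : Plane) : ℝ≥0∞ :=
  ∫⁻ t in Ioi (0 : ℝ), ENNReal.ofReal (w t * Real.exp (-(c * t)⁻¹ * ‖x‖ ^ 2))

theorem gaussianMixture_neg (w : ℝ → ℝ) (c : ℝ) (x : Plane) :
    gaussianMixture w c (-x) = gaussianMixture w c x := by
  simp only [gaussianMixture, norm_neg]

section

variable {w : ℝ → ℝ} {c : ℝ} (hw : Measurable w)

include hw

theorem measurable_gaussianMixture : Measurable (gaussianMixture w c) :=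
  Measurable.lintegral_prod_right' (f := fun z : Plane × ℝ => ENNReal.ofReal
    (w z.2 * Real.exp (-(c * z.2)⁻¹ * ‖z.1‖ ^ 2))) (by fun_prop)

theorem lintegral_mul_gaussianMixture (hw0 : ∀ t, 0 < t → 0 ≤ w t) {W : Plane → ℝ≥0∞}
    (hW : Measurable W) (y : Plane) :
    ∫⁻ x, W x * gaussianMixture w c (x - y) = ∫⁻ t in Ioi (0 : ℝ), ENNReal.ofReal (w t) *
      ∫⁻ x, W x * ENNReal.ofReal (Real.exp (-(c * t)⁻¹ * ‖x - y‖ ^ 2)) := by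
  calc ∫⁻ x, W x * gaussianMixture w c (x - y)
      = ∫⁻ x, ∫⁻ t in Ioi (0 : ℝ), W x * ENNReal.ofReal
          (w t * Real.exp (-(c * t)⁻¹ * ‖x - y‖ ^ 2)) := by
        refine lintegral_congr fun x => ?_
        rw [gaussianMixture, lintegral_const_mul _ (by fun_prop)]
    _ = ∫⁻ t in Ioi (0 : ℝ), ∫⁻ x, W x * ENNReal.ofReal
          (w t * Real.exp (-(c * t)⁻¹ * ‖x - y‖ ^ 2)) := by
        refine lintegral_lintegral_swap (Measurable.aemeasurable ?_)
        simp only [Function.uncurry_def]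
        fun_prop
    _ = _ := by
        refine setLIntegral_congr_fun measurableSet_Ioi fun t ht => ?_
        rw [← lintegral_const_mul _ (by fun_prop)]
        refine lintegral_congr fun x => ?_
        rw [ENNReal.ofReal_mul (hw0 t ht), mul_left_comm]

theorem lintegral_gaussianMixture (hw0 : ∀ t, 0 < t → 0 ≤ w t) (hc : 0 < c) :
    ∫⁻ x, gaussianMixture w c x =
      ENNReal.ofReal (Real.pi * c) * ∫⁻ t in Ioi (0 : ℝ), ENNReal.ofReal (w t * t) := by
  have h := lintegral_mul_gaussianMixture (c := c) hw hw0 measurable_one 0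
  simp only [Pi.one_apply, one_mul, sub_zero] at h
  rw [h, ← lintegral_const_mul _ (by fun_prop)]
  refine setLIntegral_congr_fun measurableSet_Ioi fun t (ht : 0 < t) => ?_
  rw [lintegral_gaussian (by positivity), ← ENNReal.ofReal_mul (hw0 t ht),
    ← ENNReal.ofReal_mul (by positivity), div_inv_eq_mul]
  congr 1
  ring

end

/-- The kernel `∫₀^∞ e ^ (-μ t) t⁻¹ e ^ (-|x|² / (16 t)) dt`. It dominates the resolvent kernels of
the Laplacian; the `16`, in place of the `4` of the heat kernel, absorbs the complex rotation of
the time and an exponential weight. -/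
def domKernel (μ : ℝ) : Plane → ℝ≥0∞ := gaussianMixture (fun t => Real.exp (-μ * t) * t⁻¹) 16

theorem domKernel_neg (μ : ℝ) (x : Plane) : domKernel μ (-x) = domKernel μ x :=
  gaussianMixture_neg _ _ x

theorem measurable_domKernel (μ : ℝ) : Measurable (domKernel μ) :=
  measurable_gaussianMixture (by fun_prop)

theorem lintegral_domKernel {μ : ℝ} (hμ : 0 < μ) :
    ∫⁻ x, domKernel μ x = ENNReal.ofReal (16 * Real.pi / μ) := by
  have hexp := lintegral_Ioi_exp_neg_mul_mul_rpow hμ one_pos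
  simp only [sub_self, Real.rpow_zero, mul_one, Real.rpow_one, Real.Gamma_one] at hexp
  have hw : ∫⁻ t in Ioi (0 : ℝ), ENNReal.ofReal (Real.exp (-μ * t) * t⁻¹ * t) =
      ENNReal.ofReal (1 / μ) := by
    rw [← hexp]
    refine setLIntegral_congr_fun measurableSet_Ioi fun t (ht : 0 < t) => ?_
    rw [inv_mul_cancel_right₀ ht.ne']
  rw [domKernel, lintegral_gaussianMixture (by fun_prop) (fun t ht => by positivity) (by norm_num),
    hw, ← ENNReal.ofReal_mul (by positivity)]
  congr 1
  ring

theorem domKernel_sq_le (μ : ℝ) (x : Plane) :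
    domKernel μ x ^ 2 ≤
      (∫⁻ t in Ioi (0 : ℝ), ENNReal.ofReal (Real.exp (-μ * t) * t ^ (1 / 2 - 1 : ℝ))) *
        gaussianMixture (fun t => Real.exp (-μ * t) * t ^ (-(3 / 2) : ℝ)) 8 x := by
  have hexp (t : ℝ) : Real.exp (-μ * t) = Real.exp (-μ / 2 * t) * Real.exp (-μ / 2 * t) := by
    rw [← Real.exp_add]
    ring_nf
  have hgauss (t : ℝ) : Real.exp (-(8 * t)⁻¹ * ‖x‖ ^ 2) =
      Real.exp (-(16 * t)⁻¹ * ‖x‖ ^ 2) * Real.exp (-(16 * t)⁻¹ * ‖x‖ ^ 2) := by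
    rw [← Real.exp_add, mul_inv, mul_inv]
    ring_nf
  have h := sq_lintegral_mul_le (μ := volume.restrict (Ioi (0 : ℝ)))
    (f := fun t => ENNReal.ofReal (Real.exp (-μ / 2 * t) * t ^ (-(1 / 4) : ℝ)))
    (g := fun t => ENNReal.ofReal (Real.exp (-μ / 2 * t) * t ^ (-(3 / 4) : ℝ) *
      Real.exp (-(16 * t)⁻¹ * ‖x‖ ^ 2))) (by fun_prop) (by fun_prop)
  convert h using 2 <;>
    refine setLIntegral_congr_fun measurableSet_Ioi fun t (ht : 0 < t) => ?_
  · have hpow : t⁻¹ = t ^ (-(1 / 4) : ℝ) * t ^ (-(3 / 4) : ℝ) := by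
      rw [← Real.rpow_add ht, ← Real.rpow_neg_one]
      norm_num
    beta_reduce
    rw [← ENNReal.ofReal_mul (by positivity), hexp, hpow]
    ring_nf
  · have hpow : t ^ (1 / 2 - 1 : ℝ) = t ^ (-(1 / 4) : ℝ) * t ^ (-(1 / 4) : ℝ) := by
      rw [← Real.rpow_add ht]
      norm_num
    rw [← ENNReal.ofReal_pow (by positivity), hexp, hpow]
    ring_nf
  · have hpow : t ^ (-(3 / 2) : ℝ) = t ^ (-(3 / 4) : ℝ) * t ^ (-(3 / 4) : ℝ) := by
      rw [← Real.rpow_add ht]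
      norm_num
    beta_reduce
    rw [← ENNReal.ofReal_pow (by positivity), hexp, hpow, hgauss]
    ring_nf

theorem lintegral_domKernel_sq_lt_top {μ : ℝ} (hμ : 0 < μ) : ∫⁻ x, domKernel μ x ^ 2 < ∞ := by
  set c : ℝ≥0∞ := ∫⁻ t in Ioi (0 : ℝ), ENNReal.ofReal (Real.exp (-μ * t) * t ^ (1 / 2 - 1 : ℝ))
    with hc
  have hc_top : c < ∞ := by
    rw [hc, lintegral_Ioi_exp_neg_mul_mul_rpow hμ (by norm_num)]
    exact ENNReal.ofReal_lt_top
  have hw : ∫⁻ t in Ioi (0 : ℝ),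
      ENNReal.ofReal (Real.exp (-μ * t) * t ^ (-(3 / 2) : ℝ) * t) = c := by
    refine setLIntegral_congr_fun measurableSet_Ioi fun t (ht : 0 < t) => ?_
    rw [mul_assoc, ← Real.rpow_add_one ht.ne']
    norm_num
  calc ∫⁻ x, domKernel μ x ^ 2 ≤ ∫⁻ x, c *
        gaussianMixture (fun t => Real.exp (-μ * t) * t ^ (-(3 / 2) : ℝ)) 8 x :=
        lintegral_mono (domKernel_sq_le μ)
    _ = c * (ENNReal.ofReal (Real.pi * 8) * c) := by
        rw [lintegral_const_mul _ (measurable_gaussianMixture (by fun_prop)),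
          lintegral_gaussianMixture (by fun_prop) (fun t ht => by positivity) (by norm_num), hw]
    _ < ∞ := ENNReal.mul_lt_top hc_top (ENNReal.mul_lt_top ENNReal.ofReal_lt_top hc_top)

/-- A quantitative Kato condition on the potential: multiplication by `V` is bounded relative to
`-Δ + μ` on `L¹`, with relative bound `C μ ^ (-a)`. -/
structure KatoBound (V : Plane → ℝ) (C a : ℝ) : Prop where
  measurable : Measurable V
  nonneg : 0 ≤ C
  pos : 0 < a
  lintegral_le : ∀ μ : ℝ, 0 < μ → ∀ y,
    ∫⁻ x, ‖V x‖ₑ * domKernel μ (x - y) ≤ ENNReal.ofReal (C * (1 / μ) ^ a)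

theorem exists_katoBound {q : ℝ≥0∞} (hq : 1 < q) {V : Plane → ℝ} (hV : Measurable V)
    (hVq : MemLp V q) : ∃ C a : ℝ, KatoBound V C a := by
  set r := (1 - q⁻¹)⁻¹ with hr
  have hconj : ENNReal.HolderConjugate q r := ENNReal.HolderConjugate.inv_one_sub_inv' hq.le
  have hr_top : r ≠ ∞ := by
    rw [hr, ne_eq, ENNReal.inv_eq_top, tsub_eq_zero_iff_le, not_le]
    exact ENNReal.inv_lt_one.2 hq
  have hr0 : r ≠ 0 := by
    rw [hr, ne_eq, ENNReal.inv_eq_zero]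
    exact ne_top_of_le_ne_top ENNReal.one_ne_top tsub_le_self
  have hρ : 0 < r.toReal := ENNReal.toReal_pos hr0 hr_top
  set ρ := r.toReal
  set N := (eLpNorm V q volume).toReal
  have hN0 : 0 ≤ N := ENNReal.toReal_nonneg
  have hN : eLpNorm V q volume = ENNReal.ofReal N := (ENNReal.ofReal_toReal hVq.2.ne).symm
  refine ⟨N * (16 * Real.pi / ρ) ^ (1 / ρ) * Real.Gamma (1 / ρ), 1 / ρ, hV,
    mul_nonneg (by positivity) (Real.Gamma_pos_of_pos (by positivity)).le, by positivity,
    fun μ hμ y => ?_⟩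
  rw [domKernel, lintegral_mul_gaussianMixture (by fun_prop) (fun t ht => by positivity) hV.enorm]
  calc _ ≤ ∫⁻ t in Ioi (0 : ℝ), ENNReal.ofReal (N * (16 * Real.pi / ρ) ^ (1 / ρ)) *
        ENNReal.ofReal (Real.exp (-μ * t) * t ^ (1 / ρ - 1)) := by
        refine setLIntegral_mono' measurableSet_Ioi fun t (ht : 0 < t) => ?_
        refine (mul_le_mul_right (lintegral_mul_gaussian_le (q := q) hr0 hr_top
          hV.aestronglyMeasurable (by positivity) y) _).trans_eq ?_
        have hpow : (Real.pi / (ρ * (16 * t)⁻¹)) ^ (1 / ρ) =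
            (16 * Real.pi / ρ) ^ (1 / ρ) * t ^ (1 / ρ) := by
          rw [← Real.mul_rpow (by positivity) ht.le]
          field_simp
        rw [hN, hpow, Real.rpow_sub_one ht.ne', ← ENNReal.ofReal_mul hN0,
          ← ENNReal.ofReal_mul (by positivity), ← ENNReal.ofReal_mul (by positivity)]
        ring_nf
    _ = _ := by
        rw [lintegral_const_mul _ (by fun_prop),
          lintegral_Ioi_exp_neg_mul_mul_rpow hμ (by positivity),
          ← ENNReal.ofReal_mul (by positivity)]
        ring_nf

end GaussianMixture

/-! ### The free resolvent -/

section ResolventKernel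

open FourierTransform

/-- The heat kernel at the complex time `ω t`, times `ω e ^ (-z ω t)`. -/
def heatIntegrand (z ω : ℂ) (t : ℝ) (x : Plane) : ℂ :=
  Complex.exp (-(z * ω) * t) * ((4 * Real.pi * t)⁻¹ : ℝ) * Complex.exp (-(4 * ω * t)⁻¹ * ‖x‖ ^ 2)

/-- The kernel of `(-Δ + z)⁻¹`, as an integral of the heat kernel over the ray `ω ℝ₊`. -/
def resolventKernel (z ω : ℂ) (x : Plane) : ℂ := ∫ t in Ioi (0 : ℝ), heatIntegrand z ω t x

theorem inv_four_mul_mul_ofReal (ω : ℂ) (t : ℝ) :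
    ((4 * ω * t)⁻¹ : ℂ) = ω⁻¹ * ((4 * t)⁻¹ : ℝ) := by
  push_cast
  rw [mul_inv, mul_inv, mul_inv]
  ring

theorem measurable_heatIntegrand (z ω : ℂ) :
    Measurable fun p : ℝ × Plane => heatIntegrand z ω p.1 p.2 := by
  unfold heatIntegrand
  fun_prop

theorem measurable_resolventKernel (z ω : ℂ) : Measurable (resolventKernel z ω) := by
  have h : StronglyMeasurable fun p : Plane × ℝ => heatIntegrand z ω p.2 p.1 :=
    ((measurable_heatIntegrand z ω).comp measurable_swap).stronglyMeasurable
  exact (h.integral_prod_right' (ν := volume.restrict (Ioi 0))).measurable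

theorem resolventKernel_neg (z ω : ℂ) (x : Plane) :
    resolventKernel z ω (-x) = resolventKernel z ω x := by
  simp only [resolventKernel, heatIntegrand, norm_neg]

theorem conj_resolventKernel_one (l : ℝ) (x : Plane) :
    (starRingEnd ℂ) (resolventKernel l 1 x) = resolventKernel l 1 x := by
  rw [resolventKernel, ← integral_conj]
  refine integral_congr_ae (.of_forall fun t => ?_)
  simp only [heatIntegrand, map_mul, ← Complex.exp_conj, map_neg, map_inv₀, map_pow,
    Complex.conj_ofReal, map_one, map_ofNat]

theorem norm_heatIntegrand_le {z ω : ℂ} {μ : ℝ} (hμ : μ ≤ (z * ω).re) (hω : 1 / 2 ≤ (ω⁻¹).re)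
    {t : ℝ} (ht : 0 < t) (x : Plane) :
    ‖heatIntegrand z ω t x‖ ≤
      Real.exp (-μ * t) * (4 * Real.pi * t)⁻¹ * Real.exp (-(8 * t)⁻¹ * ‖x‖ ^ 2) := by
  rw [heatIntegrand, norm_mul, norm_mul, Complex.norm_exp, Complex.norm_exp, Complex.norm_real,
    Real.norm_of_nonneg (by positivity)]
  have h1 : (-(z * ω) * (t : ℂ)).re = -(z * ω).re * t := by
    rw [Complex.re_mul_ofReal, Complex.neg_re]
  have h2 : (-(4 * ω * (t : ℂ))⁻¹ * ((‖x‖ : ℂ) ^ 2)).re = -((4 * t)⁻¹ * (ω⁻¹).re) * ‖x‖ ^ 2 := by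
    rw [inv_four_mul_mul_ofReal, ← Complex.ofReal_pow, Complex.re_mul_ofReal, Complex.neg_re,
      Complex.re_mul_ofReal]
    ring
  have h3 : (8 * t)⁻¹ = (4 * t)⁻¹ * (1 / 2) := by
    field_simp
    norm_num
  rw [h1, h2, h3]
  gcongr

theorem exp_mul_mul_exp_neg_sq_le (η r : ℝ) {t : ℝ} (ht : 0 < t) :
    Real.exp (η * r) * Real.exp (-(8 * t)⁻¹ * r ^ 2) ≤
      Real.exp (4 * η ^ 2 * t) * Real.exp (-(16 * t)⁻¹ * r ^ 2) := by
  rw [← Real.exp_add, ← Real.exp_add, Real.exp_le_exp]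
  have hsq : (16 * t)⁻¹ * (r - 8 * η * t) ^ 2 =
      (8 * t)⁻¹ * r ^ 2 - (16 * t)⁻¹ * r ^ 2 - η * r + 4 * η ^ 2 * t := by
    field_simp
    ring
  have hnonneg : 0 ≤ (16 * t)⁻¹ * (r - 8 * η * t) ^ 2 := by positivity
  linarith

theorem weight_mul_norm_heatIntegrand_le {z ω : ℂ} {μ η : ℝ} (hμ : μ ≤ (z * ω).re)
    (hω : 1 / 2 ≤ (ω⁻¹).re) {t : ℝ} (ht : 0 < t) (x : Plane) :
    Real.exp (η * ‖x‖) * ‖heatIntegrand z ω t x‖ ≤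
      Real.exp (-(μ - 4 * η ^ 2) * t) * t⁻¹ * Real.exp (-(16 * t)⁻¹ * ‖x‖ ^ 2) := by
  have hinv : (4 * Real.pi * t)⁻¹ ≤ t⁻¹ := by
    gcongr
    nlinarith [Real.pi_gt_three]
  have hexp : Real.exp (-(μ - 4 * η ^ 2) * t) = Real.exp (-μ * t) * Real.exp (4 * η ^ 2 * t) := by
    rw [← Real.exp_add]
    ring_nf
  calc Real.exp (η * ‖x‖) * ‖heatIntegrand z ω t x‖
      ≤ Real.exp (η * ‖x‖) *
        (Real.exp (-μ * t) * t⁻¹ * Real.exp (-(8 * t)⁻¹ * ‖x‖ ^ 2)) := by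
        gcongr
        exact (norm_heatIntegrand_le hμ hω ht x).trans (by gcongr)
    _ = Real.exp (-μ * t) * t⁻¹ * (Real.exp (η * ‖x‖) * Real.exp (-(8 * t)⁻¹ * ‖x‖ ^ 2)) := by ring
    _ ≤ Real.exp (-μ * t) * t⁻¹ *
        (Real.exp (4 * η ^ 2 * t) * Real.exp (-(16 * t)⁻¹ * ‖x‖ ^ 2)) := by
        gcongr ?_ * ?_
        exact exp_mul_mul_exp_neg_sq_le η ‖x‖ ht
    _ = _ := by
        rw [hexp]
        ring

theorem weight_mul_enorm_resolventKernel_le {z ω : ℂ} {μ : ℝ} (η : ℝ) (hμ : μ ≤ (z * ω).re)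
    (hω : 1 / 2 ≤ (ω⁻¹).re) (x : Plane) :
    ENNReal.ofReal (Real.exp (η * ‖x‖)) * ‖resolventKernel z ω x‖ₑ ≤
      domKernel (μ - 4 * η ^ 2) x := by
  calc ENNReal.ofReal (Real.exp (η * ‖x‖)) * ‖resolventKernel z ω x‖ₑ
      ≤ ENNReal.ofReal (Real.exp (η * ‖x‖)) *
        ∫⁻ t in Ioi (0 : ℝ), ‖heatIntegrand z ω t x‖ₑ := by
        gcongr
        exact enorm_integral_le_lintegral_enorm _
    _ = ∫⁻ t in Ioi (0 : ℝ), ENNReal.ofReal (Real.exp (η * ‖x‖)) * ‖heatIntegrand z ω t x‖ₑ := by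
        rw [lintegral_const_mul]
        exact ((measurable_heatIntegrand z ω).comp measurable_prodMk_right).enorm
    _ ≤ domKernel (μ - 4 * η ^ 2) x := by
        refine setLIntegral_mono' measurableSet_Ioi fun t ht => ?_
        rw [← ofReal_norm, ← ENNReal.ofReal_mul (Real.exp_pos _).le]
        exact ENNReal.ofReal_le_ofReal (weight_mul_norm_heatIntegrand_le hμ hω ht x)

theorem enorm_resolventKernel_le {z ω : ℂ} {μ : ℝ} (hμ : μ ≤ (z * ω).re)
    (hω : 1 / 2 ≤ (ω⁻¹).re) (x : Plane) : ‖resolventKernel z ω x‖ₑ ≤ domKernel μ x := by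
  simpa using weight_mul_enorm_resolventKernel_le 0 hμ hω x

theorem integrable_heatIntegrand {z ω : ℂ} (hμ : 0 < (z * ω).re) (hω : 1 / 2 ≤ (ω⁻¹).re) :
    Integrable (fun p : ℝ × Plane => heatIntegrand z ω p.1 p.2)
      ((volume.restrict (Ioi 0)).prod volume) := by
  refine ⟨(measurable_heatIntegrand z ω).aestronglyMeasurable, ?_⟩
  rw [hasFiniteIntegral_iff_enorm, lintegral_prod_symm _
    (measurable_heatIntegrand z ω).enorm.aemeasurable]
  refine lt_of_le_of_lt (lintegral_mono fun x => ?_)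
    ((lintegral_domKernel hμ).trans_lt ENNReal.ofReal_lt_top)
  refine setLIntegral_mono' measurableSet_Ioi fun t ht => ?_
  rw [← ofReal_norm]
  refine ENNReal.ofReal_le_ofReal ?_
  simpa using weight_mul_norm_heatIntegrand_le (η := 0) le_rfl hω ht x (z := z)

theorem integrable_resolventKernel {z ω : ℂ} (hμ : 0 < (z * ω).re) (hω : 1 / 2 ≤ (ω⁻¹).re) :
    Integrable (resolventKernel z ω) :=
  (integrable_heatIntegrand hμ hω).integral_prod_right

theorem fourier_heatIntegrand (z : ℂ) {ω : ℂ} (hω : 1 / 2 ≤ (ω⁻¹).re) {t : ℝ} (ht : 0 < t)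
    (ξ : Plane) : 𝓕 (heatIntegrand z ω t) ξ =
      ω * Complex.exp (-((z + laplaceSymbol ξ) * ω) * t) := by
  have hω0 : ω ≠ 0 := by
    rintro rfl
    norm_num at hω
  have ht0 : (t : ℂ) ≠ 0 := Complex.ofReal_ne_zero.2 ht.ne'
  have hb : 0 < ((4 * ω * (t : ℂ))⁻¹).re := by
    rw [inv_four_mul_mul_ofReal, Complex.re_mul_ofReal]
    exact mul_pos (one_half_pos.trans_le hω) (by positivity)
  have hmul : 𝓕 (heatIntegrand z ω t) ξ =
      (Complex.exp (-(z * ω) * t) * ((4 * Real.pi * t)⁻¹ : ℝ)) *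
        𝓕 (fun v : Plane => Complex.exp (-(4 * ω * (t : ℂ))⁻¹ * ‖v‖ ^ 2)) ξ := by
    rw [Real.fourier_eq, Real.fourier_eq, ← integral_const_mul]
    refine integral_congr_ae (.of_forall fun x => ?_)
    simp only [heatIntegrand, Circle.smul_def, smul_eq_mul]
    ring
  have hdim : (Module.finrank ℝ Plane : ℂ) / 2 = 1 := by simp
  have hexp : Complex.exp (-((z + laplaceSymbol ξ) * ω) * t) = Complex.exp (-(z * ω) * t) *
      Complex.exp (-(Real.pi : ℂ) ^ 2 * ‖ξ‖ ^ 2 / (4 * ω * t)⁻¹) := by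
    rw [← Complex.exp_add, laplaceSymbol, div_inv_eq_mul]
    push_cast
    ring_nf
  rw [hmul, fourier_gaussian_innerProductSpace hb, hdim, Complex.cpow_one, hexp]
  push_cast
  have hpi : (Real.pi : ℂ) ≠ 0 := Complex.ofReal_ne_zero.2 Real.pi_ne_zero
  field_simp

theorem re_add_laplaceSymbol_mul_pos {z ω : ℂ} (hμ : 0 < (z * ω).re) (hω : 1 / 2 ≤ (ω⁻¹).re)
    (ξ : Plane) : 0 < ((z + laplaceSymbol ξ) * ω).re := by
  have hω_re : 0 ≤ ω.re := by
    by_contra! h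
    have := div_nonpos_of_nonpos_of_nonneg h.le (Complex.normSq_nonneg ω)
    rw [Complex.inv_re] at hω
    linarith
  rw [add_mul, Complex.add_re, Complex.re_ofReal_mul]
  have := mul_nonneg (laplaceSymbol_nonneg ξ) hω_re
  linarith

theorem add_laplaceSymbol_ne_zero {z ω : ℂ} (hμ : 0 < (z * ω).re) (hω : 1 / 2 ≤ (ω⁻¹).re)
    (ξ : Plane) : z + laplaceSymbol ξ ≠ 0 := fun h => by
  simpa [h] using re_add_laplaceSymbol_mul_pos hμ hω ξ

theorem fourier_resolventKernel {z ω : ℂ} (hμ : 0 < (z * ω).re) (hω : 1 / 2 ≤ (ω⁻¹).re)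
    (ξ : Plane) : 𝓕 (resolventKernel z ω) ξ = (z + laplaceSymbol ξ)⁻¹ := by
  have hre := re_add_laplaceSymbol_mul_pos hμ hω ξ
  have hne := add_laplaceSymbol_ne_zero hμ hω ξ
  have hω0 : ω ≠ 0 := by
    rintro rfl
    simp at hμ
  have hintg : Integrable (fun p : ℝ × Plane =>
      Real.fourierChar (-inner ℝ p.2 ξ) • heatIntegrand z ω p.1 p.2)
      ((volume.restrict (Ioi 0)).prod volume) := by
    have h := integrable_heatIntegrand hμ hω
    refine h.mono (.smul ?_ h.aestronglyMeasurable) (.of_forall fun p => (Circle.norm_smul _ _).le)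
    have hc : Continuous fun p : ℝ × Plane => -inner ℝ p.2 ξ := by fun_prop
    exact (continuous_subtype_val.comp
      (Real.continuous_fourierChar.comp hc)).aestronglyMeasurable
  calc 𝓕 (resolventKernel z ω) ξ
      = ∫ x, ∫ t in Ioi (0 : ℝ), Real.fourierChar (-inner ℝ x ξ) • heatIntegrand z ω t x := by
        rw [Real.fourier_eq]
        refine integral_congr_ae (.of_forall fun x => ?_)
        simp only [resolventKernel, Circle.smul_def]
        rw [integral_smul]
    _ = ∫ t in Ioi (0 : ℝ), 𝓕 (heatIntegrand z ω t) ξ := (integral_integral_swap hintg).symm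
    _ = ∫ t in Ioi (0 : ℝ), ω * Complex.exp (-((z + laplaceSymbol ξ) * ω) * t) :=
        setIntegral_congr_fun measurableSet_Ioi fun t ht => fourier_heatIntegrand z hω ht ξ
    _ = _ := by
        rw [integral_const_mul, integral_exp_mul_complex_Ioi (by rwa [Complex.neg_re, neg_lt_zero])]
        simp only [Complex.ofReal_zero, mul_zero, Complex.exp_zero]
        field_simp

/-- The resolvent `(-Δ + z)⁻¹` on `L¹`. -/
def freeResolvent (z ω : ℂ) (hμ : 0 < (z * ω).re) (hω : 1 / 2 ≤ (ω⁻¹).re) : L1 →L[ℂ] L1 :=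
  convL1 (resolventKernel z ω) (integrable_resolventKernel hμ hω) (measurable_resolventKernel z ω)

theorem fourierAt_freeResolvent {z ω : ℂ} (hμ : 0 < (z * ω).re) (hω : 1 / 2 ≤ (ω⁻¹).re) (f : L1)
    (ξ : Plane) :
    fourierAt ξ (freeResolvent z ω hμ hω f) = (z + laplaceSymbol ξ)⁻¹ * fourierAt ξ f := by
  rw [freeResolvent, fourierAt_convL1, fourier_resolventKernel hμ hω]

theorem isBoundedInverse_freeResolvent {z ω : ℂ} (hμ : 0 < (z * ω).re) (hω : 1 / 2 ≤ (ω⁻¹).re) :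
    IsBoundedInverse (shift z (-laplacianL1)) (freeResolvent z ω hμ hω) :=
  isBoundedInverse_shift_neg_laplacianL1 (add_laplaceSymbol_ne_zero hμ hω)
    (fourierAt_freeResolvent hμ hω)

theorem norm_freeResolvent_le {z ω : ℂ} (hμ : 0 < (z * ω).re) (hω : 1 / 2 ≤ (ω⁻¹).re) :
    ‖freeResolvent z ω hμ hω‖ ≤ 16 * Real.pi / (z * ω).re := by
  refine norm_convL1_le _ _ (by positivity) ?_
  rw [← lintegral_domKernel hμ]
  exact lintegral_mono fun x => enorm_resolventKernel_le le_rfl hω x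

end ResolventKernel

/-! ### Resolvents of the Schrödinger operator far from the spectrum -/

section Perturbation

theorem exists_forall_mul_rpow_le (C : ℝ) {a : ℝ} (ha : 0 < a) {δ : ℝ} (hδ : 0 < δ) :
    ∃ μ₀ : ℝ, 1 ≤ μ₀ ∧ ∀ μ, μ₀ ≤ μ → C * (1 / μ) ^ a ≤ δ := by
  have h : Filter.Tendsto (fun μ : ℝ => C * (1 / μ) ^ a) Filter.atTop (nhds (C * 0)) := by
    refine (Filter.Tendsto.congr' ?_ (tendsto_rpow_neg_atTop ha)).const_mul C
    filter_upwards [Filter.eventually_gt_atTop 0] with μ hμ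
    rw [one_div, Real.inv_rpow hμ.le, Real.rpow_neg hμ.le]
  rw [mul_zero] at h
  obtain ⟨m, hm⟩ := Filter.eventually_atTop.1 (h.eventually (eventually_le_nhds hδ))
  exact ⟨max 1 m, le_max_left _ _, fun μ hμ => hm μ ((le_max_right _ _).trans hμ)⟩

theorem one_half_le_inv_one : (1 : ℝ) / 2 ≤ ((1 : ℂ)⁻¹).re := by norm_num

theorem one_half_le_inv_one_sub_I {σ : ℝ} (hσ : σ ^ 2 = 1) :
    1 / 2 ≤ ((1 - σ * Complex.I)⁻¹).re := by
  have hσ' : σ * σ = 1 := by rwa [← pow_two]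
  rw [Complex.inv_re, Complex.normSq_apply]
  norm_num [hσ']

theorem mul_one_sub_I_re {σ : ℝ} (hσ : σ ^ 2 = 1) (s : ℝ) :
    ((σ * Complex.I * s) * (1 - σ * Complex.I)).re = s := by
  have h : (σ * Complex.I * s) * (1 - σ * Complex.I) = s * σ ^ 2 + (σ * s : ℝ) * Complex.I := by
    push_cast
    linear_combination -(s : ℂ) * σ ^ 2 * Complex.I_sq
  rw [h, ← Complex.ofReal_pow, hσ]
  simp

namespace KatoBound

variable {V : Plane → ℝ} {C a : ℝ} {z ω : ℂ}

theorem exists_mul_freeResolvent (hV : KatoBound V C a) (hμ : 0 < (z * ω).re)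
    (hω : 1 / 2 ≤ (ω⁻¹).re) :
    ∃ K : L1 →L[ℂ] L1, (∀ f, (freeResolvent z ω hμ hω f, K f) ∈ (mulL1 V).graph) ∧
      ‖K‖ ≤ C * (1 / (z * ω).re) ^ a := by
  have hC := hV.nonneg
  refine exists_mul_comp hV.measurable _ (by positivity) fun f => ?_
  refine lintegral_mul_enorm_convL1_le _ _ hV.measurable.enorm (fun y => ?_) f
  refine le_trans (lintegral_mono fun x => ?_) (hV.lintegral_le _ hμ y)
  gcongr
  exact enorm_resolventKernel_le le_rfl hω _

theorem exists_isBoundedInverse (hV : KatoBound V C a) (hμ : 0 < (z * ω).re)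
    (hω : 1 / 2 ≤ (ω⁻¹).re) (hsmall : C * (1 / (z * ω).re) ^ a ≤ 1 / 2) :
    ∃ U : L1 ≃L[ℂ] L1,
      IsBoundedInverse (shift z (schrodinger V)) (freeResolvent z ω hμ hω ∘L U.symm) ∧
        ‖(U.symm : L1 →L[ℂ] L1)‖ ≤ 2 := by
  obtain ⟨K, hK, hKn⟩ := hV.exists_mul_freeResolvent hμ hω
  obtain ⟨U, hU, hUn⟩ := exists_equiv_add_apply (hKn.trans hsmall)
  refine ⟨U, ?_, hUn⟩
  rw [schrodinger, shift_add]
  exact (isBoundedInverse_freeResolvent hμ hω).add hK hU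

/-- At `± i s` the kernel is integrated along the ray through `1 ∓ i`, where the heat kernel still
decays. -/
theorem exists_resolvent_of_large (hV : KatoBound V C a) :
    ∃ S : ℝ, 1 ≤ S ∧ ∀ s, S ≤ s → ∀ σ : ℝ, σ ^ 2 = 1 → ∃ R : L1 →L[ℂ] L1,
      IsBoundedInverse (shift (σ * Complex.I * s) (schrodinger V)) R ∧
        ‖R‖ ≤ 32 * Real.pi / s := by
  obtain ⟨S, hS, hsmall⟩ := exists_forall_mul_rpow_le C hV.pos one_half_pos
  refine ⟨S, hS, fun s hs σ hσ => ?_⟩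
  have hre := mul_one_sub_I_re hσ s
  have hs0 : 0 < s := by linarith
  have hμ : 0 < ((σ * Complex.I * s) * (1 - σ * Complex.I)).re := by rwa [hre]
  have hω := one_half_le_inv_one_sub_I hσ
  obtain ⟨U, hR, hU⟩ := hV.exists_isBoundedInverse hμ hω (by rw [hre]; exact hsmall s hs)
  refine ⟨_, hR, (ContinuousLinearMap.opNorm_comp_le _ _).trans ?_⟩
  calc _ ≤ 16 * Real.pi / s * 2 := by
        gcongr
        exact (norm_freeResolvent_le hμ hω).trans_eq (by rw [hre])
    _ = 32 * Real.pi / s := by ring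

end KatoBound

end Perturbation

/-! ### Weighted estimates for convolutions -/

section Young

variable {G : Type*} [AddCommGroup G] [MeasurableSpace G] [MeasurableAdd₂ G] [MeasurableNeg G]
  {μ : Measure G} {f g : G → ℝ≥0∞}

omit [MeasurableAdd₂ G] [MeasurableNeg G] in
theorem lconvolution_eq_lintegral_sub (f g : G → ℝ≥0∞) (x : G) :
    (f ⋆ₗ[μ] g) x = ∫⁻ y, g (x - y) * f y ∂μ := by
  simp only [lconvolution_def, neg_add_eq_sub, mul_comm]

variable [μ.IsAddLeftInvariant]

theorem lintegral_lconvolution_le [SFinite μ] (hf : Measurable f) (hg : Measurable g) :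
    ∫⁻ x, (f ⋆ₗ[μ] g) x ∂μ ≤ (∫⁻ x, g x ∂μ) * ∫⁻ x, f x ∂μ := by
  have h := lintegral_mul_lintegral_sub_le (μ := μ) (W := fun _ => 1) (c := ∫⁻ x, g x ∂μ)
    measurable_const hg hf
    (fun y => by simp only [one_mul, lintegral_sub_right_eq_self g y, le_refl])
  simpa only [one_mul, ← lconvolution_eq_lintegral_sub] using h

variable [μ.IsNegInvariant]

theorem sq_lconvolution_le (hf : Measurable f) (hg : Measurable g) (x : G) :
    (f ⋆ₗ[μ] g) x ^ 2 ≤ (∫⁻ y, g y ^ 2 ∂μ) * ∫⁻ y, f y ^ 2 ∂μ := by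
  rw [lconvolution_eq_lintegral_sub, ← lintegral_sub_left_eq_self (fun y => g y ^ 2) x]
  exact sq_lintegral_mul_le (by fun_prop) hf.aemeasurable

theorem lintegral_sq_lconvolution_le [SFinite μ] (hf : Measurable f) (hg : Measurable g) :
    ∫⁻ x, (f ⋆ₗ[μ] g) x ^ 2 ∂μ ≤ (∫⁻ x, g x ∂μ) ^ 2 * ∫⁻ x, f x ^ 2 ∂μ := by
  have hpt (x : G) : (f ⋆ₗ[μ] g) x ^ 2 ≤
      (∫⁻ y, g y ∂μ) * ((fun y => f y ^ 2) ⋆ₗ[μ] g) x := by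
    have h := sq_lintegral_mul_le (μ := μ) (f := fun y => g (x - y) ^ (1 / 2 : ℝ))
      (g := fun y => g (x - y) ^ (1 / 2 : ℝ) * f y) (by fun_prop) (by fun_prop)
    simp only [← mul_assoc, ← pow_two, mul_pow, rpow_half_sq] at h
    rwa [lconvolution_eq_lintegral_sub, lconvolution_eq_lintegral_sub,
      ← lintegral_sub_left_eq_self g x]
  calc _ ≤ ∫⁻ x, (∫⁻ y, g y ∂μ) * ((fun y => f y ^ 2) ⋆ₗ[μ] g) x ∂μ := lintegral_mono hpt
    _ = (∫⁻ y, g y ∂μ) * ∫⁻ x, ((fun y => f y ^ 2) ⋆ₗ[μ] g) x ∂μ :=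
        lintegral_const_mul _ (measurable_lconvolution μ (hf.pow_const 2) hg)
    _ ≤ (∫⁻ y, g y ∂μ) * ((∫⁻ y, g y ∂μ) * ∫⁻ y, f y ^ 2 ∂μ) := by
        gcongr
        exact lintegral_lconvolution_le (hf.pow_const 2) hg
    _ = _ := by ring

end Young

section Weighted

/-- The exponential weight `e ^ (-ε |x - y|)` centred at `y`. -/
def expWeight (ε : ℝ) (y x : Plane) : ℝ≥0∞ := ENNReal.ofReal (Real.exp (-ε * ‖x - y‖))

/-- A convolution kernel to which the energy method applies: `k` is real and even, it is dominated
by `D` even after multiplication with `e ^ (2 |x|)`, and `|V|` has relative bound `1 / 2` with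
respect to convolution with `D`. -/
structure IsGoodKernel (V : Plane → ℝ) (k : Plane → ℂ) (D : Plane → ℝ≥0∞) : Prop where
  measurable : Measurable k
  measurable_dom : Measurable D
  integrable : Integrable k
  even : ∀ x, k (-x) = k x
  even_dom : ∀ x, D (-x) = D x
  real : ∀ x, (starRingEnd ℂ) (k x) = k x
  weight_le : ∀ x, ENNReal.ofReal (Real.exp (2 * ‖x‖)) * ‖k x‖ₑ ≤ D x
  lintegral_ne_top : ∫⁻ x, D x ≠ ∞
  lintegral_sq_ne_top : ∫⁻ x, D x ^ 2 ≠ ∞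
  small : ∀ y, ∫⁻ x, ‖V x‖ₑ * D (x - y) ≤ 1 / 2

theorem measurable_expWeight (ε : ℝ) (y : Plane) : Measurable (expWeight ε y) := by
  unfold expWeight
  fun_prop

theorem expWeight_le_one {ε : ℝ} (hε : 0 ≤ ε) (y x : Plane) : expWeight ε y x ≤ 1 := by
  rw [expWeight, ENNReal.ofReal_le_one, Real.exp_le_one_iff, neg_mul, neg_nonpos]
  positivity

theorem expWeight_le_exp_mul {ε : ℝ} (hε : 0 ≤ ε) (hε1 : ε ≤ 1) (y x z : Plane) :
    expWeight ε y x ≤ ENNReal.ofReal (Real.exp (2 * ‖x - z‖)) * expWeight ε y z := by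
  rw [expWeight, expWeight, ← ENNReal.ofReal_mul (Real.exp_pos _).le, ← Real.exp_add]
  refine ENNReal.ofReal_le_ofReal (Real.exp_le_exp.2 ?_)
  have h := norm_sub_le_norm_sub_add_norm_sub z x y
  rw [norm_sub_rev z x] at h
  nlinarith [norm_nonneg (x - z), norm_nonneg (x - y), norm_nonneg (z - y)]

namespace IsGoodKernel

variable {V : Plane → ℝ} {k : Plane → ℂ} {D : Plane → ℝ≥0∞}

/-- Convolution with `k` as an operator on `L¹`. -/
abbrev conv (hk : IsGoodKernel V k D) : L1 →L[ℂ] L1 := convL1 k hk.integrable hk.measurable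

theorem weight_mul_enorm_conv_le (hk : IsGoodKernel V k D) {ε : ℝ} (hε : 0 ≤ ε)
    (hε1 : ε ≤ 1) (y : Plane) (f : L1) :
    ∀ᵐ x, expWeight ε y x * ‖hk.conv f x‖ₑ ≤
      ((fun z => expWeight ε y z * ‖f z‖ₑ) ⋆ₗ D) x := by
  have hkm := hk.measurable
  have : Measurable f := (Lp.stronglyMeasurable f).measurable
  filter_upwards [enorm_convL1_ae_le hk.integrable hk.measurable f] with x hx
  rw [lconvolution_eq_lintegral_sub]
  calc _ ≤ expWeight ε y x * ∫⁻ z, ‖k (x - z)‖ₑ * ‖f z‖ₑ := by gcongr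
    _ = ∫⁻ z, expWeight ε y x * (‖k (x - z)‖ₑ * ‖f z‖ₑ) :=
        (lintegral_const_mul _ (by fun_prop)).symm
    _ ≤ ∫⁻ z, D (x - z) * (expWeight ε y z * ‖f z‖ₑ) := by
        refine lintegral_mono fun z => ?_
        calc _ ≤ (ENNReal.ofReal (Real.exp (2 * ‖x - z‖)) * expWeight ε y z) *
              (‖k (x - z)‖ₑ * ‖f z‖ₑ) := by gcongr; exact expWeight_le_exp_mul hε hε1 y x z
          _ = (ENNReal.ofReal (Real.exp (2 * ‖x - z‖)) * ‖k (x - z)‖ₑ) *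
              (expWeight ε y z * ‖f z‖ₑ) := by ring
          _ ≤ _ := by gcongr; exact hk.weight_le _

theorem enorm_lconvolution_le (hk : IsGoodKernel V k D) (x : Plane) :
    ((fun z => ‖V z‖ₑ) ⋆ₗ D) x ≤ 1 / 2 := by
  rw [lconvolution_eq_lintegral_sub]
  refine le_trans (le_of_eq (lintegral_congr fun z => ?_)) (hk.small x)
  rw [← hk.even_dom, neg_sub, mul_comm]

theorem ae_eq_zero_of_le_lconvolution (hk : IsGoodKernel V k D) (hV : Measurable V)
    {E : Plane → ℝ≥0∞} (hE : Measurable E) (hVE : ∫⁻ x, ‖V x‖ₑ * E x ≠ ∞)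
    (h : ∀ᵐ x, E x ≤ ((fun z => ‖V z‖ₑ * E z) ⋆ₗ D) x) : ∀ᵐ x, E x = 0 := by
  have hD := hk.measurable_dom
  have hhalf : ∫⁻ x, ‖V x‖ₑ * E x ≤ 1 / 2 * ∫⁻ x, ‖V x‖ₑ * E x := by
    refine le_trans (lintegral_mono_ae ?_) (lintegral_mul_lintegral_sub_le
      (F := fun x => ‖V x‖ₑ * E x) hV.enorm hD (hV.enorm.mul hE) hk.small)
    filter_upwards [h] with x hx
    rw [← lconvolution_eq_lintegral_sub]
    gcongr
  have hzero : ∫⁻ x, ‖V x‖ₑ * E x = 0 := by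
    by_contra h0
    refine hhalf.not_gt ?_
    rw [one_div, mul_comm, ← div_eq_mul_inv]
    exact ENNReal.half_lt_self h0 hVE
  rw [lintegral_eq_zero_iff (by fun_prop)] at hzero
  filter_upwards [h] with x hx
  rw [lconvolution_eq_lintegral_sub] at hx
  refine nonpos_iff_eq_zero.1 (hx.trans_eq ?_)
  rw [lintegral_eq_zero_iff (by fun_prop)]
  filter_upwards [hzero] with z hz
  exact mul_eq_zero_of_right _ hz

/-- `f ↦ D * (|V| f)` is a contraction, by `enorm_lconvolution_le` on `L^∞` and by `small` on
`|V|⁻¹ L¹`; the excess of `U` over `2 m` lies in the second space and is killed there. -/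
theorem ae_le_of_le_add (hk : IsGoodKernel V k D) (hV : Measurable V)
    {U : Plane → ℝ≥0∞} (hU : Measurable U) (hVU : ∫⁻ x, ‖V x‖ₑ * U x ≠ ∞) {m : ℝ≥0∞}
    (h : ∀ᵐ x, U x ≤ m + ((fun z => ‖V z‖ₑ * U z) ⋆ₗ D) x) : ∀ᵐ x, U x ≤ 2 * m := by
  have hD := hk.measurable_dom
  have hexcess : ∀ᵐ x, U x - 2 * m ≤ ((fun z => ‖V z‖ₑ * (U z - 2 * m)) ⋆ₗ D) x := by
    filter_upwards [h] with x hx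
    have hsplit : ((fun z => ‖V z‖ₑ * U z) ⋆ₗ D) x ≤
        ((fun z => ‖V z‖ₑ) ⋆ₗ D) x * (2 * m) + ((fun z => ‖V z‖ₑ * (U z - 2 * m)) ⋆ₗ D) x := by
      simp only [lconvolution_eq_lintegral_sub]
      rw [← lintegral_mul_const _ (by fun_prop), ← lintegral_add_left (by fun_prop)]
      refine lintegral_mono fun z => ?_
      calc D (x - z) * (‖V z‖ₑ * U z) ≤ D (x - z) * (‖V z‖ₑ * (2 * m + (U z - 2 * m))) := by
            gcongr; exact le_add_tsub
        _ = _ := by ring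
    have hm : ((fun z => ‖V z‖ₑ) ⋆ₗ D) x * (2 * m) ≤ m := by
      calc _ ≤ (1 / 2 : ℝ≥0∞) * (2 * m) := by gcongr; exact hk.enorm_lconvolution_le x
        _ = m := by
          rw [← mul_assoc, one_div, ENNReal.inv_mul_cancel two_ne_zero ENNReal.ofNat_ne_top,
            one_mul]
    rw [tsub_le_iff_left]
    calc U x ≤ m + ((fun z => ‖V z‖ₑ * U z) ⋆ₗ D) x := hx
      _ ≤ m + (m + ((fun z => ‖V z‖ₑ * (U z - 2 * m)) ⋆ₗ D) x) := by
          gcongr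
          exact hsplit.trans (by gcongr)
      _ = _ := by rw [← add_assoc, two_mul]
  filter_upwards [hk.ae_eq_zero_of_le_lconvolution hV (hU.sub_const _)
    (ne_top_of_le_ne_top hVU (lintegral_mono fun x => by gcongr; exact tsub_le_self)) hexcess]
    with x hx
  exact tsub_eq_zero_iff_le.1 hx

end IsGoodKernel

end Weighted

/-! ### The weighted `L²` estimate -/

section ENNReal

theorem le_rpow_half_of_sq_le {a b : ℝ≥0∞} (h : a ^ 2 ≤ b) : a ≤ b ^ (1 / 2 : ℝ) := by
  rwa [one_div, ENNReal.le_rpow_inv_iff two_pos, ENNReal.rpow_two]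

theorem ennreal_two_mul_le_add_sq (a b : ℝ≥0∞) : 2 * a * b ≤ a ^ 2 + b ^ 2 := by
  wlog h : a ≤ b generalizing a b
  · rw [mul_right_comm, add_comm]
    exact this b a (le_of_not_ge h)
  obtain ⟨c, rfl⟩ := exists_add_of_le h
  calc 2 * a * (a + c) ≤ 2 * a * (a + c) + c ^ 2 := le_self_add
    _ = _ := by ring

theorem ennreal_add_sq_le (a b : ℝ≥0∞) : (a + b) ^ 2 ≤ 2 * (a ^ 2 + b ^ 2) := by
  have := ennreal_two_mul_le_add_sq a b
  calc (a + b) ^ 2 = a ^ 2 + b ^ 2 + 2 * a * b := by ring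
    _ ≤ a ^ 2 + b ^ 2 + (a ^ 2 + b ^ 2) := by gcongr
    _ = _ := by ring

theorem ennreal_mul_le_mul_sq_add {e : ℝ≥0∞} (he : e ≠ 0) (he' : e ≠ ∞) (a b : ℝ≥0∞) :
    a * b ≤ e * a ^ 2 + e⁻¹ * b ^ 2 := by
  rcases le_total b (e * a) with h | h
  · refine le_trans ?_ le_self_add
    calc a * b ≤ a * (e * a) := by gcongr
      _ = _ := by ring
  · refine le_trans ?_ le_add_self
    have h' : a ≤ e⁻¹ * b := by
      rwa [mul_comm, ← div_eq_mul_inv, ENNReal.le_div_iff_mul_le (.inl he) (.inl he'), mul_comm]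
    calc a * b ≤ (e⁻¹ * b) * b := by gcongr
      _ = _ := by ring

theorem ennreal_le_two_mul_of_le_half_mul_add {a b : ℝ≥0∞} (ha : a ≠ ∞) (h : a ≤ 1 / 2 * a + b) :
    a ≤ 2 * b := by
  have h' : a / 2 + a / 2 ≤ a / 2 + b := by
    rwa [ENNReal.add_halves, ENNReal.div_eq_inv_mul, ← one_div]
  rw [mul_comm, ← ENNReal.div_le_iff two_ne_zero ENNReal.ofNat_ne_top]
  exact (ENNReal.add_le_add_iff_left (ENNReal.div_ne_top ha two_ne_zero)).1 h'

end ENNReal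

theorem lintegral_lintegral_mul_le_of_symm {α : Type*} [MeasurableSpace α] {μ : Measure α}
    [SFinite μ] {N : α → α → ℝ≥0∞} (hN : Measurable (Function.uncurry N))
    (hsymm : ∀ x z, N x z = N z x) {M U : α → ℝ≥0∞} (hM : Measurable M) (hU : Measurable U)
    {κ : ℝ≥0∞} (hκ : ∀ x, ∫⁻ z, N x z * M z ∂μ ≤ κ) :
    ∫⁻ x, ∫⁻ z, N x z * (M x * U x * (M z * U z)) ∂μ ∂μ ≤ κ * ∫⁻ x, M x * U x ^ 2 ∂μ := by
  have hNx (x : α) : Measurable (N x) := hN.of_uncurry_left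
  have hN' : Measurable fun p : α × α => N p.1 p.2 := hN
  set T := ∫⁻ x, ∫⁻ z, N x z * (M x * M z * U x ^ 2) ∂μ ∂μ with hT
  have hTle : T ≤ κ * ∫⁻ x, M x * U x ^ 2 ∂μ := by
    calc T = ∫⁻ x, (M x * U x ^ 2) * ∫⁻ z, N x z * M z ∂μ ∂μ := by
          refine lintegral_congr fun x => ?_
          rw [← lintegral_const_mul _ (by fun_prop)]
          exact lintegral_congr fun z => by ring
      _ ≤ ∫⁻ x, (M x * U x ^ 2) * κ ∂μ := by gcongr with x; exact hκ x
      _ = _ := by rw [lintegral_mul_const _ (by fun_prop), mul_comm]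
  have hTswap : ∫⁻ x, ∫⁻ z, N x z * (M x * M z * U z ^ 2) ∂μ ∂μ = T := by
    rw [lintegral_lintegral_swap (Measurable.aemeasurable
      (by simp only [Function.uncurry_def]; fun_prop)), hT]
    refine lintegral_congr fun z => lintegral_congr fun x => ?_
    rw [hsymm, mul_comm (M x)]
  have htwo : 2 * ∫⁻ x, ∫⁻ z, N x z * (M x * U x * (M z * U z)) ∂μ ∂μ ≤ 2 * T := by
    have hmeas : Measurable fun p : α × α => N p.1 p.2 * (M p.1 * M p.2 * U p.1 ^ 2) := by fun_prop
    simp only [← lintegral_const_mul' 2 _ ENNReal.ofNat_ne_top]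
    calc ∫⁻ x, ∫⁻ z, 2 * (N x z * (M x * U x * (M z * U z))) ∂μ ∂μ
      _ ≤ ∫⁻ x, ∫⁻ z, (N x z * (M x * M z * U x ^ 2) + N x z * (M x * M z * U z ^ 2)) ∂μ ∂μ := by
          gcongr with x z
          calc 2 * (N x z * (M x * U x * (M z * U z)))
              = N x z * (M x * M z) * (2 * U x * U z) := by ring
            _ ≤ N x z * (M x * M z) * (U x ^ 2 + U z ^ 2) := by
                gcongr; exact ennreal_two_mul_le_add_sq _ _
            _ = _ := by ring
      _ = ∫⁻ x, (∫⁻ z, N x z * (M x * M z * U x ^ 2) ∂μ +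
            ∫⁻ z, N x z * (M x * M z * U z ^ 2) ∂μ) ∂μ :=
          lintegral_congr fun x => lintegral_add_left ((hNx x).mul (by fun_prop)) _
      _ = 2 * T := by rw [lintegral_add_left hmeas.lintegral_prod_right', hTswap, two_mul]
  exact ((ENNReal.mul_le_mul_iff_right two_ne_zero ENNReal.ofNat_ne_top).1 htwo).trans hTle

section WeightedL2

/-- The square of the weighted `L²` norm with the exponential weight centred at `y`. -/
def weightedSq (ε : ℝ) (y : Plane) (f : L1) : ℝ≥0∞ := ∫⁻ x, (expWeight ε y x * ‖f x‖ₑ) ^ 2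

/-- The square of the weighted `L²` norm with the additional weight `|ζ - V|`. -/
def weightedForm (V : Plane → ℝ) (ζ : ℂ) (ε : ℝ) (y : Plane) (f : L1) : ℝ≥0∞ :=
  ∫⁻ x, ‖ζ - V x‖ₑ * (expWeight ε y x * ‖f x‖ₑ) ^ 2

theorem measurable_expWeight_mul_enorm (ε : ℝ) (y : Plane) (f : L1) :
    Measurable fun x => expWeight ε y x * ‖f x‖ₑ :=
  (measurable_expWeight ε y).mul (Lp.stronglyMeasurable f).measurable.enorm

theorem weightedSq_add_le (ε : ℝ) (y : Plane) (f g : L1) :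
    weightedSq ε y (f + g) ≤ 2 * (weightedSq ε y f + weightedSq ε y g) := by
  have hf := measurable_expWeight_mul_enorm ε y f
  have hg := measurable_expWeight_mul_enorm ε y g
  unfold weightedSq
  rw [← lintegral_add_left (by fun_prop), ← lintegral_const_mul _ (by fun_prop)]
  refine lintegral_mono_ae ?_
  filter_upwards [Lp.coeFn_add f g] with x hx
  refine le_trans ?_ (ennreal_add_sq_le _ _)
  rw [hx, ← mul_add]
  gcongr
  exact enorm_add_le _ _

theorem enorm_sub_ofReal_le (ζ : ℂ) (r : ℝ) : ‖ζ - r‖ₑ ≤ ‖ζ‖ₑ + ‖r‖ₑ :=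
  enorm_sub_le.trans_eq (by rw [enorm_complex_ofReal])

theorem lintegral_enorm_mul_ne_top {V : Plane → ℝ} {ζ : ℂ} {u v : L1}
    (hv : ∀ᵐ x, v x = (ζ - V x) * u x) : ∫⁻ x, ‖V x‖ₑ * ‖u x‖ₑ ≠ ∞ := by
  have hum := (Lp.stronglyMeasurable u).measurable.enorm
  have h : ∫⁻ x, ‖V x‖ₑ * ‖u x‖ₑ ≤ ‖ζ‖ₑ * ‖u‖ₑ + ‖v‖ₑ := by
    rw [enorm_L1_eq, enorm_L1_eq, ← lintegral_const_mul _ hum,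
      ← lintegral_add_left (hum.const_mul _)]
    refine lintegral_mono_ae ?_
    filter_upwards [hv] with x hx
    have e : (V x : ℂ) * u x = ζ * u x - v x := by rw [hx]; ring
    rw [← enorm_complex_ofReal, ← enorm_mul, e, ← enorm_mul]
    exact enorm_sub_le
  exact ne_top_of_le_ne_top (by simp [ENNReal.mul_eq_top]) h

theorem weightedForm_le {V : Plane → ℝ} {Vs : Plane → ℝ≥0∞} {L : ℝ≥0∞} (hVs : Measurable Vs)
    (hVV : ∀ x, ‖V x‖ₑ ≤ L + Vs x) (ζ : ℂ) (ε : ℝ) (y : Plane) (f : L1) {m : ℝ≥0∞}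
    (hm : ∀ᵐ x, expWeight ε y x * ‖f x‖ₑ ≤ m) :
    weightedForm V ζ ε y f ≤ (‖ζ‖ₑ + L) * weightedSq ε y f + (∫⁻ x, Vs x) * m ^ 2 := by
  have hfm := measurable_expWeight_mul_enorm ε y f
  unfold weightedForm weightedSq
  rw [← lintegral_const_mul _ (hfm.pow_const 2), ← lintegral_mul_const _ hVs,
    ← lintegral_add_left ((hfm.pow_const 2).const_mul _)]
  refine lintegral_mono_ae ?_
  filter_upwards [hm] with x hx
  have hζV : ‖ζ - V x‖ₑ ≤ ‖ζ‖ₑ + L + Vs x := by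
    rw [add_assoc]
    exact (enorm_sub_ofReal_le ζ _).trans (by gcongr; exact hVV x)
  calc _ ≤ (‖ζ‖ₑ + L + Vs x) * (expWeight ε y x * ‖f x‖ₑ) ^ 2 := by gcongr
    _ = (‖ζ‖ₑ + L) * (expWeight ε y x * ‖f x‖ₑ) ^ 2 + Vs x * (expWeight ε y x * ‖f x‖ₑ) ^ 2 :=
        add_mul _ _ _
    _ ≤ _ := by gcongr

namespace IsGoodKernel

variable {V : Plane → ℝ} {k : Plane → ℂ} {D : Plane → ℝ≥0∞} {ε : ℝ}

theorem weightedSq_conv_le (hk : IsGoodKernel V k D) (hε : 0 ≤ ε) (hε1 : ε ≤ 1) (y : Plane)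
    (f : L1) : weightedSq ε y (hk.conv f) ≤ (∫⁻ z, D z) ^ 2 * weightedSq ε y f := by
  refine le_trans (lintegral_mono_ae ?_)
    (lintegral_sq_lconvolution_le (measurable_expWeight_mul_enorm ε y f) hk.measurable_dom)
  filter_upwards [hk.weight_mul_enorm_conv_le hε hε1 y f] with x hx
  gcongr

theorem weightedSq_conv_le_sq_lintegral (hk : IsGoodKernel V k D) (hε : 0 ≤ ε) (hε1 : ε ≤ 1)
    (y : Plane) (f : L1) :
    weightedSq ε y (hk.conv f) ≤ (∫⁻ z, D z ^ 2) * (∫⁻ z, expWeight ε y z * ‖f z‖ₑ) ^ 2 := by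
  rw [mul_comm]
  refine le_trans (lintegral_mono_ae ?_)
    (lintegral_sq_lconvolution_le hk.measurable_dom (measurable_expWeight_mul_enorm ε y f))
  filter_upwards [hk.weight_mul_enorm_conv_le hε hε1 y f] with x hx
  rw [lconvolution_comm]
  gcongr

theorem weightedSq_conv_ne_top (hk : IsGoodKernel V k D) (hε : 0 ≤ ε) (hε1 : ε ≤ 1) (y : Plane)
    (f : L1) : weightedSq ε y (hk.conv f) ≠ ∞ := by
  have h : ∫⁻ z, expWeight ε y z * ‖f z‖ₑ ≤ ‖f‖ₑ := by
    rw [enorm_L1_eq]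
    exact lintegral_mono fun z => mul_le_of_le_one_left' (expWeight_le_one hε y z)
  exact ne_top_of_le_ne_top (ENNReal.mul_ne_top hk.lintegral_sq_ne_top
    (ENNReal.pow_ne_top (ne_top_of_le_ne_top enorm_ne_top h)))
    (hk.weightedSq_conv_le_sq_lintegral hε hε1 y f)

theorem lconvolution_le_rpow (hk : IsGoodKernel V k D) (y : Plane) (f : L1) (x : Plane) :
    ((fun z => expWeight ε y z * ‖f z‖ₑ) ⋆ₗ D) x ≤
      ((∫⁻ z, D z ^ 2) * weightedSq ε y f) ^ (1 / 2 : ℝ) :=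
  le_rpow_half_of_sq_le
    (sq_lconvolution_le (measurable_expWeight_mul_enorm ε y f) hk.measurable_dom x)

theorem weight_mul_enorm_le (hk : IsGoodKernel V k D) (hV : Measurable V) (hε : 0 ≤ ε)
    (hε1 : ε ≤ 1) (y : Plane) {ζ : ℂ} {u g v : L1} (hv : ∀ᵐ x, v x = (ζ - V x) * u x)
    (hu : u = hk.conv g + hk.conv v) :
    ∀ᵐ x, expWeight ε y x * ‖u x‖ₑ ≤ 2 * (((∫⁻ z, D z ^ 2) * weightedSq ε y g) ^ (1 / 2 : ℝ) +
      ‖ζ‖ₑ * ((∫⁻ z, D z ^ 2) * weightedSq ε y u) ^ (1 / 2 : ℝ)) := by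
  have hD := hk.measurable_dom
  have hum := measurable_expWeight_mul_enorm ε y u
  refine hk.ae_le_of_le_add hV hum ?_ ?_
  · refine ne_top_of_le_ne_top (lintegral_enorm_mul_ne_top hv) (lintegral_mono fun x => ?_)
    gcongr
    exact mul_le_of_le_one_left' (expWeight_le_one hε y x)
  have hsum := Lp.coeFn_add (hk.conv g) (hk.conv v)
  rw [← hu] at hsum
  filter_upwards [hsum, hk.weight_mul_enorm_conv_le hε hε1 y g,
    hk.weight_mul_enorm_conv_le hε hε1 y v] with x hx hgx hvx
  have hvle : ((fun z => expWeight ε y z * ‖v z‖ₑ) ⋆ₗ D) x ≤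
      ‖ζ‖ₑ * ((fun z => expWeight ε y z * ‖u z‖ₑ) ⋆ₗ D) x +
        ((fun z => ‖V z‖ₑ * (expWeight ε y z * ‖u z‖ₑ)) ⋆ₗ D) x := by
    simp only [lconvolution_eq_lintegral_sub]
    rw [← lintegral_const_mul _ (by fun_prop), ← lintegral_add_left (by fun_prop)]
    refine lintegral_mono_ae ?_
    filter_upwards [hv] with z hz
    rw [hz, enorm_mul]
    calc _ ≤ D (x - z) * (expWeight ε y z * ((‖ζ‖ₑ + ‖V z‖ₑ) * ‖u z‖ₑ)) := by
          gcongr; exact enorm_sub_ofReal_le ζ _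
      _ = _ := by ring
  calc expWeight ε y x * ‖u x‖ₑ
      ≤ expWeight ε y x * ‖hk.conv g x‖ₑ + expWeight ε y x * ‖hk.conv v x‖ₑ := by
        rw [← mul_add, hx]
        gcongr
        exact enorm_add_le _ _
    _ ≤ ((∫⁻ z, D z ^ 2) * weightedSq ε y g) ^ (1 / 2 : ℝ) +
        (‖ζ‖ₑ * ((∫⁻ z, D z ^ 2) * weightedSq ε y u) ^ (1 / 2 : ℝ) +
          ((fun z => ‖V z‖ₑ * (expWeight ε y z * ‖u z‖ₑ)) ⋆ₗ D) x) := by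
        gcongr
        · exact hgx.trans (hk.lconvolution_le_rpow y g x)
        · exact hvx.trans (hvle.trans (by gcongr; exact hk.lconvolution_le_rpow y u x))
    _ = _ := by rw [add_assoc]

theorem lintegral_lintegral_le (hk : IsGoodKernel V k D) (hV : Measurable V)
    (ζ : ℂ) (ε : ℝ) (y : Plane) (u : L1) :
    ∫⁻ x, ∫⁻ z, D (x - z) * ((‖ζ - V x‖ₑ * (expWeight ε y x * ‖u x‖ₑ)) *
      (‖ζ - V z‖ₑ * (expWeight ε y z * ‖u z‖ₑ))) ≤
      (‖ζ‖ₑ * (∫⁻ z, D z) + 1 / 2) * weightedForm V ζ ε y u := by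
  have hD := hk.measurable_dom
  have hsymm (x z : Plane) : D (x - z) = D (z - x) := by rw [← hk.even_dom, neg_sub]
  refine lintegral_lintegral_mul_le_of_symm (N := fun x z => D (x - z))
    (hD.comp measurable_sub) hsymm (M := fun x => ‖ζ - V x‖ₑ) (by fun_prop)
    (measurable_expWeight_mul_enorm ε y u) fun x => ?_
  calc ∫⁻ z, D (x - z) * ‖ζ - V z‖ₑ ≤ ∫⁻ z, (‖ζ‖ₑ * D (x - z) + ‖V z‖ₑ * D (z - x)) := by
        refine lintegral_mono fun z => ?_
        rw [hsymm z x, ← add_mul, mul_comm]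
        gcongr
        exact enorm_sub_ofReal_le ζ _
    _ = ‖ζ‖ₑ * (∫⁻ z, D z) + ∫⁻ z, ‖V z‖ₑ * D (z - x) := by
        rw [lintegral_add_left (by fun_prop), lintegral_const_mul _ (by fun_prop),
          lintegral_sub_left_eq_self D x]
    _ ≤ _ := by gcongr; exact hk.small x

end IsGoodKernel

end WeightedL2

/-! ### The energy estimate -/

section Energy

theorem exp_sub_exp_neg_le (d : ℝ) : Real.exp d - Real.exp (-d) ≤ 2 * d * Real.exp d := by
  have hexp : Real.exp (-d) = Real.exp d * Real.exp (-(2 * d)) := by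
    rw [← Real.exp_add]
    ring_nf
  rw [hexp]
  nlinarith [Real.exp_pos d, Real.add_one_le_exp (-(2 * d))]

theorem abs_exp_sq_sub_le {ε : ℝ} (hε : 0 ≤ ε) (hε1 : ε ≤ 1) (y x z : Plane) :
    |Real.exp (-ε * ‖x - y‖) ^ 2 - Real.exp (-ε * ‖z - y‖) ^ 2| ≤
      2 * ε * Real.exp (2 * ‖x - z‖) *
        (Real.exp (-ε * ‖x - y‖) * Real.exp (-ε * ‖z - y‖)) := by
  wlog hxz : ‖x - y‖ ≤ ‖z - y‖ generalizing x z
  · have h := this z x (le_of_not_ge hxz)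
    rwa [abs_sub_comm, norm_sub_rev z x, mul_comm (Real.exp (-ε * ‖z - y‖))] at h
  set a := ‖x - y‖
  set b := ‖z - y‖
  set r := ‖x - z‖
  have : 0 ≤ r := norm_nonneg _
  have hba : b ≤ r + a := by
    have h := norm_sub_le_norm_sub_add_norm_sub z x y
    rwa [norm_sub_rev z x] at h
  set d := ε * (b - a) with hd
  have hd0 : 0 ≤ d := mul_nonneg hε (by linarith)
  have hdr : d ≤ ε * r := mul_le_mul_of_nonneg_left (by linarith) hε
  have hfactor : Real.exp (-ε * a) ^ 2 - Real.exp (-ε * b) ^ 2 =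
      (Real.exp d - Real.exp (-d)) * (Real.exp (-ε * a) * Real.exp (-ε * b)) := by
    rw [sub_mul, ← Real.exp_add, ← Real.exp_add, ← Real.exp_add, ← Real.exp_nat_mul,
      ← Real.exp_nat_mul]
    congr 2 <;> push_cast <;> rw [hd] <;> ring
  have hpos : 0 ≤ Real.exp d - Real.exp (-d) := by
    rw [sub_nonneg, Real.exp_le_exp]
    linarith
  rw [hfactor, abs_of_nonneg (by positivity)]
  gcongr
  calc Real.exp d - Real.exp (-d) ≤ 2 * d * Real.exp d := exp_sub_exp_neg_le d
    _ ≤ 2 * (ε * r) * Real.exp r := by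
        gcongr
        nlinarith
    _ ≤ 2 * (ε * Real.exp r) * Real.exp r := by
        gcongr
        linarith [Real.add_one_le_exp r]
    _ = 2 * ε * Real.exp (2 * r) := by
        rw [two_mul r, Real.exp_add]
        ring

theorem enorm_exp_sq_sub_le {ε : ℝ} (hε : 0 ≤ ε) (hε1 : ε ≤ 1) (y x z : Plane) :
    ‖Real.exp (-ε * ‖x - y‖) ^ 2 - Real.exp (-ε * ‖z - y‖) ^ 2‖ₑ ≤
      2 * ENNReal.ofReal ε * ENNReal.ofReal (Real.exp (2 * ‖x - z‖)) *
        (expWeight ε y x * expWeight ε y z) := by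
  rw [Real.enorm_eq_ofReal_abs]
  refine (ENNReal.ofReal_le_ofReal (abs_exp_sq_sub_le hε hε1 y x z)).trans_eq ?_
  rw [expWeight, expWeight, ENNReal.ofReal_mul (by positivity),
    ENNReal.ofReal_mul (by positivity), ENNReal.ofReal_mul (by positivity),
    ENNReal.ofReal_mul (by positivity), ENNReal.ofReal_ofNat]

theorem enorm_sub_conj (z : ℂ) : ‖z - (starRingEnd ℂ) z‖ₑ = 2 * ‖z.im‖ₑ := by
  have hI : ‖Complex.I‖ₑ = 1 := by rw [← ofReal_norm, Complex.norm_I, ENNReal.ofReal_one]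
  have htwo : ‖(2 : ℝ)‖ₑ = 2 := by
    rw [Real.enorm_of_nonneg zero_le_two, ENNReal.ofReal_ofNat]
  rw [Complex.sub_conj, enorm_mul, enorm_complex_ofReal, enorm_mul, hI, htwo, mul_one]

/-- The integrand `w(x)² (conj a) b` of the weighted `L²` pairing, where `w` is the exponential
weight centred at `y`. -/
def weightedMul (ε : ℝ) (y x : Plane) (a b : ℂ) : ℂ :=
  ((Real.exp (-ε * ‖x - y‖) ^ 2 : ℝ) : ℂ) * (starRingEnd ℂ) a * b

theorem enorm_weightedMul (ε : ℝ) (y x : Plane) (a b : ℂ) :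
    ‖weightedMul ε y x a b‖ₑ = expWeight ε y x * ‖a‖ₑ * (expWeight ε y x * ‖b‖ₑ) := by
  rw [weightedMul, enorm_mul, enorm_mul, enorm_complex_ofReal, pow_two, enorm_mul,
    Real.enorm_of_nonneg (Real.exp_pos _).le, RCLike.enorm_conj, expWeight]
  ring

theorem measurable_weightedMul {α : Type*} [MeasurableSpace α] {ε : ℝ} {y : Plane}
    {x : α → Plane} {a b : α → ℂ} (hx : Measurable x) (ha : Measurable a) (hb : Measurable b) :
    Measurable fun p => weightedMul ε y (x p) (a p) (b p) := by
  have hconj : Measurable fun p => (starRingEnd ℂ) (a p) :=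
    Complex.continuous_conj.measurable.comp ha
  unfold weightedMul
  fun_prop

/-- The integrand of the weighted quadratic form `∫ w² (conj v) (k * v)`. -/
def pairIntegrand (k : Plane → ℂ) (ε : ℝ) (y : Plane) (v : L1) (p : Plane × Plane) : ℂ :=
  weightedMul ε y p.1 (v p.1) (k (p.1 - p.2) * v p.2)

/-- The quadratic form of `D` at `w |v|`, which dominates the weighted form of `k` at `v`. -/
def domForm (D : Plane → ℝ≥0∞) (ε : ℝ) (y : Plane) (v : L1) : ℝ≥0∞ :=
  ∫⁻ x, ∫⁻ z, D (x - z) * ((expWeight ε y x * ‖v x‖ₑ) * (expWeight ε y z * ‖v z‖ₑ))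

variable {V : Plane → ℝ} {k : Plane → ℂ} {D : Plane → ℝ≥0∞} {ζ : ℂ} {ε : ℝ} {u g v : L1}

namespace IsGoodKernel

theorem integrable_pairIntegrand (hk : IsGoodKernel V k D) (hε : 0 ≤ ε)
    (hε1 : ε ≤ 1) (y : Plane) (hfin : domForm D ε y v ≠ ∞) :
    Integrable (pairIntegrand k ε y v) (volume.prod volume) := by
  have hkm := hk.measurable
  have hvm := (Lp.stronglyMeasurable v).measurable
  have hmeas : Measurable (pairIntegrand k ε y v) :=
    measurable_weightedMul measurable_fst (hvm.comp measurable_fst) (by fun_prop)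
  refine ⟨hmeas.aestronglyMeasurable, ?_⟩
  rw [hasFiniteIntegral_iff_enorm, lintegral_prod _ hmeas.enorm.aemeasurable]
  refine (lintegral_mono fun x => lintegral_mono fun z => ?_).trans_lt (lt_top_iff_ne_top.2 hfin)
  rw [pairIntegrand, enorm_weightedMul, enorm_mul]
  calc _ ≤ expWeight ε y x * ‖v x‖ₑ * (ENNReal.ofReal (Real.exp (2 * ‖x - z‖)) *
        expWeight ε y z * (‖k (x - z)‖ₑ * ‖v z‖ₑ)) := by
        gcongr
        exact expWeight_le_exp_mul hε hε1 y x z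
    _ = (ENNReal.ofReal (Real.exp (2 * ‖x - z‖)) * ‖k (x - z)‖ₑ) *
        ((expWeight ε y x * ‖v x‖ₑ) * (expWeight ε y z * ‖v z‖ₑ)) := by ring
    _ ≤ _ := by gcongr; exact hk.weight_le _

theorem pairIntegrand_sub_conj_swap (hk : IsGoodKernel V k D) (y : Plane) (p : Plane × Plane) :
    pairIntegrand k ε y v p - (starRingEnd ℂ) (pairIntegrand k ε y v p.swap) =
      ((Real.exp (-ε * ‖p.1 - y‖) ^ 2 - Real.exp (-ε * ‖p.2 - y‖) ^ 2 : ℝ) : ℂ) *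
        (starRingEnd ℂ) (v p.1) * (k (p.1 - p.2) * v p.2) := by
  have hsymm : k (p.2 - p.1) = k (p.1 - p.2) := by rw [← hk.even, neg_sub]
  simp only [pairIntegrand, weightedMul, Prod.fst_swap, Prod.snd_swap, map_mul,
    Complex.conj_ofReal, Complex.conj_conj, hk.real, hsymm]
  push_cast
  ring

theorem enorm_pairIntegrand_sub_conj_swap_le (hk : IsGoodKernel V k D) (hε : 0 ≤ ε)
    (hε1 : ε ≤ 1) (y : Plane) (p : Plane × Plane) :
    ‖pairIntegrand k ε y v p - (starRingEnd ℂ) (pairIntegrand k ε y v p.swap)‖ₑ ≤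
      2 * ENNReal.ofReal ε * (D (p.1 - p.2) *
        ((expWeight ε y p.1 * ‖v p.1‖ₑ) * (expWeight ε y p.2 * ‖v p.2‖ₑ))) := by
  rw [hk.pairIntegrand_sub_conj_swap, enorm_mul, enorm_mul, enorm_mul, enorm_complex_ofReal,
    RCLike.enorm_conj]
  calc _ ≤ 2 * ENNReal.ofReal ε * ENNReal.ofReal (Real.exp (2 * ‖p.1 - p.2‖)) *
        (expWeight ε y p.1 * expWeight ε y p.2) * ‖v p.1‖ₑ * (‖k (p.1 - p.2)‖ₑ * ‖v p.2‖ₑ) := by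
        gcongr
        exact enorm_exp_sq_sub_le hε hε1 y p.1 p.2
    _ = 2 * ENNReal.ofReal ε * ((ENNReal.ofReal (Real.exp (2 * ‖p.1 - p.2‖)) *
        ‖k (p.1 - p.2)‖ₑ) * ((expWeight ε y p.1 * ‖v p.1‖ₑ) *
          (expWeight ε y p.2 * ‖v p.2‖ₑ))) := by ring
    _ ≤ _ := by gcongr; exact hk.weight_le _

/-- Without the weight the form would be real, because `k` is real and even; the imaginary part is
a commutator with `w²` and therefore of size `ε`. -/
theorem enorm_im_integral_pairIntegrand_le (hk : IsGoodKernel V k D) (hε : 0 ≤ ε)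
    (hε1 : ε ≤ 1) (y : Plane) (hfin : domForm D ε y v ≠ ∞) :
    ‖(∫ p, pairIntegrand k ε y v p ∂(volume.prod volume)).im‖ₑ ≤
      ENNReal.ofReal ε * domForm D ε y v := by
  have hDm := hk.measurable_dom
  have hwm := measurable_expWeight_mul_enorm ε y v
  have hintg := hk.integrable_pairIntegrand hε hε1 y hfin
  set J := ∫ p, pairIntegrand k ε y v p ∂(volume.prod volume) with hJ
  have hconj : (starRingEnd ℂ) J =
      ∫ p, (starRingEnd ℂ) (pairIntegrand k ε y v p.swap) ∂(volume.prod volume) := by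
    rw [hJ, ← integral_conj, ← integral_prod_swap]
  have hintg' : Integrable (fun p => (starRingEnd ℂ) (pairIntegrand k ε y v p.swap))
      (volume.prod volume) :=
    RCLike.conjCLE.toContinuousLinearMap.integrable_comp hintg.swap
  have hm : Measurable fun p : Plane × Plane => D (p.1 - p.2) *
      ((expWeight ε y p.1 * ‖v p.1‖ₑ) * (expWeight ε y p.2 * ‖v p.2‖ₑ)) :=
    (hDm.comp (measurable_fst.sub measurable_snd)).mul
      ((hwm.comp measurable_fst).mul (hwm.comp measurable_snd))
  have hle : ‖J - (starRingEnd ℂ) J‖ₑ ≤ 2 * (ENNReal.ofReal ε * domForm D ε y v) := by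
    rw [hconj, hJ, ← integral_sub hintg hintg', domForm, ← lintegral_prod _ hm.aemeasurable,
      ← mul_assoc, ← lintegral_const_mul _ hm]
    exact (enorm_integral_le_lintegral_enorm _).trans
      (lintegral_mono fun p => hk.enorm_pairIntegrand_sub_conj_swap_le hε hε1 y p)
  rw [enorm_sub_conj] at hle
  exact (ENNReal.mul_le_mul_iff_right two_ne_zero ENNReal.ofNat_ne_top).1 hle

end IsGoodKernel

theorem ae_expWeight_mul_enorm_eq (hv : ∀ᵐ x, v x = (ζ - V x) * u x) (ε : ℝ) (y : Plane) :
    ∀ᵐ x, expWeight ε y x * ‖v x‖ₑ = ‖ζ - V x‖ₑ * (expWeight ε y x * ‖u x‖ₑ) := by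
  filter_upwards [hv] with x hx
  rw [hx, enorm_mul]
  ring

theorem IsGoodKernel.domForm_le (hk : IsGoodKernel V k D) (hV : Measurable V)
    (hv : ∀ᵐ x, v x = (ζ - V x) * u x) (ε : ℝ) (y : Plane) :
    domForm D ε y v ≤ (‖ζ‖ₑ * (∫⁻ z, D z) + 1 / 2) * weightedForm V ζ ε y u := by
  refine le_trans (le_of_eq (lintegral_congr_ae ?_)) (hk.lintegral_lintegral_le hV ζ ε y u)
  have hvu := ae_expWeight_mul_enorm_eq hv ε y
  filter_upwards [hvu] with x hx
  refine lintegral_congr_ae ?_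
  filter_upwards [hvu] with z hz
  rw [hx, hz]

theorem lintegral_enorm_weightedMul (hv : ∀ᵐ x, v x = (ζ - V x) * u x) (ε : ℝ) (y : Plane)
    (f : L1) : ∫⁻ x, ‖weightedMul ε y x (v x) (f x)‖ₑ =
      ∫⁻ x, ‖ζ - V x‖ₑ * ((expWeight ε y x * ‖u x‖ₑ) * (expWeight ε y x * ‖f x‖ₑ)) := by
  refine lintegral_congr_ae ?_
  filter_upwards [ae_expWeight_mul_enorm_eq hv ε y] with x hx
  rw [enorm_weightedMul, hx, mul_assoc]

theorem integrable_weightedMul (hV : Measurable V) (hv : ∀ᵐ x, v x = (ζ - V x) * u x) (y : Plane)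
    (hu : weightedForm V ζ ε y u ≠ ∞) {f : L1} (hf : weightedForm V ζ ε y f ≠ ∞) :
    Integrable fun x => weightedMul ε y x (v x) (f x) := by
  have hwu := measurable_expWeight_mul_enorm ε y u
  refine ⟨(measurable_weightedMul measurable_id (Lp.stronglyMeasurable v).measurable
    (Lp.stronglyMeasurable f).measurable).aestronglyMeasurable, ?_⟩
  rw [hasFiniteIntegral_iff_enorm, lintegral_enorm_weightedMul hv]
  refine lt_of_le_of_lt ?_ (lt_top_iff_ne_top.2 (ENNReal.add_ne_top.2 ⟨hu, hf⟩))
  unfold weightedForm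
  rw [← lintegral_add_left (by fun_prop)]
  refine lintegral_mono fun x => ?_
  rw [← mul_add]
  gcongr
  simpa using ennreal_mul_le_mul_sq_add one_ne_zero ENNReal.one_ne_top (expWeight ε y x * ‖u x‖ₑ)
    (expWeight ε y x * ‖f x‖ₑ)

theorem im_weightedMul (ε : ℝ) (y x : Plane) (ζ b : ℂ) (r : ℝ) :
    (weightedMul ε y x ((ζ - r) * b) b).im =
      -ζ.im * (Real.exp (-ε * ‖x - y‖) * ‖b‖) ^ 2 := by
  have hb : (starRingEnd ℂ) b * b = ((‖b‖ ^ 2 : ℝ) : ℂ) := by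
    rw [mul_comm, Complex.mul_conj, Complex.normSq_eq_norm_sq]
  have h : weightedMul ε y x ((ζ - r) * b) b =
      (((Real.exp (-ε * ‖x - y‖) * ‖b‖) ^ 2 : ℝ) : ℂ) * ((starRingEnd ℂ) ζ - r) := by
    rw [weightedMul, map_mul, map_sub, Complex.conj_ofReal, mul_pow, Complex.ofReal_mul, ← hb]
    ring
  rw [h, Complex.im_ofReal_mul, Complex.sub_im, Complex.conj_im, Complex.ofReal_im]
  ring

theorem ofReal_abs_im_mul_weightedSq (hv : ∀ᵐ x, v x = (ζ - V x) * u x) (y : Plane)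
    (hu : weightedSq ε y u ≠ ∞) (hintg : Integrable fun x => weightedMul ε y x (v x) (u x)) :
    ENNReal.ofReal |ζ.im| * weightedSq ε y u =
      ‖(∫ x, weightedMul ε y x (v x) (u x)).im‖ₑ := by
  set U : Plane → ℝ := fun x => (Real.exp (-ε * ‖x - y‖) * ‖u x‖) ^ 2 with hU
  have hUe (x : Plane) : ENNReal.ofReal (U x) = (expWeight ε y x * ‖u x‖ₑ) ^ 2 := by
    rw [hU, ENNReal.ofReal_pow (by positivity), ENNReal.ofReal_mul (Real.exp_pos _).le,
      ofReal_norm, expWeight]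
  have hU0 : ∀ x, 0 ≤ U x := fun x => sq_nonneg _
  have hUint : Integrable U := by
    have := (Lp.stronglyMeasurable u).measurable
    refine ⟨Measurable.aestronglyMeasurable (by fun_prop), ?_⟩
    rw [hasFiniteIntegral_iff_ofReal (.of_forall hU0)]
    exact (lintegral_congr hUe).trans_lt (lt_top_iff_ne_top.2 hu)
  have hUeq : ENNReal.ofReal (∫ x, U x) = weightedSq ε y u :=
    (ofReal_integral_eq_lintegral_ofReal hUint (.of_forall hU0)).trans (lintegral_congr hUe)
  have him : (∫ x, weightedMul ε y x (v x) (u x)).im = -ζ.im * ∫ x, U x := by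
    have h := integral_im hintg
    simp only [RCLike.im_to_complex] at h
    rw [← h, ← integral_const_mul]
    refine integral_congr_ae ?_
    filter_upwards [hv] with x hx
    rw [hx, im_weightedMul]
  rw [him, ← hUeq, enorm_mul, enorm_neg, Real.enorm_eq_ofReal_abs ζ.im,
    Real.enorm_of_nonneg (integral_nonneg hU0)]

namespace IsGoodKernel

theorem integral_weightedMul_conv (hk : IsGoodKernel V k D) (hε : 0 ≤ ε) (hε1 : ε ≤ 1)
    (y : Plane) (hfin : domForm D ε y v ≠ ∞) :
    ∫ x, weightedMul ε y x (v x) (hk.conv v x) =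
      ∫ p, pairIntegrand k ε y v p ∂(volume.prod volume) := by
  rw [integral_prod _ (hk.integrable_pairIntegrand hε hε1 y hfin)]
  refine integral_congr_ae ?_
  filter_upwards [convL1_ae hk.integrable hk.measurable v] with x hx
  simp only [pairIntegrand, weightedMul]
  rw [hx, ← integral_const_mul]

/-- Taking imaginary parts in `∫ w² (conj v) u = ∫ w² (conj v) (k * g) + ∫ w² (conj v) (k * v)`. -/
theorem ofReal_abs_im_mul_weightedSq_le (hk : IsGoodKernel V k D) (hV : Measurable V)
    (hε : 0 ≤ ε) (hε1 : ε ≤ 1) (y : Plane) (hv : ∀ᵐ x, v x = (ζ - V x) * u x)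
    (hu : u = hk.conv g + hk.conv v) (hSq : weightedSq ε y u ≠ ∞)
    (hForm : weightedForm V ζ ε y u ≠ ∞) (hFormg : weightedForm V ζ ε y (hk.conv g) ≠ ∞) :
    ENNReal.ofReal |ζ.im| * weightedSq ε y u ≤
      (∫⁻ x, ‖ζ - V x‖ₑ * ((expWeight ε y x * ‖u x‖ₑ) * (expWeight ε y x * ‖hk.conv g x‖ₑ))) +
      ENNReal.ofReal ε * ((‖ζ‖ₑ * (∫⁻ z, D z) + 1 / 2) * weightedForm V ζ ε y u) := by
  have hdom := hk.domForm_le hV hv ε y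
  have hfin : domForm D ε y v ≠ ∞ :=
    ne_top_of_le_ne_top (ENNReal.mul_ne_top (ENNReal.add_ne_top.2
      ⟨ENNReal.mul_ne_top enorm_ne_top hk.lintegral_ne_top, by simp⟩) hForm) hdom
  have hintu := integrable_weightedMul hV hv y hForm hForm
  have hintg := integrable_weightedMul hV hv y hForm hFormg
  have hsum : ∀ᵐ x, u x = hk.conv g x + hk.conv v x := by
    have h := Lp.coeFn_add (hk.conv g) (hk.conv v)
    rwa [← hu] at h
  have hsplit : ∫ x, weightedMul ε y x (v x) (u x) =
      (∫ x, weightedMul ε y x (v x) (hk.conv g x)) +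
        ∫ p, pairIntegrand k ε y v p ∂(volume.prod volume) := by
    rw [← hk.integral_weightedMul_conv hε hε1 y hfin, ← sub_eq_iff_eq_add',
      ← integral_sub hintu hintg]
    refine integral_congr_ae ?_
    filter_upwards [hsum] with x hx
    rw [hx, weightedMul, weightedMul, weightedMul]
    ring
  rw [ofReal_abs_im_mul_weightedSq hv y hSq hintu, hsplit, Complex.add_im]
  refine (enorm_add_le _ _).trans ?_
  gcongr ?_ + ?_
  · rw [← lintegral_enorm_weightedMul hv]
    refine le_trans ?_ (enorm_integral_le_lintegral_enorm _)
    rw [← ofReal_norm, ← ofReal_norm]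
    exact ENNReal.ofReal_le_ofReal (Complex.abs_im_le_norm _)
  · exact (hk.enorm_im_integral_pairIntegrand_le hε hε1 y hfin).trans (by gcongr)

end IsGoodKernel

end Energy

/-! ### The a priori estimate off the real axis -/

section WeightedResolvent

/-- `V` is the sum of a function bounded by `L` and a function dominated by the integrable `S`. -/
structure IsBoundedAddIntegrable (V : Plane → ℝ) (L : ℝ≥0∞) (S : Plane → ℝ≥0∞) : Prop where
  bound_ne_top : L ≠ ∞
  measurable : Measurable S
  le_add : ∀ x, ‖V x‖ₑ ≤ L + S x
  lintegral_ne_top : ∫⁻ x, S x ≠ ∞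

theorem exists_isBoundedAddIntegrable {q : ℝ≥0∞} (hq : 1 ≤ q) {V : Plane → ℝ} (hV : Measurable V)
    (hVq : MemLp V q) : ∃ L S, IsBoundedAddIntegrable V L S := by
  rcases eq_or_ne q ∞ with rfl | hq'
  · refine ⟨eLpNorm V ∞ volume, fun x => ‖V x‖ₑ - eLpNorm V ∞ volume, hVq.2.ne,
      hV.enorm.sub_const _, fun x => le_add_tsub, ?_⟩
    have hzero : ∫⁻ x, (‖V x‖ₑ - eLpNorm V ∞ volume) = 0 := by
      rw [lintegral_eq_zero_iff (hV.enorm.sub_const _)]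
      filter_upwards [ae_le_eLpNormEssSup (f := V) (μ := volume)] with x hx
      rw [eLpNorm_exponent_top]
      exact tsub_eq_zero_of_le hx
    rw [hzero]
    exact ENNReal.zero_ne_top
  · refine ⟨1, fun x => ‖V x‖ₑ - 1, ENNReal.one_ne_top, hV.enorm.sub_const _,
      fun x => le_add_tsub, ?_⟩
    have hfin := lintegral_rpow_enorm_lt_top_of_eLpNorm_lt_top (zero_lt_one.trans_le hq).ne' hq'
      hVq.2
    refine ne_top_of_le_ne_top hfin.ne (lintegral_mono fun x => ?_)
    rcases le_total ‖V x‖ₑ 1 with h | h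
    · rw [tsub_eq_zero_of_le h]
      exact zero_le
    · have hq1 : 1 ≤ q.toReal := by
        rw [← ENNReal.toReal_one]
        exact ENNReal.toReal_mono hq' hq
      calc ‖V x‖ₑ - 1 ≤ ‖V x‖ₑ ^ (1 : ℝ) := by
            rw [ENNReal.rpow_one]
            exact tsub_le_self
        _ ≤ _ := ENNReal.rpow_le_rpow_of_exponent_le h hq1

theorem exists_ofReal_mul_le_half {K : ℝ≥0∞} (hK : K ≠ ∞) :
    ∃ ε : ℝ, 0 < ε ∧ ε ≤ 1 ∧ ENNReal.ofReal ε * K ≤ 1 / 2 := by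
  have hK0 : 0 ≤ K.toReal := ENNReal.toReal_nonneg
  refine ⟨1 / (2 * (K.toReal + 1)), by positivity, ?_, ?_⟩
  · rw [div_le_one (by positivity)]
    linarith
  · have hhalf : (1 / 2 : ℝ≥0∞) = ENNReal.ofReal (1 / 2) := by
      rw [ENNReal.ofReal_div_of_pos two_pos, ENNReal.ofReal_one, ENNReal.ofReal_ofNat]
    rw [← ENNReal.ofReal_toReal hK, ← ENNReal.ofReal_mul (by positivity), hhalf]
    refine ENNReal.ofReal_le_ofReal ?_
    rw [div_mul_eq_mul_div, one_mul, ENNReal.toReal_ofReal hK0,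
      div_le_div_iff₀ (by positivity) two_pos]
    linarith

theorem lintegral_mul_mul_le_weightedForm {V : Plane → ℝ} (hV : Measurable V) (ζ : ℂ) (ε : ℝ)
    (y : Plane) (u f : L1) {e : ℝ≥0∞} (he0 : e ≠ 0) (he : e ≠ ∞) :
    ∫⁻ x, ‖ζ - V x‖ₑ * ((expWeight ε y x * ‖u x‖ₑ) * (expWeight ε y x * ‖f x‖ₑ)) ≤
      e * weightedForm V ζ ε y u + e⁻¹ * weightedForm V ζ ε y f := by
  have hu := measurable_expWeight_mul_enorm ε y u
  have hf := measurable_expWeight_mul_enorm ε y f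
  unfold weightedForm
  rw [← lintegral_const_mul _ (by fun_prop), ← lintegral_const_mul _ (by fun_prop),
    ← lintegral_add_left (by fun_prop)]
  refine lintegral_mono fun x => ?_
  calc _ ≤ ‖ζ - V x‖ₑ * (e * (expWeight ε y x * ‖u x‖ₑ) ^ 2 +
        e⁻¹ * (expWeight ε y x * ‖f x‖ₑ) ^ 2) := by
        gcongr
        exact ennreal_mul_le_mul_sq_add he0 he _ _
    _ = _ := by ring

variable {V : Plane → ℝ} {k : Plane → ℂ} {D S : Plane → ℝ≥0∞} {L Z : ℝ≥0∞}

namespace IsGoodKernel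

theorem weightedForm_le (hk : IsGoodKernel V k D) (hV : Measurable V)
    (hS : IsBoundedAddIntegrable V L S) {ε : ℝ} (hε : 0 ≤ ε) (hε1 : ε ≤ 1) (y : Plane) {ζ : ℂ}
    (hζ : ‖ζ‖ₑ ≤ Z) {u g v : L1} (hv : ∀ᵐ x, v x = (ζ - V x) * u x)
    (hu : u = hk.conv g + hk.conv v) :
    weightedForm V ζ ε y u ≤
      ((Z + L) + 8 * (∫⁻ x, S x) * (∫⁻ z, D z ^ 2) * Z ^ 2) * weightedSq ε y u +
        8 * (∫⁻ x, S x) * (∫⁻ z, D z ^ 2) * weightedSq ε y g := by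
  refine (SchrodingerL1.weightedForm_le hS.measurable hS.le_add ζ ε y u
    (hk.weight_mul_enorm_le hV hε hε1 y hv hu)).trans ?_
  set X := weightedSq ε y u
  set G := weightedSq ε y g
  set D2 := ∫⁻ z, D z ^ 2
  have hsup : (2 * ((D2 * G) ^ (1 / 2 : ℝ) + ‖ζ‖ₑ * (D2 * X) ^ (1 / 2 : ℝ))) ^ 2 ≤
      8 * (D2 * G + Z ^ 2 * (D2 * X)) := by
    calc _ = 4 * ((D2 * G) ^ (1 / 2 : ℝ) + ‖ζ‖ₑ * (D2 * X) ^ (1 / 2 : ℝ)) ^ 2 := by ring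
      _ ≤ 4 * (2 * (((D2 * G) ^ (1 / 2 : ℝ)) ^ 2 + (‖ζ‖ₑ * (D2 * X) ^ (1 / 2 : ℝ)) ^ 2)) := by
          gcongr
          exact ennreal_add_sq_le _ _
      _ = 8 * (D2 * G + ‖ζ‖ₑ ^ 2 * (D2 * X)) := by
          rw [mul_pow, rpow_half_sq, rpow_half_sq]
          ring
      _ ≤ _ := by gcongr
  calc _ ≤ (Z + L) * X + (∫⁻ x, S x) * (8 * (D2 * G + Z ^ 2 * (D2 * X))) := by gcongr
    _ = _ := by ring

theorem weightedForm_conv_le (hk : IsGoodKernel V k D) (hS : IsBoundedAddIntegrable V L S)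
    {ε : ℝ} (hε : 0 ≤ ε) (hε1 : ε ≤ 1) (y : Plane) {ζ : ℂ} (hζ : ‖ζ‖ₑ ≤ Z) (g : L1) :
    weightedForm V ζ ε y (hk.conv g) ≤
      ((Z + L) * (∫⁻ z, D z) ^ 2 + (∫⁻ x, S x) * ∫⁻ z, D z ^ 2) * weightedSq ε y g := by
  have hsup : ∀ᵐ x, expWeight ε y x * ‖hk.conv g x‖ₑ ≤
      ((∫⁻ z, D z ^ 2) * weightedSq ε y g) ^ (1 / 2 : ℝ) := by
    filter_upwards [hk.weight_mul_enorm_conv_le hε hε1 y g] with x hx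
    exact hx.trans (hk.lconvolution_le_rpow y g x)
  refine (SchrodingerL1.weightedForm_le hS.measurable hS.le_add ζ ε y _ hsup).trans ?_
  rw [rpow_half_sq]
  calc _ ≤ (Z + L) * ((∫⁻ z, D z) ^ 2 * weightedSq ε y g) +
        (∫⁻ x, S x) * ((∫⁻ z, D z ^ 2) * weightedSq ε y g) := by
        gcongr
        exact hk.weightedSq_conv_le hε hε1 y g
    _ = _ := by ring

theorem weightedSq_ne_top (hk : IsGoodKernel V k D) {ε : ℝ} (hε : 0 ≤ ε) (hε1 : ε ≤ 1)
    (y : Plane) {u g v : L1} (hu : u = hk.conv g + hk.conv v) : weightedSq ε y u ≠ ∞ := by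
  have hg := hk.weightedSq_conv_ne_top hε hε1 y g
  have hv := hk.weightedSq_conv_ne_top hε hε1 y v
  refine ne_top_of_le_ne_top ?_ (hu ▸ weightedSq_add_le ε y (hk.conv g) (hk.conv v))
  finiteness

theorem weightedSq_le_weightedForm_add (hk : IsGoodKernel V k D) (hV : Measurable V) {ζ : ℂ}
    {ε : ℝ} (hε : 0 < ε) (hε1 : ε ≤ 1) (y : Plane) {u g v : L1} (hζ : ‖ζ‖ₑ ≤ Z) (him : 1 ≤ |ζ.im|)
    (hv : ∀ᵐ x, v x = (ζ - V x) * u x) (hu : u = hk.conv g + hk.conv v)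
    (hSq : weightedSq ε y u ≠ ∞) (hForm : weightedForm V ζ ε y u ≠ ∞)
    (hFormg : weightedForm V ζ ε y (hk.conv g) ≠ ∞) :
    weightedSq ε y u ≤
      (ENNReal.ofReal ε * weightedForm V ζ ε y u +
        (ENNReal.ofReal ε)⁻¹ * weightedForm V ζ ε y (hk.conv g)) +
      ENNReal.ofReal ε * ((Z * (∫⁻ x, D x) + 1 / 2) * weightedForm V ζ ε y u) :=
  calc weightedSq ε y u ≤ ENNReal.ofReal |ζ.im| * weightedSq ε y u :=
        le_mul_of_one_le_left' (ENNReal.one_le_ofReal.2 him)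
    _ ≤ _ := hk.ofReal_abs_im_mul_weightedSq_le hV hε.le hε1 y hv hu hSq hForm hFormg
    _ ≤ _ := by
        gcongr
        exact lintegral_mul_mul_le_weightedForm hV ζ ε y u _ (ENNReal.ofReal_pos.2 hε).ne'
          ENNReal.ofReal_ne_top

/-- The energy estimate with the terms in `u` on its right absorbed, for small `ε`. -/
theorem exists_weightedSq_le (hk : IsGoodKernel V k D) (hV : Measurable V)
    (hS : IsBoundedAddIntegrable V L S) (hZ : Z ≠ ∞) :
    ∃ ε : ℝ, 0 < ε ∧ ε ≤ 1 ∧ ∃ B : ℝ≥0∞, B ≠ ∞ ∧ ∀ (ζ : ℂ) (u g v : L1), ‖ζ‖ₑ ≤ Z →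
      1 ≤ |ζ.im| → (∀ᵐ x, v x = (ζ - V x) * u x) → u = hk.conv g + hk.conv v →
      ∀ y, weightedSq ε y g ≠ ∞ → weightedSq ε y u ≤ B * weightedSq ε y g := by
  have hL := hS.bound_ne_top
  have hSfin := hS.lintegral_ne_top
  have hD1 := hk.lintegral_ne_top
  have hD2 := hk.lintegral_sq_ne_top
  have h8 : (8 : ℝ≥0∞) ≠ ∞ := ENNReal.ofNat_ne_top
  have hhalf : (1 / 2 : ℝ≥0∞) ≠ ∞ := by simp
  set B₁ := (Z + L) + 8 * (∫⁻ x, S x) * (∫⁻ z, D z ^ 2) * Z ^ 2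
  set B₂ := 8 * (∫⁻ x, S x) * (∫⁻ z, D z ^ 2)
  set B₃ := (Z + L) * (∫⁻ z, D z) ^ 2 + (∫⁻ x, S x) * ∫⁻ z, D z ^ 2
  set C := Z * (∫⁻ z, D z) + 1 / 2
  have hB₁fin : B₁ ≠ ∞ := by finiteness
  have hB₂fin : B₂ ≠ ∞ := by finiteness
  have hB₃fin : B₃ ≠ ∞ := by finiteness
  have hCfin : C ≠ ∞ := by finiteness
  obtain ⟨ε, hε0, hε1, hεK⟩ := exists_ofReal_mul_le_half (K := (1 + C) * B₁) (by finiteness)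
  set e := ENNReal.ofReal ε
  have he0 : e ≠ 0 := (ENNReal.ofReal_pos.2 hε0).ne'
  have heinv : e⁻¹ ≠ ∞ := ENNReal.inv_ne_top.2 he0
  refine ⟨ε, hε0, hε1, 2 * (e * (1 + C) * B₂ + e⁻¹ * B₃), by finiteness, ?_⟩
  intro ζ u g v hζ him hv hu y hG
  have hX := hk.weightedSq_ne_top hε0.le hε1 y hu
  have hQ : weightedForm V ζ ε y u ≤ B₁ * weightedSq ε y u + B₂ * weightedSq ε y g :=
    hk.weightedForm_le hV hS hε0.le hε1 y hζ hv hu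
  have hQg : weightedForm V ζ ε y (hk.conv g) ≤ B₃ * weightedSq ε y g :=
    hk.weightedForm_conv_le hS hε0.le hε1 y hζ g
  set X := weightedSq ε y u
  set G := weightedSq ε y g
  rw [mul_assoc]
  refine ennreal_le_two_mul_of_le_half_mul_add hX ?_
  calc X ≤ (e * weightedForm V ζ ε y u + e⁻¹ * weightedForm V ζ ε y (hk.conv g)) +
        e * (C * weightedForm V ζ ε y u) :=
        hk.weightedSq_le_weightedForm_add hV hε0 hε1 y hζ him hv hu hX
          (ne_top_of_le_ne_top (by finiteness) hQ) (ne_top_of_le_ne_top (by finiteness) hQg)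
    _ ≤ (e * (B₁ * X + B₂ * G) + e⁻¹ * (B₃ * G)) + e * (C * (B₁ * X + B₂ * G)) := by gcongr
    _ = e * ((1 + C) * B₁) * X + (e * (1 + C) * B₂ + e⁻¹ * B₃) * G := by ring
    _ ≤ _ := by gcongr

end IsGoodKernel

theorem expWeight_eq_sub (ε : ℝ) (y x : Plane) : expWeight ε y x = expWeight ε 0 (y - x) := by
  rw [expWeight, expWeight, sub_zero, norm_sub_rev]

theorem expWeight_two_mul (ε : ℝ) (y x : Plane) :
    expWeight (2 * ε) y x = expWeight ε y x ^ 2 := by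
  rw [expWeight, expWeight, ← ENNReal.ofReal_pow (Real.exp_pos _).le, ← Real.exp_nat_mul]
  push_cast
  ring_nf

theorem lintegral_expWeight_ne_top {ε : ℝ} (hε : 0 < ε) : ∫⁻ x, expWeight ε 0 x ≠ ∞ := by
  have hfin : ∫⁻ x : Plane, ENNReal.ofReal ((1 + ‖x‖) ^ (-3 : ℝ)) < ∞ :=
    finite_integral_one_add_norm (by simp; norm_num)
  have hle (x : Plane) : expWeight ε 0 x ≤
      ENNReal.ofReal ((1 + 3 / ε) ^ 3) * ENNReal.ofReal ((1 + ‖x‖) ^ (-3 : ℝ)) := by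
    rw [expWeight, sub_zero, ← ENNReal.ofReal_mul (by positivity)]
    refine ENNReal.ofReal_le_ofReal ?_
    rw [Real.rpow_neg (by positivity), ← div_eq_mul_inv, le_div_iff₀ (by positivity), neg_mul,
      Real.exp_neg, inv_mul_le_iff₀ (Real.exp_pos _)]
    have hlin : 1 + ‖x‖ ≤ Real.exp (ε * ‖x‖ / 3) * (1 + 3 / ε) := by
      have hexp := Real.add_one_le_exp (ε * ‖x‖ / 3)
      have hnonneg : 0 ≤ 3 / ε + ε * ‖x‖ / 3 := by positivity
      calc 1 + ‖x‖ ≤ 1 + ‖x‖ + (3 / ε + ε * ‖x‖ / 3) := le_add_of_nonneg_right hnonneg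
        _ = (ε * ‖x‖ / 3 + 1) * (1 + 3 / ε) := by
          field_simp
          ring
        _ ≤ _ := by gcongr
    have hpow : (1 + ‖x‖) ^ (3 : ℝ) = (1 + ‖x‖) ^ 3 := by norm_cast
    calc (1 + ‖x‖) ^ (3 : ℝ) ≤ (Real.exp (ε * ‖x‖ / 3) * (1 + 3 / ε)) ^ 3 := by
          rw [hpow]
          gcongr
      _ = _ := by
        rw [mul_pow, ← Real.exp_nat_mul]
        congr 2
        push_cast
        ring
  refine ne_top_of_le_ne_top ?_ (lintegral_mono hle)
  rw [lintegral_const_mul' _ _ ENNReal.ofReal_ne_top]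
  exact ENNReal.mul_ne_top ENNReal.ofReal_ne_top hfin.ne

theorem lintegral_expWeight_ne_zero (ε : ℝ) : ∫⁻ x, expWeight ε 0 x ≠ 0 := by
  rw [Ne, lintegral_eq_zero_iff (measurable_expWeight ε 0)]
  intro h
  obtain ⟨x, hx⟩ := h.exists
  exact (ENNReal.ofReal_pos.2 (Real.exp_pos _)).ne' hx

theorem lintegral_expWeight_mul_enorm_le (ε : ℝ) (y : Plane) (f : L1) :
    ∫⁻ x, expWeight (2 * ε) y x * ‖f x‖ₑ ≤
      (∫⁻ x, expWeight (2 * ε) 0 x) ^ (1 / 2 : ℝ) * weightedSq ε y f ^ (1 / 2 : ℝ) := by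
  rw [← ENNReal.mul_rpow_of_nonneg _ _ (by norm_num)]
  refine le_rpow_half_of_sq_le ?_
  calc _ = (∫⁻ x, expWeight ε y x * (expWeight ε y x * ‖f x‖ₑ)) ^ 2 := by
        simp only [expWeight_two_mul, pow_two, mul_assoc]
    _ ≤ (∫⁻ x, expWeight ε y x ^ 2) * ∫⁻ x, (expWeight ε y x * ‖f x‖ₑ) ^ 2 :=
        sq_lintegral_mul_le (measurable_expWeight ε y).aemeasurable
          (measurable_expWeight_mul_enorm ε y f).aemeasurable
    _ = _ := by
        simp only [← expWeight_two_mul, expWeight_eq_sub (2 * ε) y, weightedSq]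
        rw [lintegral_sub_left_eq_self (expWeight (2 * ε) 0) y]

theorem mul_enorm_le_lintegral_weightedSq {ε : ℝ} (hε : 0 < ε) (f : L1) :
    (∫⁻ x, expWeight (2 * ε) 0 x) * ‖f‖ₑ ≤
      (∫⁻ x, expWeight (2 * ε) 0 x) ^ (1 / 2 : ℝ) * ∫⁻ y, weightedSq ε y f ^ (1 / 2 : ℝ) := by
  have hf := (Lp.stronglyMeasurable f).measurable
  have hw := measurable_expWeight (2 * ε) 0
  calc (∫⁻ x, expWeight (2 * ε) 0 x) * ‖f‖ₑ
      = ∫⁻ x, ∫⁻ y, expWeight (2 * ε) 0 (y - x) * ‖f x‖ₑ := by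
        rw [enorm_L1_eq, ← lintegral_const_mul _ hf.enorm]
        refine lintegral_congr fun x => ?_
        rw [lintegral_mul_const _ (by fun_prop),
          lintegral_sub_right_eq_self (expWeight (2 * ε) 0) x]
    _ = ∫⁻ y, ∫⁻ x, expWeight (2 * ε) 0 (y - x) * ‖f x‖ₑ :=
        lintegral_lintegral_swap (Measurable.aemeasurable (by
          simp only [Function.uncurry_def]; fun_prop))
    _ ≤ ∫⁻ y, (∫⁻ x, expWeight (2 * ε) 0 x) ^ (1 / 2 : ℝ) * weightedSq ε y f ^ (1 / 2 : ℝ) := by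
        refine lintegral_mono fun y => ?_
        simp only [← expWeight_eq_sub (2 * ε) y]
        exact lintegral_expWeight_mul_enorm_le ε y f
    _ = _ := lintegral_const_mul' _ _ (ENNReal.rpow_ne_top_of_nonneg (by norm_num)
        (lintegral_expWeight_ne_top (by positivity)))

namespace IsGoodKernel

theorem lintegral_weightedSq_conv_le (hk : IsGoodKernel V k D) {ε : ℝ} (hε : 0 ≤ ε)
    (hε1 : ε ≤ 1) (f : L1) :
    ∫⁻ y, weightedSq ε y (hk.conv f) ^ (1 / 2 : ℝ) ≤
      (∫⁻ z, D z ^ 2) ^ (1 / 2 : ℝ) * ((∫⁻ x, expWeight ε 0 x) * ‖f‖ₑ) := by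
  have hf := (Lp.stronglyMeasurable f).measurable.enorm
  have hw := measurable_expWeight ε 0
  calc _ ≤ ∫⁻ y, (∫⁻ z, D z ^ 2) ^ (1 / 2 : ℝ) *
        ((fun z => ‖f z‖ₑ) ⋆ₗ expWeight ε 0) y := by
        refine lintegral_mono fun y => ?_
        refine (ENNReal.rpow_le_rpow (hk.weightedSq_conv_le_sq_lintegral hε hε1 y f)
          (by norm_num)).trans_eq ?_
        rw [ENNReal.mul_rpow_of_nonneg _ _ (by norm_num), ← ENNReal.rpow_two, ← ENNReal.rpow_mul,
          mul_one_div_cancel two_ne_zero, ENNReal.rpow_one, lconvolution_eq_lintegral_sub]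
        simp only [expWeight_eq_sub ε y]
    _ = (∫⁻ z, D z ^ 2) ^ (1 / 2 : ℝ) * ∫⁻ y, ((fun z => ‖f z‖ₑ) ⋆ₗ expWeight ε 0) y :=
        lintegral_const_mul' _ _
          (ENNReal.rpow_ne_top_of_nonneg (by norm_num) hk.lintegral_sq_ne_top)
    _ ≤ _ := by
        gcongr
        rw [enorm_L1_eq]
        exact lintegral_lconvolution_le hf hw

/-- Averaging the weighted `L²` estimate over the centre `y` of the weight. -/
theorem exists_enorm_le (hk : IsGoodKernel V k D) (hV : Measurable V)
    (hS : IsBoundedAddIntegrable V L S) (hZ : Z ≠ ∞) :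
    ∃ B : ℝ≥0∞, B ≠ ∞ ∧ ∀ (ζ : ℂ) (u h v : L1), ‖ζ‖ₑ ≤ Z → 1 ≤ |ζ.im| →
      (∀ᵐ x, v x = (ζ - V x) * u x) → u = hk.conv (hk.conv h) + hk.conv v →
      ‖u‖ₑ ≤ B * ‖h‖ₑ := by
  obtain ⟨ε, hε0, hε1, B, hB, hest⟩ := hk.exists_weightedSq_le hV hS hZ
  have hct : ∫⁻ x, expWeight (2 * ε) 0 x ≠ ∞ := lintegral_expWeight_ne_top (by positivity)
  have hc0 := lintegral_expWeight_ne_zero (2 * ε)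
  have hct' := lintegral_expWeight_ne_top hε0
  have hhalf (a : ℝ≥0∞) (ha : a ≠ ∞) : a ^ (1 / 2 : ℝ) ≠ ∞ :=
    ENNReal.rpow_ne_top_of_nonneg (by norm_num) ha
  have hD := hhalf _ hk.lintegral_sq_ne_top
  have hBhalf := hhalf B hB
  have hchalf := hhalf _ hct
  set c := ∫⁻ x, expWeight (2 * ε) 0 x
  set c' := ∫⁻ x, expWeight ε 0 x
  set d := (∫⁻ z, D z ^ 2) ^ (1 / 2 : ℝ)
  have hcinv : c⁻¹ ≠ ∞ := ENNReal.inv_ne_top.2 hc0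
  refine ⟨c⁻¹ * (c ^ (1 / 2 : ℝ) * (B ^ (1 / 2 : ℝ) * (d * c'))), by finiteness, ?_⟩
  intro ζ u h v hζ him hv hu
  have hmean : ∫⁻ y, weightedSq ε y u ^ (1 / 2 : ℝ) ≤ B ^ (1 / 2 : ℝ) * (d * (c' * ‖h‖ₑ)) := by
    calc ∫⁻ y, weightedSq ε y u ^ (1 / 2 : ℝ)
        ≤ ∫⁻ y, B ^ (1 / 2 : ℝ) * weightedSq ε y (hk.conv h) ^ (1 / 2 : ℝ) := by
          refine lintegral_mono fun y => ?_
          rw [← ENNReal.mul_rpow_of_nonneg _ _ (by norm_num)]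
          exact ENNReal.rpow_le_rpow (hest ζ u _ v hζ him hv hu y
            (hk.weightedSq_conv_ne_top hε0.le hε1 y h)) (by norm_num)
      _ = B ^ (1 / 2 : ℝ) * ∫⁻ y, weightedSq ε y (hk.conv h) ^ (1 / 2 : ℝ) :=
          lintegral_const_mul' _ _ hBhalf
      _ ≤ _ := by
          gcongr
          exact hk.lintegral_weightedSq_conv_le hε0.le hε1 h
  calc ‖u‖ₑ = c⁻¹ * (c * ‖u‖ₑ) := by rw [← mul_assoc, ENNReal.inv_mul_cancel hc0 hct, one_mul]
    _ ≤ c⁻¹ * (c ^ (1 / 2 : ℝ) * ∫⁻ y, weightedSq ε y u ^ (1 / 2 : ℝ)) :=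
        mul_le_mul_right (mul_enorm_le_lintegral_weightedSq hε0 u) _
    _ ≤ c⁻¹ * (c ^ (1 / 2 : ℝ) * (B ^ (1 / 2 : ℝ) * (d * (c' * ‖h‖ₑ)))) := by gcongr
    _ = _ := by ring

end IsGoodKernel

end WeightedResolvent

/-! ### Positivity of `1 + H²` -/

section Positivity

variable {V : Plane → ℝ} {C a : ℝ}

theorem KatoBound.isGoodKernel_resolventKernel (hV : KatoBound V C a) {l : ℝ} (hl : 16 < l)
    (hsmall : C * (1 / (l - 16)) ^ a ≤ 1 / 2) :
    IsGoodKernel V (resolventKernel l 1) (domKernel (l - 16)) where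
  measurable := measurable_resolventKernel _ _
  measurable_dom := measurable_domKernel _
  integrable := integrable_resolventKernel (by simp; linarith) one_half_le_inv_one
  even := resolventKernel_neg _ _
  even_dom := domKernel_neg _
  real := conj_resolventKernel_one l
  weight_le x := by
    have h := weight_mul_enorm_resolventKernel_le (z := l) (ω := 1) (μ := l) 2 (by simp)
      one_half_le_inv_one x
    norm_num at h
    exact h
  lintegral_ne_top := by
    rw [lintegral_domKernel (by linarith)]
    exact ENNReal.ofReal_ne_top
  lintegral_sq_ne_top := (lintegral_domKernel_sq_lt_top (by linarith)).ne
  small y := by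
    refine (hV.lintegral_le _ (by linarith) y).trans
      ((ENNReal.ofReal_le_ofReal hsmall).trans_eq ?_)
    rw [ENNReal.ofReal_div_of_pos two_pos]
    simp

theorem apply_eq_freeResolvent_add {A : L1 →L[ℂ] L1} {z ω c : ℂ} (hμ : 0 < (z * ω).re)
    (hω : 1 / 2 ≤ (ω⁻¹).re) (hA : IsBoundedInverse (shift z (schrodinger V)) A) {u f : L1}
    (huf : (u, f) ∈ (shift c (schrodinger V)).graph) :
    u = A f + (z - c) • A u ∧ ∃ v : L1, (∀ᵐ x, v x = (z - c - V x) * A u x) ∧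
      A u = freeResolvent z ω hμ hω (A f) + freeResolvent z ω hμ hω v := by
  have hu : u = A f + (z - c) • A u := by
    obtain ⟨y, hy, hyf⟩ := mem_shift_graph.1 huf
    have hAu : A (f + (z - c) • u) = u := by
      refine (hA _ _).1 (mem_shift_graph.2 ⟨y, hy, ?_⟩)
      rw [← hyf]
      module
    rw [← map_smul, ← map_add, hAu]
  refine ⟨hu, ?_⟩
  obtain ⟨y, hy, hyu⟩ := mem_shift_graph.1 (hA.mem_graph u)
  obtain ⟨p, w, hp, hw, rfl⟩ := mem_add_graph.1 hy
  have hfree := (isBoundedInverse_freeResolvent hμ hω _ _).1 (mem_shift_graph.2 ⟨p, hp, rfl⟩)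
  have hsum : z • A u + p = A f + ((z - c) • A u - w) :=
    calc z • A u + p = u - w := eq_sub_of_add_eq (by rwa [add_assoc])
      _ = A f + (z - c) • A u - w := congrArg (· - w) hu
      _ = _ := add_sub_assoc _ _ _
  refine ⟨(z - c) • A u - w, ?_, by rw [← map_add, ← hsum, hfree]⟩
  filter_upwards [Lp.coeFn_sub ((z - c) • A u) w, Lp.coeFn_smul (z - c) (A u),
    (mem_mulL1_graph _ _ _).1 hw] with x hsub hsmul hmul
  rw [hsub, Pi.sub_apply, hsmul, hmul, Pi.smul_apply, smul_eq_mul]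
  ring

theorem norm_mul_I_mul {σ : ℝ} (hσ : σ ^ 2 = 1) (s : ℝ) : ‖(σ * Complex.I * s : ℂ)‖ = |s| := by
  rcases sq_eq_one_iff.1 hσ with rfl | rfl <;> simp

theorem abs_im_sub_mul_I_mul {σ : ℝ} (hσ : σ ^ 2 = 1) (l s : ℝ) :
    |(l - σ * Complex.I * s : ℂ).im| = |s| := by
  rcases sq_eq_one_iff.1 hσ with rfl | rfl <;> simp

theorem KatoBound.exists_norm_le_of_mem_graph (hV : KatoBound V C a) {L : ℝ≥0∞}
    {V₁ : Plane → ℝ≥0∞} (hV₁ : IsBoundedAddIntegrable V L V₁) {S : ℝ} (hS : 0 ≤ S) :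
    ∃ B : ℝ, 0 ≤ B ∧ ∀ s : ℝ, 1 ≤ s → s ≤ S → ∀ σ : ℝ, σ ^ 2 = 1 →
      ∀ u f, (u, f) ∈ (shift (σ * Complex.I * s) (schrodinger V)).graph → ‖u‖ ≤ B * ‖f‖ := by
  obtain ⟨μ₀, hμ₀, hsmall⟩ := exists_forall_mul_rpow_le C hV.pos one_half_pos
  set l : ℝ := μ₀ + 16 with hl
  have hl0 : 0 < l := by linarith
  have hre : ((l : ℂ) * 1).re = l := by simp
  have hμ : 0 < ((l : ℂ) * 1).re := by rwa [hre]
  have hk := hV.isGoodKernel_resolventKernel (l := l) (by linarith)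
    (by rw [hl, add_sub_cancel_right]; exact hsmall μ₀ le_rfl)
  obtain ⟨U, hA, hU⟩ := hV.exists_isBoundedInverse hμ one_half_le_inv_one
    (by rw [hre]; exact hsmall l (by linarith))
  set A := freeResolvent l 1 hμ one_half_le_inv_one ∘L (U.symm : L1 →L[ℂ] L1)
  obtain ⟨B, hB, hest⟩ := hk.exists_enorm_le hV.measurable hV₁ (Z := ENNReal.ofReal (l + S))
    ENNReal.ofReal_ne_top
  refine ⟨‖A‖ + (l + S) * (B.toReal * 2), by positivity, fun s hs hsS σ hσ u f huf => ?_⟩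
  have hζ : ‖(l - σ * Complex.I * s : ℂ)‖ ≤ l + S := by
    refine (norm_sub_le _ _).trans ?_
    rw [norm_mul_I_mul hσ, Complex.norm_of_nonneg hl0.le, abs_of_pos (by linarith)]
    gcongr
  obtain ⟨hu, v, hv, hAu⟩ := apply_eq_freeResolvent_add hμ one_half_le_inv_one hA huf
  have hAu_le : ‖A u‖ ≤ B.toReal * (2 * ‖f‖) := by
    have henorm : ‖A u‖ₑ ≤ B * ‖U.symm f‖ₑ := by
      refine hest (l - σ * Complex.I * s) _ _ v ?_ ?_ hv hAu
      · rw [← ofReal_norm]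
        exact ENNReal.ofReal_le_ofReal hζ
      · rw [abs_im_sub_mul_I_mul hσ]
        exact hs.trans (le_abs_self s)
    rw [← ENNReal.ofReal_toReal hB] at henorm
    refine (norm_le_mul_norm_of_enorm_le ENNReal.toReal_nonneg henorm).trans ?_
    gcongr
    exact (U.symm : L1 →L[ℂ] L1).le_of_opNorm_le hU f
  calc ‖u‖ ≤ ‖A f‖ + ‖(l - σ * Complex.I * s : ℂ) • A u‖ := by
        nth_rewrite 1 [hu]
        exact norm_add_le _ _
    _ ≤ ‖A‖ * ‖f‖ + (l + S) * (B.toReal * (2 * ‖f‖)) := by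
        rw [norm_smul]
        gcongr
        exact A.le_opNorm f
    _ = _ := by ring

/-- Continuation downwards in `s`, in steps whose length depends only on the bound `B`. -/
theorem exists_isBoundedInverse_of_norm_le {H : L1 →ₗ.[ℂ] L1} {σ S B : ℝ} (hσ : σ ^ 2 = 1)
    (hB : 0 ≤ B) (hS : ∃ R, IsBoundedInverse (shift (σ * Complex.I * S) H) R)
    (hbound : ∀ s, 1 ≤ s → s ≤ S → ∀ R, IsBoundedInverse (shift (σ * Complex.I * s) H) R →
      ‖R‖ ≤ B) {s : ℝ} (hs : 1 ≤ s) (hsS : s ≤ S) :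
    ∃ R, IsBoundedInverse (shift (σ * Complex.I * s) H) R := by
  set δ : ℝ := 1 / (2 * (B + 1)) with hδ
  have hδ0 : 0 < δ := by positivity
  have hδB : δ * B ≤ 1 / 2 := by
    rw [hδ, div_mul_eq_mul_div, one_mul, div_le_div_iff₀ (by positivity) two_pos]
    linarith
  have hsteps (n : ℕ) : ∀ s, 1 ≤ s → s ≤ S → S - n * δ ≤ s →
      ∃ R, IsBoundedInverse (shift (σ * Complex.I * s) H) R := by
    induction n with
    | zero =>
      intro s _ hsS hs
      rwa [le_antisymm hsS (by simpa using hs)]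
    | succ n ih =>
      intro s hs1 hsS hs
      push_cast at hs
      set s' := min S (s + δ)
      have hss' : s ≤ s' := le_min hsS (by linarith)
      have hs's : s' ≤ s + δ := min_le_right _ _
      have hs' : S - n * δ ≤ s' := le_min (sub_le_self _ (by positivity)) (by linarith)
      obtain ⟨R, hR⟩ := ih s' (hs1.trans hss') (min_le_left _ _) hs'
      refine hR.exists_shift_of_norm_le (d := σ * Complex.I * s) (le_trans ?_ hδB)
      gcongr
      · rw [← mul_sub, ← Complex.ofReal_sub, norm_mul_I_mul hσ, abs_le]
        constructor <;> linarith
      · exact hbound s' (hs1.trans hss') (min_le_left _ _) R hR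
  obtain ⟨n, hn⟩ := exists_nat_ge (S / δ)
  rw [div_le_iff₀ hδ0] at hn
  exact hsteps n s hs hsS (by linarith)

theorem exists_resolvent_imaginary {q : ℝ≥0∞} (hq : 1 < q) (hV : Measurable V)
    (hVq : MemLp V q) : ∃ B : ℝ, 0 ≤ B ∧ ∀ s : ℝ, 1 ≤ s → ∀ σ : ℝ, σ ^ 2 = 1 →
      ∃ R, IsBoundedInverse (shift (σ * Complex.I * s) (schrodinger V)) R ∧ ‖R‖ ≤ B / s := by
  obtain ⟨C, a, hK⟩ := exists_katoBound hq hV hVq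
  obtain ⟨L, V₁, hV₁⟩ := exists_isBoundedAddIntegrable hq.le hV hVq
  obtain ⟨S, hS, hlarge⟩ := hK.exists_resolvent_of_large
  obtain ⟨B, hB, hapriori⟩ := hK.exists_norm_le_of_mem_graph hV₁ (zero_le_one.trans hS)
  refine ⟨32 * Real.pi + B * S, by positivity, fun s hs σ hσ => ?_⟩
  rcases le_total S s with h | h
  · obtain ⟨R, hR, hRn⟩ := hlarge s h σ hσ
    refine ⟨R, hR, hRn.trans ?_⟩
    gcongr
    exact le_add_of_nonneg_right (by positivity)
  · have hbound : ∀ s, 1 ≤ s → s ≤ S → ∀ R,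
        IsBoundedInverse (shift (σ * Complex.I * s) (schrodinger V)) R → ‖R‖ ≤ B :=
      fun s hs hsS R hR => R.opNorm_le_bound hB fun f =>
        hapriori s hs hsS σ hσ (R f) f (hR.mem_graph f)
    obtain ⟨R₀, hR₀, -⟩ := hlarge S le_rfl σ hσ
    obtain ⟨R, hR⟩ := exists_isBoundedInverse_of_norm_le hσ hB ⟨R₀, hR₀⟩ hbound hs h
    refine ⟨R, hR, (hbound s hs h R hR).trans ?_⟩
    rw [le_div_iff₀ (by linarith)]
    calc B * s ≤ B * S := by gcongr
      _ ≤ _ := le_add_of_nonneg_left (by positivity)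

theorem exists_resolvents_imaginary {q : ℝ≥0∞} (hq : 1 < q) (hV : Measurable V)
    (hVq : MemLp V q) : ∃ B : ℝ, 0 ≤ B ∧ ∀ s : ℝ, 1 ≤ s → ∃ R S,
      IsBoundedInverse (shift (Complex.I * s) (schrodinger V)) R ∧
      IsBoundedInverse (shift (-(Complex.I * s)) (schrodinger V)) S ∧
      ‖R‖ ≤ B / s ∧ ‖S‖ ≤ B / s := by
  obtain ⟨B, hB, hres⟩ := exists_resolvent_imaginary hq hV hVq
  refine ⟨B, hB, fun s hs => ?_⟩
  obtain ⟨R, hR, hRB⟩ := hres s hs 1 (one_pow 2)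
  obtain ⟨S, hS, hSB⟩ := hres s hs (-1) (by norm_num)
  refine ⟨R, S, ?_, ?_, hRB, hSB⟩
  · simpa using hR
  · simpa using hS

theorem add_one_eq_neg_I_mul_sqrt_sq {t : ℝ} (ht : 0 ≤ t) :
    (t + 1 : ℂ) = -((Complex.I * √(1 + t)) * (Complex.I * √(1 + t))) := by
  have h : (√(1 + t) : ℂ) ^ 2 = 1 + t := by exact_mod_cast Real.sq_sqrt (by linarith)
  linear_combination -h + (√(1 + t) : ℂ) ^ 2 * Complex.I_sq

theorem norm_mul_le_div_one_add {X : Type*} [NormedAddCommGroup X] [NormedSpace ℂ X]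
    {R S : X →L[ℂ] X} {B t : ℝ} (hB : 0 ≤ B) (ht : 0 ≤ t) (hR : ‖R‖ ≤ B / √(1 + t))
    (hS : ‖S‖ ≤ B / √(1 + t)) : ‖S * R‖ ≤ B ^ 2 / (1 + t) :=
  calc ‖S * R‖ ≤ ‖S‖ * ‖R‖ := norm_mul_le _ _
    _ ≤ (B / √(1 + t)) * (B / √(1 + t)) := by gcongr
    _ = B ^ 2 / (1 + t) := by
        rw [div_mul_div_comm, Real.mul_self_sqrt (by linarith), ← pow_two]

theorem isPositiveOperator_oneAddSq {q : ℝ≥0∞} (hq : 1 < q) (hV : Measurable V)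
    (hVq : MemLp V q) : IsPositiveOperator (oneAddSq V) := by
  obtain ⟨B, hB, hres⟩ := exists_resolvents_imaginary hq hV hVq
  refine ⟨B ^ 2, fun t ht => ?_⟩
  obtain ⟨R, S, hR, hS, hRB, hSB⟩ := hres √(1 + t) (Real.one_le_sqrt.2 (by linarith))
  exact ⟨S * R, hR.shift_one_add_sq hS (add_one_eq_neg_I_mul_sqrt_sq ht),
    norm_mul_le_div_one_add hB ht hRB hSB⟩

end Positivity

/-! ### Bessel potentials as integrals of free resolvents -/

section Bessel

variable {β t τ : ℝ}

theorem one_add_mul_one_re (t : ℝ) : ((1 + t : ℂ) * 1).re = 1 + t := by simp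

theorem one_add_mul_one_re_pos (ht : 0 ≤ t) : 0 < ((1 + t : ℂ) * 1).re := by
  rw [one_add_mul_one_re]
  linarith

/-- The resolvent `(1 - Δ + τ)⁻¹` on `L¹`. -/
def besselResolvent (τ : ℝ) : L1 →L[ℂ] L1 :=
  boundedInverse (shift (τ : ℂ) (shift 1 (-laplacianL1)))

theorem isBoundedInverse_one_sub_laplacianL1 (ht : 0 ≤ t) :
    IsBoundedInverse (shift (t : ℂ) (shift 1 (-laplacianL1)))
      (freeResolvent (1 + t) 1 (one_add_mul_one_re_pos ht) one_half_le_inv_one) := by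
  rw [shift_shift, add_comm (t : ℂ)]
  exact isBoundedInverse_freeResolvent _ _

theorem besselResolvent_eq (hτ : 0 ≤ τ) : besselResolvent τ =
    freeResolvent (1 + τ) 1 (one_add_mul_one_re_pos hτ) one_half_le_inv_one :=
  (isBoundedInverse_one_sub_laplacianL1 hτ).boundedInverse_eq

theorem norm_besselResolvent_le (hτ : 0 ≤ τ) : ‖besselResolvent τ‖ ≤ 16 * Real.pi / (1 + τ) := by
  have h := norm_freeResolvent_le (one_add_mul_one_re_pos hτ) one_half_le_inv_one
  rwa [one_add_mul_one_re, ← besselResolvent_eq hτ] at h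

theorem isPositiveOperator_one_sub_laplacianL1 : IsPositiveOperator (shift 1 (-laplacianL1)) := by
  refine ⟨16 * Real.pi, fun t ht => ⟨_, isBoundedInverse_one_sub_laplacianL1 ht, ?_⟩⟩
  rw [← besselResolvent_eq ht]
  exact norm_besselResolvent_le ht

theorem fourierAt_besselResolvent (hτ : 0 ≤ τ) (f : L1) (ξ : Plane) :
    fourierAt ξ (besselResolvent τ f) =
      (((1 + laplaceSymbol ξ + τ)⁻¹ : ℝ) : ℂ) * fourierAt ξ f := by
  rw [besselResolvent_eq hτ, fourierAt_freeResolvent]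
  push_cast
  ring

theorem integrableOn_rpow_smul_besselResolvent (hβ : 0 < β) (hβ1 : β < 1) :
    IntegrableOn (fun τ : ℝ => τ ^ (-β) • besselResolvent τ) (Ioi 0) := by
  obtain ⟨M, hM⟩ := isPositiveOperator_one_sub_laplacianL1.exists_isResolventFamily
  exact hM.integrableOn_rpow_smul hβ hβ1

/-- The normalising constant `π / sin (π β)` of Balakrishnan's formula for `(1 - Δ) ^ (-β)`, as an
integral. -/
def besselConst (β : ℝ) : ℝ := ∫ τ in Ioi (0 : ℝ), τ ^ (-β) * (1 + τ)⁻¹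

theorem besselConst_pos (hβ : 0 < β) (hβ1 : β < 1) : 0 < besselConst β := by
  have h_int : IntegrableOn (fun τ : ℝ => τ ^ (-β) * (1 + τ)⁻¹) (Ioi 0) := by
    have h := integrableOn_Ioi_rpow_mul_one_add_rpow (a := -β) (b := -1) (by linarith)
      (by linarith)
    simpa only [Real.rpow_neg_one] using h
  have hpos : ∀ τ ∈ Ioi (0 : ℝ), 0 < τ ^ (-β) * (1 + τ)⁻¹ := fun τ (hτ : 0 < τ) => by positivity
  rw [besselConst, setIntegral_pos_iff_support_of_nonneg_ae _ h_int]
  · have hsupp : Ioi 0 ⊆ Function.support fun τ : ℝ => τ ^ (-β) * (1 + τ)⁻¹ :=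
      fun τ hτ => (hpos τ hτ).ne'
    rw [inter_eq_right.2 hsupp]
    simp
  · filter_upwards [ae_restrict_mem measurableSet_Ioi] with τ hτ using (hpos τ hτ).le

theorem integral_rpow_mul_add_inv (β : ℝ) {b : ℝ} (hb : 0 < b) :
    ∫ τ in Ioi (0 : ℝ), τ ^ (-β) * (b + τ)⁻¹ = b ^ (-β) * besselConst β := by
  have hscale := integral_comp_mul_left_Ioi (fun τ : ℝ => τ ^ (-β) * (b + τ)⁻¹) 0 hb
  rw [mul_zero, smul_eq_mul] at hscale
  refine (mul_left_cancel₀ (inv_ne_zero hb.ne') (Eq.trans ?_ hscale)).symm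
  rw [besselConst, ← integral_const_mul, ← integral_const_mul]
  refine setIntegral_congr_fun measurableSet_Ioi fun τ (hτ : 0 < τ) => ?_
  rw [Real.mul_rpow hb.le hτ.le, show b + b * τ = b * (1 + τ) by ring, mul_inv]
  ring

/-- The operator `(1 - Δ) ^ (-β)` on `L¹`. -/
def besselOp (β : ℝ) : L1 →L[ℂ] L1 := (besselConst β)⁻¹ • resolventIntegral besselResolvent β

theorem map_besselOp (hβ : 0 < β) (hβ1 : β < 1) {F : Type*} [NormedAddCommGroup F]
    [NormedSpace ℂ F] [CompleteSpace F] (T : L1 →L[ℂ] F) (f : L1) : T (besselOp β f) =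
      (besselConst β)⁻¹ • ∫ τ in Ioi (0 : ℝ), τ ^ (-β) • T (besselResolvent τ f) := by
  have h := (T.comp (ContinuousLinearMap.apply ℂ L1 f)).integral_comp_comm
    (integrableOn_rpow_smul_besselResolvent hβ hβ1)
  have hsmul (τ : ℝ) : (T.comp (ContinuousLinearMap.apply ℂ L1 f)) (τ ^ (-β) • besselResolvent τ) =
      τ ^ (-β) • T (besselResolvent τ f) := by
    change T ((τ ^ (-β) • besselResolvent τ) f) = _
    rw [_root_.smul_apply, T.map_smul_of_tower]
  simp only [hsmul] at h
  rw [h]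
  exact T.map_smul_of_tower (besselConst β)⁻¹ (resolventIntegral besselResolvent β f)

theorem norm_map_besselOp_le (hβ : 0 < β) (hβ1 : β < 1) {F : Type*} [NormedAddCommGroup F]
    [NormedSpace ℂ F] [CompleteSpace F] (T : L1 →L[ℂ] F) (f : L1) {φ : ℝ → ℝ}
    (hφ : IntegrableOn (fun τ => τ ^ (-β) * φ τ) (Ioi 0))
    (h : ∀ τ, 0 < τ → ‖T (besselResolvent τ f)‖ ≤ φ τ) :
    ‖T (besselOp β f)‖ ≤ (besselConst β)⁻¹ * ∫ τ in Ioi (0 : ℝ), τ ^ (-β) * φ τ := by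
  have hc := besselConst_pos hβ hβ1
  rw [map_besselOp hβ hβ1, norm_smul, Real.norm_of_nonneg (by positivity)]
  gcongr
  refine norm_integral_le_of_norm_le hφ ?_
  filter_upwards [ae_restrict_mem measurableSet_Ioi] with τ (hτ : 0 < τ)
  rw [norm_smul, Real.norm_of_nonneg (by positivity)]
  gcongr
  exact h τ hτ

theorem isBesselPotential_besselOp (hβ : 0 < β) (hβ1 : β < 1) (f : L1) :
    IsBesselPotential β f (besselOp β f) := by
  rw [isBesselPotential_iff_fourierAt]
  intro ξ
  have hb : 0 < 1 + laplaceSymbol ξ := by linarith [laplaceSymbol_nonneg ξ]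
  have hc : (besselConst β : ℂ) ≠ 0 := Complex.ofReal_ne_zero.2 (besselConst_pos hβ hβ1).ne'
  have hintegral : ∫ τ in Ioi (0 : ℝ), τ ^ (-β) • fourierAt ξ (besselResolvent τ f) =
      (((1 + laplaceSymbol ξ) ^ (-β) * besselConst β : ℝ) : ℂ) * fourierAt ξ f := by
    rw [← integral_rpow_mul_add_inv β hb, ← integral_complex_ofReal, ← integral_mul_const]
    refine setIntegral_congr_fun measurableSet_Ioi fun τ (hτ : 0 < τ) => ?_
    rw [fourierAt_besselResolvent hτ.le, Complex.real_smul]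
    push_cast
    ring
  rw [map_besselOp hβ hβ1, hintegral, Complex.real_smul]
  push_cast
  field_simp

end Bessel

/-! ### The mapping property of `⟨H⟩ ^ α` -/

section Mapping

variable {V : Plane → ℝ}

/-- With `c = i √(1 + t)` and `e = i` the coefficient `c ^ 2 - e ^ 2` is `-t`. The right-hand side
gains a factor `c⁻¹` over the left-hand side, at the price of applying `A` once. -/
theorem IsBoundedInverse.add_smul_apply_apply {X : Type*} [NormedAddCommGroup X] [NormedSpace ℂ X]
    {A : X →ₗ.[ℂ] X} {R S : X →L[ℂ] X} {c : ℂ} (hR : IsBoundedInverse (shift c A) R)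
    (hS : IsBoundedInverse (shift (-c) A) S) {v w : X} (hv : (v, w) ∈ A.graph) (e : ℂ) :
    v + (c ^ 2 - e ^ 2) • S (R v) = R (w + e • v) + (c - e) • S (R (w + e • v)) := by
  have hRw : R (w + e • v) = v - (c - e) • R v := by
    have hRv : R (c • v + w) = v := hR.apply_eq (mem_shift_graph.2 ⟨w, hv, rfl⟩)
    rw [eq_sub_iff_add_eq, ← map_smul, ← map_add]
    nth_rewrite 3 [← hRv]
    congr 1
    module
  have hSR : S v = R v + (2 * c) • S (R v) := by
    have h : S v - R v = (c - -c) • S (R v) :=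
      congrArg (fun T : X →L[ℂ] X => T v) (hS.resolvent_identity hR)
    rw [eq_add_of_sub_eq' h]
    module
  rw [hRw, map_sub, map_smul, hSR]
  module

theorem norm_sub_smul_mul_apply_le {X : Type*} [NormedAddCommGroup X] [NormedSpace ℂ X]
    {R S : X →L[ℂ] X} {B t : ℝ} (hB : 0 ≤ B) (ht : 0 ≤ t) (hRB : ‖R‖ ≤ B / √(1 + t))
    (hSB : ‖S‖ ≤ B / √(1 + t)) (v : X) : ‖v - t • (S * R) v‖ ≤ (1 + B ^ 2) * ‖v‖ := by
  have hSR : ‖t • (S * R) v‖ ≤ B ^ 2 * ‖v‖ := by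
    rw [norm_smul, Real.norm_of_nonneg ht]
    calc t * ‖(S * R) v‖ ≤ t * (B ^ 2 / (1 + t) * ‖v‖) := by
          gcongr
          exact (S * R).le_of_opNorm_le (norm_mul_le_div_one_add hB ht hRB hSB) v
      _ = t / (1 + t) * (B ^ 2 * ‖v‖) := by ring
      _ ≤ B ^ 2 * ‖v‖ :=
          mul_le_of_le_one_left (by positivity) ((div_le_one (by linarith)).2 (by linarith))
  calc _ ≤ ‖v‖ + B ^ 2 * ‖v‖ := (norm_sub_le _ _).trans (by gcongr)
    _ = (1 + B ^ 2) * ‖v‖ := by ring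

theorem IsBoundedInverse.norm_sub_smul_mul_apply_le {X : Type*} [NormedAddCommGroup X]
    [NormedSpace ℂ X] {A : X →ₗ.[ℂ] X} {R S : X →L[ℂ] X} {B t : ℝ} (ht : 0 ≤ t)
    (hR : IsBoundedInverse (shift (Complex.I * √(1 + t)) A) R)
    (hS : IsBoundedInverse (shift (-(Complex.I * √(1 + t))) A) S)
    (hRB : ‖R‖ ≤ B / √(1 + t)) (hSB : ‖S‖ ≤ B / √(1 + t)) {v w : X} (hvw : (v, w) ∈ A.graph) :
    ‖v - t • (S * R) v‖ ≤ (B + B ^ 2) * (‖w‖ + ‖v‖) / √(1 + t) := by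
  have hs : 1 ≤ √(1 + t) := Real.one_le_sqrt.2 (by linarith)
  have hid : v - t • (S * R) v = R (w + Complex.I • v) +
      (Complex.I * √(1 + t) - Complex.I) • S (R (w + Complex.I • v)) := by
    rw [← hR.add_smul_apply_apply hS hvw, Complex.I_sq, sub_eq_add_neg, ← neg_smul,
      ← Complex.coe_smul]
    congr 2
    push_cast
    linear_combination -add_one_eq_neg_I_mul_sqrt_sq ht
  have hcoeff : ‖Complex.I * √(1 + t) - Complex.I‖ ≤ √(1 + t) := by
    rw [← mul_sub_one, norm_mul, Complex.norm_I, one_mul, ← Complex.ofReal_one,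
      ← Complex.ofReal_sub, Complex.norm_of_nonneg (by linarith)]
    linarith
  have hB : 0 ≤ B := by
    simpa using (le_div_iff₀ (by linarith)).1 ((norm_nonneg R).trans hRB)
  set k := w + Complex.I • v
  have hk : ‖k‖ ≤ ‖w‖ + ‖v‖ :=
    (norm_add_le _ _).trans_eq (by rw [norm_smul, Complex.norm_I, one_mul])
  have hRk := R.le_of_opNorm_le hRB k
  have hSRk : ‖S (R k)‖ ≤ B / √(1 + t) * (B / √(1 + t) * ‖k‖) :=
    (S.le_of_opNorm_le hSB _).trans (by gcongr)
  calc _ ≤ ‖R k‖ + ‖(Complex.I * √(1 + t) - Complex.I) • S (R k)‖ := by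
        rw [hid]
        exact norm_add_le _ _
    _ ≤ B / √(1 + t) * ‖k‖ + √(1 + t) * (B / √(1 + t) * (B / √(1 + t) * ‖k‖)) := by
        rw [norm_smul]
        gcongr
    _ = (B + B ^ 2) * ‖k‖ / √(1 + t) := by field_simp
    _ ≤ (B + B ^ 2) * (‖w‖ + ‖v‖) / √(1 + t) := by gcongr

theorem exists_norm_sub_smul_boundedInverse_le {q : ℝ≥0∞} (hq : 1 < q) (hV : Measurable V)
    (hVq : MemLp V q) : ∃ K : ℝ, 0 ≤ K ∧ ∀ t : ℝ, 0 ≤ t →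
      (∀ v, ‖v - t • boundedInverse (shift (t : ℂ) (oneAddSq V)) v‖ ≤ K * ‖v‖) ∧
      ∀ v w, (v, w) ∈ (schrodinger V).graph →
        ‖v - t • boundedInverse (shift (t : ℂ) (oneAddSq V)) v‖ ≤
          K * (‖w‖ + ‖v‖) / √(1 + t) := by
  obtain ⟨B, hB, hres⟩ := exists_resolvents_imaginary hq hV hVq
  refine ⟨1 + B + B ^ 2, by positivity, fun t ht => ?_⟩
  obtain ⟨R, S, hR, hS, hRB, hSB⟩ := hres _ (Real.one_le_sqrt.2 (by linarith : 1 ≤ 1 + t))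
  rw [oneAddSq, (hR.shift_one_add_sq hS (add_one_eq_neg_I_mul_sqrt_sq ht)).boundedInverse_eq]
  refine ⟨fun v => (norm_sub_smul_mul_apply_le hB ht hRB hSB v).trans ?_,
    fun v w hvw => (hR.norm_sub_smul_mul_apply_le ht hS hRB hSB hvw).trans ?_⟩
  all_goals
    gcongr
    linarith

theorem KatoBound.exists_schrodinger_besselResolvent {C a : ℝ} (hV : KatoBound V C a) :
    ∃ K : ℝ, 0 ≤ K ∧ ∀ τ : ℝ, 0 ≤ τ → ∀ f, ∃ w,
      (besselResolvent τ f, w) ∈ (schrodinger V).graph ∧ ‖w‖ ≤ K * ‖f‖ := by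
  have hC := hV.nonneg
  refine ⟨1 + 16 * Real.pi + C, by positivity, fun τ hτ f => ?_⟩
  obtain ⟨T, hT, hTC⟩ :=
    hV.exists_mul_freeResolvent (one_add_mul_one_re_pos hτ) one_half_le_inv_one
  rw [one_add_mul_one_re] at hTC
  have hTf : ‖T f‖ ≤ C * ‖f‖ := T.le_of_opNorm_le (hTC.trans (mul_le_of_le_one_right hC
    (Real.rpow_le_one (by positivity) ((div_le_one (by linarith)).2 (by linarith)) hV.pos.le))) f
  have hfree : (besselResolvent τ f, f) ∈ (shift (1 + τ : ℂ) (-laplacianL1)).graph := by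
    rw [besselResolvent_eq hτ]
    exact (isBoundedInverse_freeResolvent _ _).mem_graph f
  obtain ⟨y, hy, hyf⟩ := mem_shift_graph.1 hfree
  have hyn : ‖y‖ ≤ ‖f‖ + 16 * Real.pi * ‖f‖ := by
    rw [eq_sub_of_add_eq' hyf, ← Complex.ofReal_one, ← Complex.ofReal_add]
    refine (norm_sub_le _ _).trans ?_
    rw [norm_smul, Complex.norm_of_nonneg (by positivity)]
    gcongr ‖f‖ + ?_
    calc (1 + τ) * ‖besselResolvent τ f‖ ≤ (1 + τ) * (16 * Real.pi / (1 + τ) * ‖f‖) := by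
          gcongr
          exact ContinuousLinearMap.le_of_opNorm_le _ (norm_besselResolvent_le hτ) f
      _ = 16 * Real.pi * ‖f‖ := by field_simp
  refine ⟨y + T f, mem_add_graph.2 ⟨y, T f, hy, ?_, rfl⟩, ?_⟩
  · rw [besselResolvent_eq hτ]
    exact hT f
  · calc ‖y + T f‖ ≤ (‖f‖ + 16 * Real.pi * ‖f‖) + C * ‖f‖ := norm_add_le_of_le hyn hTf
      _ = _ := by ring

theorem le_mul_rpow_mul_rpow_of_le_div {X K a b θ : ℝ} (hX : 0 ≤ X) (hK : 0 ≤ K) (ha : 0 < a)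
    (hb : 0 < b) (hθ : 0 ≤ θ) (hθ1 : θ ≤ 1) (hXa : X ≤ K / a) (hXb : X ≤ K / b) :
    X ≤ K * (a ^ (-(1 - θ)) * b ^ (-θ)) := by
  have hsplit {y : ℝ} (hy : 0 ≤ y) : y ^ (1 - θ) * y ^ θ = y := by
    rw [← Real.rpow_add' hy (by norm_num), sub_add_cancel, Real.rpow_one]
  calc X = X ^ (1 - θ) * X ^ θ := (hsplit hX).symm
    _ ≤ (K / a) ^ (1 - θ) * (K / b) ^ θ := by
        have := sub_nonneg.2 hθ1
        gcongr
    _ = (K ^ (1 - θ) * K ^ θ) * (a ^ (-(1 - θ)) * b ^ (-θ)) := by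
        rw [Real.div_rpow hK ha.le, Real.div_rpow hK hb.le, Real.rpow_neg ha.le,
          Real.rpow_neg hb.le]
        ring
    _ = _ := by rw [hsplit hK]

theorem exists_norm_besselResolvent_sub_le {q : ℝ≥0∞} (hq : 1 < q) (hV : Measurable V)
    (hVq : MemLp V q) {θ : ℝ} (hθ : 0 ≤ θ) (hθ1 : θ ≤ 1) :
    ∃ K : ℝ, 0 ≤ K ∧ ∀ τ t : ℝ, 0 ≤ τ → 0 ≤ t → ∀ f,
      ‖besselResolvent τ f - t • boundedInverse (shift (t : ℂ) (oneAddSq V))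
        (besselResolvent τ f)‖ ≤
        K * ‖f‖ * ((1 + τ) ^ (-(1 - θ)) * (1 + t) ^ (-(θ / 2))) := by
  obtain ⟨B, hB, hest⟩ := exists_norm_sub_smul_boundedInverse_le hq hV hVq
  obtain ⟨C, a, hC⟩ := exists_katoBound hq hV hVq
  obtain ⟨L, hL, hmem⟩ := hC.exists_schrodinger_besselResolvent
  refine ⟨B * (L + 16 * Real.pi), by positivity, fun τ t hτ ht f => ?_⟩
  obtain ⟨w, hw, hwL⟩ := hmem τ hτ f
  obtain ⟨hbdd, hdecay⟩ := hest t ht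
  have hv := (besselResolvent τ).le_of_opNorm_le (norm_besselResolvent_le hτ) f
  have hsqrt : √(1 + t) ^ (-θ) = (1 + t) ^ (-(θ / 2)) := by
    rw [Real.sqrt_eq_rpow, ← Real.rpow_mul (by linarith)]
    ring_nf
  rw [← hsqrt]
  refine le_mul_rpow_mul_rpow_of_le_div (norm_nonneg _) (by positivity) (by linarith)
    (Real.sqrt_pos.2 (by linarith)) hθ hθ1 ?_ ?_
  · calc _ ≤ B * (16 * Real.pi / (1 + τ) * ‖f‖) := (hbdd _).trans (by gcongr)
      _ = B * (0 + 16 * Real.pi) * ‖f‖ / (1 + τ) := by ring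
      _ ≤ _ := by gcongr
  · have hv' : ‖besselResolvent τ f‖ ≤ 16 * Real.pi * ‖f‖ :=
      hv.trans (by gcongr; exact div_le_self (by positivity) (by linarith))
    calc _ ≤ B * (L * ‖f‖ + 16 * Real.pi * ‖f‖) / √(1 + t) :=
          (hdecay _ w hw).trans (by gcongr)
      _ = _ := by ring

theorem exists_norm_besselOp_sub_le {q : ℝ≥0∞} (hq : 1 < q) (hV : Measurable V)
    (hVq : MemLp V q) {β θ : ℝ} (hθ : 0 ≤ θ) (hθβ : θ < β) (hβ1 : β < 1) :
    ∃ K : ℝ, 0 ≤ K ∧ ∀ t : ℝ, 0 ≤ t → ∀ f,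
      ‖besselOp β f - t • boundedInverse (shift (t : ℂ) (oneAddSq V)) (besselOp β f)‖ ≤
        K * ‖f‖ * (1 + t) ^ (-(θ / 2)) := by
  obtain ⟨K, hK, hdecay⟩ := exists_norm_besselResolvent_sub_le hq hV hVq hθ (by linarith)
  have hβ : 0 < β := hθ.trans_lt hθβ
  have hc := besselConst_pos hβ hβ1
  have h_int := integrableOn_Ioi_rpow_mul_one_add_rpow (a := -β) (b := -(1 - θ)) (by linarith)
    (by linarith)
  set J := ∫ τ in Ioi (0 : ℝ), τ ^ (-β) * (1 + τ) ^ (-(1 - θ))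
  have hJ : 0 ≤ J := setIntegral_nonneg measurableSet_Ioi fun τ (hτ : 0 < τ) => by positivity
  refine ⟨(besselConst β)⁻¹ * (K * J), by positivity, fun t ht f => ?_⟩
  set T : L1 →L[ℂ] L1 := 1 - t • boundedInverse (shift (t : ℂ) (oneAddSq V))
  have hφ (τ : ℝ) : τ ^ (-β) * (K * ‖f‖ * ((1 + τ) ^ (-(1 - θ)) * (1 + t) ^ (-(θ / 2)))) =
      K * ‖f‖ * (1 + t) ^ (-(θ / 2)) * (τ ^ (-β) * (1 + τ) ^ (-(1 - θ))) := by ring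
  have hT := norm_map_besselOp_le hβ hβ1 T f (by simp only [hφ]; exact h_int.const_mul _)
    fun τ hτ => hdecay τ t hτ.le ht f
  simp only [hφ, integral_const_mul] at hT
  calc ‖T (besselOp β f)‖ ≤ (besselConst β)⁻¹ * (K * ‖f‖ * (1 + t) ^ (-(θ / 2)) * J) := hT
    _ = (besselConst β)⁻¹ * (K * J) * ‖f‖ * (1 + t) ^ (-(θ / 2)) := by ring

theorem mulL1_congr {V W : Plane → ℝ} (h : V =ᵐ[volume] W) : mulL1 V = mulL1 W := by
  have hgraph : mulGraph V = mulGraph W := by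
    ext p
    change (⇑p.2 =ᵐ[volume] fun x => (V x : ℂ) * p.1 x) ↔
      ⇑p.2 =ᵐ[volume] fun x => (W x : ℂ) * p.1 x
    refine Filter.EventuallyEq.congr_right ?_
    filter_upwards [h] with x hx
    rw [hx]
  rw [mulL1, mulL1, hgraph]

theorem oneAddSq_congr {V W : Plane → ℝ} (h : V =ᵐ[volume] W) : oneAddSq V = oneAddSq W := by
  rw [oneAddSq, oneAddSq, schrodinger, schrodinger, mulL1_congr h]

end Mapping

end SchrodingerL1

end

theorem lemmaC1 (q : ENNReal) (hq : 1 < q) (V : SchrodingerL1.Plane → ℝ)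
    (hV : MeasureTheory.MemLp V q MeasureTheory.volume)
    (α β : ℝ) (hα : 0 < α) (hαβ : α < β) (hβ : β < 1) :
    SchrodingerL1.IsPositiveOperator (SchrodingerL1.oneAddSq V) ∧
    Function.Injective (SchrodingerL1.negPow (SchrodingerL1.oneAddSq V) (α / 2)) ∧
    ∃ C : ℝ, ∀ f : SchrodingerL1.L1, ∃ u : (SchrodingerL1.japanesePow V α).domain,
      SchrodingerL1.IsBesselPotential β f u ∧
      ‖SchrodingerL1.japanesePow V α u‖ ≤ C * ‖f‖ := by
  obtain ⟨W, hW, hVW⟩ : ∃ W, Measurable W ∧ V =ᵐ[volume] W :=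
    ⟨hV.1.mk V, hV.1.stronglyMeasurable_mk.measurable, hV.1.ae_eq_mk⟩
  have hWq : MemLp W q := (memLp_congr_ae hVW).1 hV
  rw [SchrodingerL1.japanesePow, SchrodingerL1.oneAddSq_congr hVW]
  have hpos := SchrodingerL1.isPositiveOperator_oneAddSq hq hW hWq
  have hp : 0 < α / 2 := by linarith
  have hp1 : α / 2 < 1 := by linarith
  obtain ⟨K, -, hdecay⟩ := SchrodingerL1.exists_norm_besselOp_sub_le hq hW hWq
    (θ := (α + β) / 2) (by linarith) (by linarith) hβ
  obtain ⟨L, hL⟩ := hpos.exists_fracPow_eq hp hp1 (δ := (β - α) / 4) (by linarith)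
  refine ⟨hpos, hpos.negPow_injective hp hp1, L * K, fun f => ?_⟩
  obtain ⟨u, hu, hun⟩ := hL (K * ‖f‖) (SchrodingerL1.besselOp β f) fun t ht =>
    (hdecay t ht.le f).trans_eq (by ring_nf)
  rw [← mul_assoc] at hun
  exact ⟨u, hu ▸ SchrodingerL1.isBesselPotential_besselOp (by linarith) hβ f, hun⟩
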